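/- **Setting.** Let $(M,\omega)$ be a symplectic manifold (finite-dimensional, Hausdorff, $\sigma$-compact, without boundary, not necessarily compact), with Poisson bracket $\{\cdot,\cdot\}$, and let $\|\cdot\|$ denote the supremum norm of functions on $M$. All maps from $M$ to $\mathbb R^2$ below are $C^\infty$. Let $\Delta\subset\mathbb R^2$ be any compact convex set of area $1$ whose boundary is smooth or polygonal, and let $p_1,p_2,p_3\in\partial\Delta$ be distinct points in counterclockwise order. Let $\gamma_i\subset\partial\Delta$ be the closed arc running counterclockwise from $p_i$ to $p_{i+1}$ (indices mod $3$). For compact $X_1,X_2,X_3\subset M$, let $Pb_3(X_1,X_2,X_3)$ be the infimum of $\|\{\Phi_1,\Phi_2\}\|$ over all maps $\Phi=(\Phi_1,\Phi_2)\colon M\to\Delta$ such that $\Phi-p$ has compact support for some $p\in\Delta$ and each $X_i$ has an open neighbourhood $U_i$ with $\Phi(U_i)\subseteq\gamma_i$. For a compact set $X\subset M$, let $H^1(X;\mathbb Z)\cong[X:S^1]$ be the set of homotopy classes of continuous maps $X\to S^1$. For $r>0$ let $\overline D_r\subset\mathbb R^2$ be the closed disc of radius $r$ centred at $0$; its boundary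 circle is identified with $S^1$ by scaling. For $\alpha\in[X:S^1]$, let $Pb_X^{(r)}(\alpha)$ be the infimum of $\|\{\phi_1,\phi_2\}\|$ over all compactly supported maps $\phi=(\phi_1,\phi_2)\colon M\to\overline D_r$ for which there is an open $U\supset X$ with $\phi(U)\subseteq\partial\overline D_r$ and $[\phi|_X]=\alpha$. Write $Pb_X(\alpha):=Pb_X^{(1/\sqrt\pi)}(\alpha)$, the invariant defined with the round disc of area $1$. **Theorem.** Let $X_1,X_2,X_3\subset M$ be compact with $X_1\cap X_2\cap X_3=\emptyset$, and let $X=X_1\cup X_2\cup X_3$. There is exactly one class $\alpha\in[X:S^1]$ that is represented by a map $f\colon X\to S^1$ for which there is a division of $S^1$ into three consecutive arcs $\beta_1,\beta_2,\beta_3$, ordered counterclockwise, with $f(X_i)\subseteq\beta_i$ for $i=1,2,3$. For this class, and for every choice of $(\Delta,p_1,p_2,p_3)$ as above, $$Pb_3(X_1,X_2,X_3)=Pb_X(\alpha).$$ Equivalently, in terms of the disc of radius $1$, $\;Pb_X^{(1)}(\alpha)=\pi\cdot Pb_3(X_1,X_2,X_3)$. -/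

import Mathlib

open scoped Manifold ContDiff

noncomputable section

/-! ### Symplectic manifolds and the Poisson bracket -/

/-- A field of alternating bilinear forms on the tangent spaces of `M`. -/
abbrev TwoFormField (E M : Type*) [NormedAddCommGroup E] [NormedSpace ℝ E]
    [TopologicalSpace M] [ChartedSpace E M] :=
  ∀ x : M, TangentSpace 𝓘(ℝ, E) x [⋀^Fin 2]→L[ℝ] ℝ

/-- The expression of `Ω` in the chart around `x₀`: the pullback of `Ω` by the inverse chart.
Only its values on the (open) target of the chart are meaningful. -/
def inChart {E M : Type*} [NormedAddCommGroup E] [NormedSpace ℝ E]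
    [TopologicalSpace M] [ChartedSpace E M] (Ω : TwoFormField E M) (x₀ : M) (y : E) :
    E [⋀^Fin 2]→L[ℝ] ℝ :=
  (Ω ((chartAt E x₀).symm y)).compContinuousLinearMap
    (mfderiv 𝓘(ℝ, E) 𝓘(ℝ, E) (chartAt E x₀).symm y :
      E →L[ℝ] TangentSpace 𝓘(ℝ, E) ((chartAt E x₀).symm y))

/-- A symplectic form on a manifold without boundary modelled on `E`: a smooth, closed,
non-degenerate differential 2-form. -/
structure SymplecticForm (E M : Type*) [NormedAddCommGroup E] [NormedSpace ℝ E]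
    [TopologicalSpace M] [ChartedSpace E M] where
  form : TwoFormField E M
  smooth : ∀ x₀ : M, ContDiffOn ℝ ∞ (inChart form x₀) (chartAt E x₀).target
  closed : ∀ x₀ : M, ∀ y ∈ (chartAt E x₀).target, extDeriv (inChart form x₀) y = 0
  nondegenerate : ∀ (x : M) (v : TangentSpace 𝓘(ℝ, E) x),
    (∀ w : TangentSpace 𝓘(ℝ, E) x, form x ![v, w] = 0) → v = 0

theorem SymplecticForm.exists_unique_dual {E M : Type*} [NormedAddCommGroup E] [NormedSpace ℝ E]
    [FiniteDimensional ℝ E] [TopologicalSpace M] [ChartedSpace E M] (Ω : SymplecticForm E M)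
    (x : M) (l : TangentSpace 𝓘(ℝ, E) x →L[ℝ] ℝ) :
    ∃! v : TangentSpace 𝓘(ℝ, E) x, ∀ w : TangentSpace 𝓘(ℝ, E) x, Ω.form x ![v, w] = l w := by
  have : FiniteDimensional ℝ (TangentSpace 𝓘(ℝ, E) x) := inferInstanceAs (FiniteDimensional ℝ E)
  have e0 : ∀ v w a : TangentSpace 𝓘(ℝ, E) x, Function.update ![v, w] 0 a = ![a, w] := by
    intro v w a
    ext i
    fin_cases i <;> rfl
  have e1 : ∀ v w a : TangentSpace 𝓘(ℝ, E) x, Function.update ![v, w] 1 a = ![v, a] := by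
    intro v w a
    ext i
    fin_cases i <;> rfl
  have hadd : ∀ v v' w : TangentSpace 𝓘(ℝ, E) x,
      Ω.form x ![v + v', w] = Ω.form x ![v, w] + Ω.form x ![v', w] := by
    intro v v' w
    simpa only [e0, smul_eq_mul] using (Ω.form x).map_update_add ![v, w] 0 v v'
  have hsmul : ∀ (c : ℝ) (v w : TangentSpace 𝓘(ℝ, E) x),
      Ω.form x ![c • v, w] = c * Ω.form x ![v, w] := by
    intro c v w
    simpa only [e0, smul_eq_mul] using (Ω.form x).map_update_smul ![v, w] 0 c v
  have hadd' : ∀ v w w' : TangentSpace 𝓘(ℝ, E) x,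
      Ω.form x ![v, w + w'] = Ω.form x ![v, w] + Ω.form x ![v, w'] := by
    intro v w w'
    simpa only [e1, smul_eq_mul] using (Ω.form x).map_update_add ![v, w] 1 w w'
  have hsmul' : ∀ (c : ℝ) (v w : TangentSpace 𝓘(ℝ, E) x),
      Ω.form x ![v, c • w] = c * Ω.form x ![v, w] := by
    intro c v w
    simpa only [e1, smul_eq_mul] using (Ω.form x).map_update_smul ![v, w] 1 c w
  let flat : TangentSpace 𝓘(ℝ, E) x →ₗ[ℝ] Module.Dual ℝ (TangentSpace 𝓘(ℝ, E) x) :=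
    LinearMap.mk₂ ℝ (fun v w => Ω.form x ![v, w]) hadd hsmul hadd' hsmul'
  have hinj : Function.Injective flat := by
    rw [injective_iff_map_eq_zero]
    intro v hv
    exact Ω.nondegenerate x v fun w => LinearMap.congr_fun hv w
  have hsurj : Function.Surjective flat :=
    (LinearMap.injective_iff_surjective_of_finrank_eq_finrank
      (Subspace.dual_finrank_eq (K := ℝ) (V := TangentSpace 𝓘(ℝ, E) x)).symm).1 hinj
  obtain ⟨v, hv⟩ := hsurj l.toLinearMap
  refine ⟨v, fun w => LinearMap.congr_fun hv w, fun v' hv' => hinj ?_⟩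
  rw [hv]
  ext w
  exact hv' w

/-- The Hamiltonian vector field `X_F` at `x`: the unique vector with `Ω(X_F, ·) = -dF`. -/
def SymplecticForm.hamVec {E M : Type*} [NormedAddCommGroup E] [NormedSpace ℝ E]
    [FiniteDimensional ℝ E] [TopologicalSpace M] [ChartedSpace E M] (Ω : SymplecticForm E M)
    (F : M → ℝ) (x : M) : TangentSpace 𝓘(ℝ, E) x :=
  (Ω.exists_unique_dual x (-mvfderiv 𝓘(ℝ, E) F x)).choose

/-- The Poisson bracket `{F, G} = Ω(X_G, X_F)`. -/
def SymplecticForm.bracket {E M : Type*} [NormedAddCommGroup E] [NormedSpace ℝ E]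
    [FiniteDimensional ℝ E] [TopologicalSpace M] [ChartedSpace E M] (Ω : SymplecticForm E M)
    (F G : M → ℝ) (x : M) : ℝ :=
  Ω.form x ![Ω.hamVec G x, Ω.hamVec F x]

/-- The supremum norm of the Poisson bracket of the two components of a map into the plane,
with values in `[0, ∞]`. The plane `ℝ²` is `ℂ`, with components `re` and `im`. -/
def SymplecticForm.bracketNorm {E M : Type*} [NormedAddCommGroup E] [NormedSpace ℝ E]
    [FiniteDimensional ℝ E] [TopologicalSpace M] [ChartedSpace E M] (Ω : SymplecticForm E M)
    (Φ : M → ℂ) : ENNReal :=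
  ⨆ x : M, ‖Ω.bracket (fun y => (Φ y).re) (fun y => (Φ y).im) x‖ₑ

/-! ### Convex plane domains with marked boundary points -/

/-- The angle in `[0, 2π)` by which the ray from `o` through `p` has to be rotated
counterclockwise around `o` to reach the ray from `o` through `q`. -/
def ccwAngle (o p q : ℂ) : ℝ :=
  toIcoMod Real.two_pi_pos 0 (Complex.arg ((q - o) / (p - o)))

/-- The points `p 0, p 1, …` are distinct and lie on the boundary of the convex body `D` in this
cyclic order, counterclockwise: seen from any interior point, their angles from `p 0` increase. -/
def CyclicallyOrdered {N : ℕ} [NeZero N] (D : Set ℂ) (p : Fin N → ℂ) : Prop :=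
  (∀ i, p i ∈ frontier D) ∧ ∀ o ∈ interior D, StrictMono fun i => ccwAngle o (p 0) (p i)

/-- The closed boundary arc of the convex body `D` that runs counterclockwise from `p` to `q`. -/
def ccwArc (D : Set ℂ) (p q : ℂ) : Set ℂ :=
  {z | z ∈ frontier D ∧ ∀ o ∈ interior D, ccwAngle o p z ≤ ccwAngle o p q}

/-- `D` has a smooth boundary: near each boundary point it is the sublevel set of a smooth function
without critical point there. -/
def HasSmoothBoundary (D : Set ℂ) : Prop :=
  ∀ z ∈ frontier D, ∃ U : Set ℂ, IsOpen U ∧ z ∈ U ∧ ∃ g : ℂ → ℝ,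
    ContDiffOn ℝ ∞ g U ∧ g z = 0 ∧ fderiv ℝ g z ≠ 0 ∧ ∀ w ∈ U, (w ∈ D ↔ g w ≤ 0)

/-- A convex polygon, as the convex hull of finitely many points. -/
def IsConvexPolygon (D : Set ℂ) : Prop :=
  ∃ S : Finset ℂ, D = convexHull ℝ (S : Set ℂ)

/-- A compact convex plane domain of area one with smooth or polygonal boundary, and `N` marked
boundary points in counterclockwise cyclic order. -/
structure MarkedDomain (N : ℕ) [NeZero N] where
  carrier : Set ℂ
  isCompact : IsCompact carrier
  convex : Convex ℝ carrier
  area : MeasureTheory.volume carrier = 1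
  boundary : HasSmoothBoundary carrier ∨ IsConvexPolygon carrier
  point : Fin N → ℂ
  ordered : CyclicallyOrdered carrier point

/-- The boundary arc from the `i`-th marked point to the next one (cyclically). -/
def MarkedDomain.arc {N : ℕ} [NeZero N] (Δ : MarkedDomain N) (i : Fin N) : Set ℂ :=
  ccwArc Δ.carrier (Δ.point i) (Δ.point (i + 1))

/-! ### The invariant of a tuple of sets -/

/-- Smooth maps `Φ : M → Δ` that are constant outside a compact set and send a neighbourhood of each
`X i` into the `i`-th boundary arc. -/
def AdmissibleForTuple {E M : Type*} [NormedAddCommGroup E] [NormedSpace ℝ E]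
    [TopologicalSpace M] [ChartedSpace E M] {N : ℕ} [NeZero N] (Δ : MarkedDomain N)
    (X : Fin N → Set M) (Φ : M → ℂ) : Prop :=
  ContMDiff 𝓘(ℝ, E) 𝓘(ℝ, ℂ) ∞ Φ ∧ (∀ x, Φ x ∈ Δ.carrier) ∧
  (∃ p ∈ Δ.carrier, HasCompactSupport fun x => Φ x - p) ∧
  ∀ i, ∃ U : Set M, IsOpen U ∧ X i ⊆ U ∧ ∀ x ∈ U, Φ x ∈ Δ.arc i

/-- The Poisson bracket invariant `Pb_N(X_1, …, X_N)`, computed with the marked domain `Δ`. -/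
def SymplecticForm.pbTuple {E M : Type*} [NormedAddCommGroup E] [NormedSpace ℝ E]
    [FiniteDimensional ℝ E] [TopologicalSpace M] [ChartedSpace E M] (Ω : SymplecticForm E M)
    {N : ℕ} [NeZero N] (Δ : MarkedDomain N) (X : Fin N → Set M) : ENNReal :=
  ⨅ (Φ : M → ℂ) (_ : AdmissibleForTuple (E := E) Δ X Φ), Ω.bracketNorm Φ

/-! ### The invariant of a homotopy class -/

/-- The set `[X : Y]` of homotopy classes of continuous maps. -/
def HomotopyClasses (X Y : Type*) [TopologicalSpace X] [TopologicalSpace Y] :=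
  Quotient (⟨ContinuousMap.Homotopic, ContinuousMap.Homotopic.equivalence⟩ : Setoid C(X, Y))

/-- The homotopy class of a continuous map. -/
def homotopyClass {X Y : Type*} [TopologicalSpace X] [TopologicalSpace Y] (f : C(X, Y)) :
    HomotopyClasses X Y :=
  Quotient.mk _ f

/-- Smooth compactly supported maps `φ` from `M` to the closed disc of radius `r` around the origin
that send a neighbourhood of `X` into the boundary circle and restrict to a map of class `α` on `X`;
the circle of radius `r` is identified with the unit circle by scaling. -/
def AdmissibleForClass {E M : Type*} [NormedAddCommGroup E] [NormedSpace ℝ E]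
    [TopologicalSpace M] [ChartedSpace E M] (r : ℝ) (X : Set M) (α : HomotopyClasses X Circle)
    (φ : M → ℂ) : Prop :=
  ContMDiff 𝓘(ℝ, E) 𝓘(ℝ, ℂ) ∞ φ ∧ (∀ x, φ x ∈ Metric.closedBall (0 : ℂ) r) ∧
  HasCompactSupport φ ∧
  (∃ U : Set M, IsOpen U ∧ X ⊆ U ∧ ∀ x ∈ U, φ x ∈ Metric.sphere (0 : ℂ) r) ∧
  ∃ g : C(X, Circle), (∀ x : X, φ x = r * (g x : ℂ)) ∧ homotopyClass g = α

/-- The invariant `Pb_X(α)`, computed with maps to the disc of radius `r`. -/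
def SymplecticForm.pbClass {E M : Type*} [NormedAddCommGroup E] [NormedSpace ℝ E]
    [FiniteDimensional ℝ E] [TopologicalSpace M] [ChartedSpace E M] (Ω : SymplecticForm E M)
    (r : ℝ) (X : Set M) (α : HomotopyClasses X Circle) : ENNReal :=
  ⨅ (φ : M → ℂ) (_ : AdmissibleForClass (E := E) r X α φ), Ω.bracketNorm φ

/-- `α` is the class of some map `f : X → S¹` that sends each `Y i` into the `i`-th of the consecutive
counterclockwise arcs into which `N` cyclically ordered points divide the unit circle. -/
def IsDecompositionClass {M : Type*} [TopologicalSpace M] {N : ℕ} [NeZero N] (X : Set M)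
    (Y : Fin N → Set M) (α : HomotopyClasses X Circle) : Prop :=
  ∃ p : Fin N → ℂ, CyclicallyOrdered (Metric.closedBall (0 : ℂ) 1) p ∧
  ∃ f : C(X, Circle),
    (∀ (i : Fin N) (x : X), (x : M) ∈ Y i →
      (f x : ℂ) ∈ ccwArc (Metric.closedBall (0 : ℂ) 1) (p i) (p (i + 1))) ∧
    homotopyClass f = α

end

/-! The bracket `{Re φ, Im φ}` is the pullback of the plane area form paired with the symplectic
structure. Composing `φ` with a smooth plane map `Z` therefore multiplies it by the Jacobian
determinant of `Z` (`bracket_comp`), and it vanishes wherever `φ` stays in a circle or a line. Both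
invariants thus see only area distortion, and it suffices to compare the marked domain with the unit
disc by smooth maps whose Jacobians are bounded by constants arbitrarily close to the ratio of
areas: `π` towards the disc and `1 / π` back. No diffeomorphism is needed, and none could be smooth
up to the corners of a polygon.

Both comparison maps have the polar form `(r, θ) ↦ ρ (r * k θ) • C θ`, whose Jacobian is controlled
by `k² |C × C'|` (`abs_planeDet_radialMap_le`). Towards the disc (`exists_map_to_disc`), `k` is a
smooth approximation of the gauge of the domain from above, and `C` runs through the circle with
speed proportional to `k⁻²`. Back from the disc (`exists_map_from_disc`), `k = 1` and `C` runs
around the boundary sweeping area at nearly constant rate. It slows down to all orders at corners,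
so that it is smooth, and rests at the marked points.

For `Pb_X ≤ π Pb_3` (`pbClass_one_le`), an admissible map to the domain is composed with the first
map and multiplied by a cutoff. Since the boundary map is monotone in the angle, arcs go to arcs,
and the class is the required one.

For `Pb_3 ≤ Pb_X / π` (`pbTuple_le`), a map `φ` of class `α` only agrees up to homotopy with one
that sends the sets to arcs. The homotopy is a rotation by `exp (i h)` with `h` real. Undoing a
smooth approximation of `h` where `φ` has values in the circle costs no bracket and brings each set
within `δ` of its arc. The rests of `C` at the marked points absorb this error.

Existence and uniqueness of `α` come from lifting to angles: consecutive arcs meet only in their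
common endpoint, so the differences of the lifts of two such maps glue to a global real function,
which gives a homotopy. -/

open Filter Topology Set

/-! ### The Poisson bracket under plane maps -/

section Bracket

variable {E M : Type*} [NormedAddCommGroup E] [NormedSpace ℝ E]
  [TopologicalSpace M] [ChartedSpace E M]

/-- The Jacobian determinant of a real linear endomorphism of the plane. -/
noncomputable def planeDet (L : ℂ →L[ℝ] ℂ) : ℝ :=
  (L 1).re * (L Complex.I).im - (L Complex.I).re * (L 1).im

theorem SymplecticForm.form_add_smul (Ω : SymplecticForm E M) (x : M) (a b : ℝ)
    (u v w : TangentSpace 𝓘(ℝ, E) x) :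
    Ω.form x ![a • u + b • v, w] = a * Ω.form x ![u, w] + b * Ω.form x ![v, w] := by
  have e0 : ∀ v w a : TangentSpace 𝓘(ℝ, E) x, Function.update ![v, w] 0 a = ![a, w] := by
    intro v w a
    ext i
    fin_cases i <;> rfl
  have h1 := (Ω.form x).map_update_add ![u, w] 0 (a • u) (b • v)
  have h2 := (Ω.form x).map_update_smul ![u, w] 0 a u
  have h3 := (Ω.form x).map_update_smul ![u, w] 0 b v
  simp only [e0, smul_eq_mul] at h1 h2 h3
  rw [h1, h2, h3]

theorem SymplecticForm.form_swap (Ω : SymplecticForm E M) (x : M)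
    (u v : TangentSpace 𝓘(ℝ, E) x) : Ω.form x ![u, v] = -Ω.form x ![v, u] := by
  have h := (Ω.form x).toAlternatingMap.map_swap ![v, u] (i := 0) (j := 1) (by decide)
  have e : ![v, u] ∘ Equiv.swap (0 : Fin 2) 1 = ![u, v] := by
    ext i
    fin_cases i <;> simp
  rw [e] at h
  exact h

theorem mvfderiv_congr {F G : M → ℝ} {x : M} (h : F =ᶠ[𝓝 x] G) :
    mvfderiv 𝓘(ℝ, E) F x = mvfderiv 𝓘(ℝ, E) G x := by
  ext w
  have := h.mfderiv_eq (I := 𝓘(ℝ, E)) (I' := 𝓘(ℝ, ℝ))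
  simp only [mvfderiv]
  exact congrArg (fun L : E →L[ℝ] ℝ => L w) this

theorem mvfderiv_comp_plane {φ : M → ℂ} {x : M} (hφ : MDifferentiableAt 𝓘(ℝ, E) 𝓘(ℝ, ℂ) φ x)
    {H : ℂ → ℝ} {l : ℂ →L[ℝ] ℝ} (hH : HasFDerivAt H l (φ x)) :
    mvfderiv 𝓘(ℝ, E) (fun y => H (φ y)) x =
      l 1 • mvfderiv 𝓘(ℝ, E) (fun y => (φ y).re) x +
        l Complex.I • mvfderiv 𝓘(ℝ, E) (fun y => (φ y).im) x := by
  have comp : ∀ {H : ℂ → ℝ} {l : ℂ →L[ℝ] ℝ} (_ : HasFDerivAt H l (φ x))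
      (w : TangentSpace 𝓘(ℝ, E) x), mvfderiv 𝓘(ℝ, E) (fun y => H (φ y)) x w =
        l (mfderiv 𝓘(ℝ, E) 𝓘(ℝ, ℂ) φ x w : ℂ) := by
    intro H l hH w
    have := (hH.hasMFDerivAt.comp x hφ.hasMFDerivAt).mfderiv
    exact congrArg (fun L : E →L[ℝ] ℝ => L w) this
  ext w
  have h1 := comp (Complex.reCLM.hasFDerivAt (x := φ x)) w
  have h2 := comp (Complex.imCLM.hasFDerivAt (x := φ x)) w
  have h3 := comp hH w
  simp only [Complex.reCLM_apply, Complex.imCLM_apply] at h1 h2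
  simp only [add_apply, smul_apply, smul_eq_mul]
  erw [h1, h2, h3]
  set z : ℂ := (mfderiv 𝓘(ℝ, E) 𝓘(ℝ, ℂ) φ x w : ℂ)
  have hz : z = z.re • (1 : ℂ) + z.im • Complex.I := by
    apply Complex.ext <;> simp
  conv_lhs => rw [hz]
  rw [map_add, map_smul, map_smul, smul_eq_mul, smul_eq_mul, Complex.reCLM_apply,
    Complex.imCLM_apply]
  ring

variable [FiniteDimensional ℝ E]

theorem SymplecticForm.form_hamVec (Ω : SymplecticForm E M) (F : M → ℝ) (x : M)
    (w : TangentSpace 𝓘(ℝ, E) x) :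
    Ω.form x ![Ω.hamVec F x, w] = -mvfderiv 𝓘(ℝ, E) F x w :=
  (Ω.exists_unique_dual x (-mvfderiv 𝓘(ℝ, E) F x)).choose_spec.1 w

theorem SymplecticForm.hamVec_eq_add (Ω : SymplecticForm E M) {F f g : M → ℝ} {x : M} {a b : ℝ}
    (h : mvfderiv 𝓘(ℝ, E) F x = a • mvfderiv 𝓘(ℝ, E) f x + b • mvfderiv 𝓘(ℝ, E) g x) :
    Ω.hamVec F x = a • Ω.hamVec f x + b • Ω.hamVec g x := by
  refine (Ω.exists_unique_dual x (-mvfderiv 𝓘(ℝ, E) F x)).unique (fun w => ?_) (fun w => ?_)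
  · rw [Ω.form_hamVec]; rfl
  · rw [Ω.form_add_smul, Ω.form_hamVec, Ω.form_hamVec, h]
    simp
    ring

theorem SymplecticForm.bracket_eq (Ω : SymplecticForm E M) (F G : M → ℝ) (x : M) :
    Ω.bracket F G x = -mvfderiv 𝓘(ℝ, E) G x (Ω.hamVec F x) :=
  Ω.form_hamVec G x _

/-- Hamiltonian vectors depend linearly on differentials, and an alternating form multiplies by the
determinant under a linear change of a pair of vectors. -/
theorem SymplecticForm.bracket_linear (Ω : SymplecticForm E M) {F G f g : M → ℝ} {x : M}
    {a b c d : ℝ}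
    (hF : mvfderiv 𝓘(ℝ, E) F x = a • mvfderiv 𝓘(ℝ, E) f x + b • mvfderiv 𝓘(ℝ, E) g x)
    (hG : mvfderiv 𝓘(ℝ, E) G x = c • mvfderiv 𝓘(ℝ, E) f x + d • mvfderiv 𝓘(ℝ, E) g x) :
    Ω.bracket F G x = (a * d - b * c) * Ω.bracket f g x := by
  have key : ∀ u v : TangentSpace 𝓘(ℝ, E) x, Ω.form x ![u, u] = 0 := by
    intro u _
    have := Ω.form_swap x u u
    linarith
  have s := Ω.form_swap x (Ω.hamVec f x) (Ω.hamVec g x)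
  unfold SymplecticForm.bracket
  rw [Ω.hamVec_eq_add hF, Ω.hamVec_eq_add hG, Ω.form_add_smul,
    Ω.form_swap x (Ω.hamVec f x), Ω.form_swap x (Ω.hamVec g x), Ω.form_add_smul, Ω.form_add_smul,
    key _ 0, key _ 0, s]
  ring

theorem SymplecticForm.bracket_congr (Ω : SymplecticForm E M) {φ ψ : M → ℂ} {x : M}
    (h : φ =ᶠ[𝓝 x] ψ) :
    Ω.bracket (fun y => (φ y).re) (fun y => (φ y).im) x =
      Ω.bracket (fun y => (ψ y).re) (fun y => (ψ y).im) x := by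
  have h1 : (fun y => (φ y).re) =ᶠ[𝓝 x] fun y => (ψ y).re := h.fun_comp Complex.re
  have h2 : (fun y => (φ y).im) =ᶠ[𝓝 x] fun y => (ψ y).im := h.fun_comp Complex.im
  have := Ω.bracket_linear (x := x) (a := 1) (b := 0) (c := 0) (d := 1)
    (F := fun y => (φ y).re) (G := fun y => (φ y).im)
    (f := fun y => (ψ y).re) (g := fun y => (ψ y).im)
    (by rw [mvfderiv_congr h1]; simp) (by rw [mvfderiv_congr h2]; simp)
  simpa using this

theorem SymplecticForm.bracket_comp (Ω : SymplecticForm E M) {φ : M → ℂ} {x : M}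
    (hφ : MDifferentiableAt 𝓘(ℝ, E) 𝓘(ℝ, ℂ) φ x) {Z : ℂ → ℂ} {L : ℂ →L[ℝ] ℂ}
    (hZ : HasFDerivAt Z L (φ x)) :
    Ω.bracket (fun y => (Z (φ y)).re) (fun y => (Z (φ y)).im) x =
      planeDet L * Ω.bracket (fun y => (φ y).re) (fun y => (φ y).im) x := by
  have h1 := mvfderiv_comp_plane hφ (Complex.reCLM.hasFDerivAt.comp _ hZ)
  have h2 := mvfderiv_comp_plane hφ (Complex.imCLM.hasFDerivAt.comp _ hZ)
  exact Ω.bracket_linear h1 h2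

/-- Differentiating `|φ|² = 1` gives a nontrivial linear relation between the differentials of the
two components, and the bracket of functions with dependent differentials is zero. -/
theorem SymplecticForm.bracket_eq_zero_of_sphere (Ω : SymplecticForm E M) {φ : M → ℂ} {x : M}
    (hφ : MDifferentiableAt 𝓘(ℝ, E) 𝓘(ℝ, ℂ) φ x) (h : ∀ᶠ y in 𝓝 x, ‖φ y‖ = 1) :
    Ω.bracket (fun y => (φ y).re) (fun y => (φ y).im) x = 0 := by
  have hN : HasFDerivAt (fun z : ℂ => z.re * z.re + z.im * z.im)
      ((φ x).re • Complex.reCLM + (φ x).re • Complex.reCLM +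
        ((φ x).im • Complex.imCLM + (φ x).im • Complex.imCLM)) (φ x) :=
    (Complex.reCLM.hasFDerivAt.mul Complex.reCLM.hasFDerivAt).add
      (Complex.imCLM.hasFDerivAt.mul Complex.imCLM.hasFDerivAt)
  have h1 := mvfderiv_comp_plane hφ hN
  have h2 : (fun y => (φ y).re * (φ y).re + (φ y).im * (φ y).im) =ᶠ[𝓝 x] fun _ => (1 : ℝ) := by
    filter_upwards [h] with y hy
    rw [← Complex.normSq_apply, Complex.normSq_eq_norm_sq, hy, one_pow]
  rw [mvfderiv_congr h2, mvfderiv_const] at h1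
  have hx := h2.self_of_nhds
  dsimp only at hx
  simp at h1
  set dF := mvfderiv 𝓘(ℝ, E) (fun y => (φ y).re) x
  set dG := mvfderiv 𝓘(ℝ, E) (fun y => (φ y).im) x
  set a := (φ x).re
  set b := (φ x).im
  have h3 : a • dF + b • dG = 0 := by
    have : (2 : ℝ) • (a • dF + b • dG) = 0 := by
      rw [h1]; module
    exact (smul_eq_zero.1 this).resolve_left two_ne_zero
  by_cases ha : a = 0
  · have hb : b ≠ 0 := by
      rintro hb
      rw [ha, hb] at hx
      norm_num at hx
    have : dG = 0 := by simpa [ha, hb] using h3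
    rw [Ω.bracket_eq]
    change -(dG _) = 0
    rw [this]
    simp
  · have : dF = (-(b / a)) • dG + (0 : ℝ) • dG := by
      have : a • dF = a • ((-(b / a)) • dG + (0 : ℝ) • dG) := by
        rw [zero_smul, add_zero, smul_smul, mul_neg, mul_div_cancel₀ _ ha, neg_smul]
        exact eq_neg_of_add_eq_zero_left h3
      exact smul_right_injective _ ha this
    have := Ω.bracket_linear (F := fun y => (φ y).re) (G := fun y => (φ y).im)
      (f := fun y => (φ y).im) (g := fun y => (φ y).im) (c := 1) (d := 0) this (by simp)
    rw [this]
    have h0 := Ω.form_swap x (Ω.hamVec (fun y => (φ y).im) x) (Ω.hamVec (fun y => (φ y).im) x)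
    have : Ω.bracket (fun y => (φ y).im) (fun y => (φ y).im) x = 0 := by
      unfold SymplecticForm.bracket
      linarith
    rw [this, mul_zero]

theorem SymplecticForm.bracket_eq_zero_of_line (Ω : SymplecticForm E M) {χ : M → ℝ} {x : M}
    (hχ : MDifferentiableAt 𝓘(ℝ, E) 𝓘(ℝ, ℝ) χ x) (c : ℂ) {φ : M → ℂ}
    (h : ∀ᶠ y in 𝓝 x, φ y = χ y * c) :
    Ω.bracket (fun y => (φ y).re) (fun y => (φ y).im) x = 0 := by
  have hd : MDifferentiableAt 𝓘(ℝ, E) 𝓘(ℝ, ℂ) (fun y => (χ y : ℂ)) x :=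
    (Complex.ofRealCLM.hasFDerivAt.hasMFDerivAt.comp x hχ.hasMFDerivAt).mdifferentiableAt
  have hZ : HasFDerivAt (fun w : ℂ => w.re • c) (Complex.reCLM.smulRight c) (χ x : ℂ) :=
    (Complex.reCLM.smulRight c).hasFDerivAt
  have h1 := Ω.bracket_comp hd hZ
  have h2 : φ =ᶠ[𝓝 x] fun y => ((χ y : ℂ)).re • c := by
    filter_upwards [h] with y hy
    rw [hy]
    simp
  rw [Ω.bracket_congr h2, h1]
  simp [planeDet]

theorem SymplecticForm.bracketNorm_le (Ω : SymplecticForm E M) {φ ψ : M → ℂ} {c : ℝ}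
    (hc : 0 ≤ c) (h : ∀ x, |Ω.bracket (fun y => (φ y).re) (fun y => (φ y).im) x| ≤
      c * |Ω.bracket (fun y => (ψ y).re) (fun y => (ψ y).im) x|) :
    Ω.bracketNorm φ ≤ ENNReal.ofReal c * Ω.bracketNorm ψ := by
  refine iSup_le fun x => ?_
  refine le_trans ?_ (mul_le_mul_right (le_iSup (fun x : M =>
    ‖Ω.bracket (fun y => (ψ y).re) (fun y => (ψ y).im) x‖ₑ) x) _)
  rw [Real.enorm_eq_ofReal_abs, Real.enorm_eq_ofReal_abs, ← ENNReal.ofReal_mul hc]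
  exact ENNReal.ofReal_le_ofReal (h x)

end Bracket

/-! ### Angles and cyclic order on convex boundaries -/

section Angles

open Complex (I exp arg)

theorem exp_mul_I_eq_of_toIcoMod (x : ℝ) :
    exp ((toIcoMod Real.two_pi_pos 0 x : ℝ) * I) = exp (x * I) := by
  rw [toIcoMod, Complex.exp_eq_exp_iff_exists_int]
  refine ⟨-toIcoDiv Real.two_pi_pos 0 x, ?_⟩
  push_cast [zsmul_eq_mul]
  ring

theorem ccwAngle_nonneg (o p q : ℂ) : 0 ≤ ccwAngle o p q :=
  left_le_toIcoMod _ _ _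

theorem ccwAngle_lt_two_pi (o p q : ℂ) : ccwAngle o p q < 2 * Real.pi :=
  (toIcoMod_lt_right Real.two_pi_pos 0 (arg ((q - o) / (p - o)))).trans_eq (zero_add _)

theorem exp_ccwAngle (o p q : ℂ) :
    exp (ccwAngle o p q * I) = exp (arg ((q - o) / (p - o)) * I) :=
  exp_mul_I_eq_of_toIcoMod _

theorem eq_of_exp_mul_I_eq {a b : ℝ} (ha : a ∈ Ico 0 (2 * Real.pi)) (hb : b ∈ Ico 0 (2 * Real.pi))
    (h : exp (a * I) = exp (b * I)) : a = b := by
  obtain ⟨n, hn⟩ := Complex.exp_eq_exp_iff_exists_int.1 h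
  have h1 : a = b + n * (2 * Real.pi) := by
    have := congrArg Complex.im hn
    simpa using this
  have hpi := Real.pi_pos
  have h2 : n = 0 := by
    have l : (n : ℝ) < 1 := by
      by_contra hc
      push Not at hc
      nlinarith [ha.2, hb.1]
    have l' : (-1 : ℝ) < n := by
      by_contra hc
      push Not at hc
      nlinarith [ha.1, hb.2]
    have a1 : n < 1 := by exact_mod_cast l
    have a2 : -1 < n := by exact_mod_cast l'
    omega
  simpa [h2] using h1

/-- The polar form of `q` seen from `o`, measured from the direction of `p`. -/
theorem sub_eq_of_ccwAngle {o p q : ℂ} {a σ : ℝ} (ha : 0 < a) (hp : p - o = a * exp (σ * I)) :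
    q - o = ‖q - o‖ * exp ((σ + ccwAngle o p q : ℝ) * I) := by
  have hp0 : p - o ≠ 0 := by
    rw [hp]
    exact mul_ne_zero (by exact_mod_cast ha.ne') (Complex.exp_ne_zero _)
  have hpn : ‖p - o‖ = a := by
    rw [hp, norm_mul, Complex.norm_exp_ofReal_mul_I, mul_one, Complex.norm_real, Real.norm_eq_abs,
      abs_of_pos ha]
  have h := Complex.norm_mul_exp_arg_mul_I ((q - o) / (p - o))
  rw [← exp_ccwAngle, norm_div, hpn] at h
  have h2 : q - o = (q - o) / (p - o) * (p - o) := by field_simp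
  have ha' : (a : ℂ) ≠ 0 := by exact_mod_cast ha.ne'
  conv_lhs => rw [h2, ← h, hp]
  push_cast
  rw [add_mul, Complex.exp_add]
  field_simp

theorem ccwAngle_eq_of_polar {o p q : ℂ} {a b σ θ : ℝ} (ha : 0 < a) (hb : 0 < b)
    (hp : p - o = a * exp (σ * I)) (hq : q - o = b * exp (θ * I)) (h0 : σ ≤ θ)
    (h1 : θ < σ + 2 * Real.pi) : ccwAngle o p q = θ - σ := by
  have h := sub_eq_of_ccwAngle (q := q) ha hp
  have hqn : ‖q - o‖ = b := by
    rw [hq, norm_mul, Complex.norm_exp_ofReal_mul_I, mul_one, Complex.norm_real, Real.norm_eq_abs,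
      abs_of_pos hb]
  rw [hqn, hq] at h
  have h2 := mul_left_cancel₀ (by exact_mod_cast hb.ne') h
  refine eq_of_exp_mul_I_eq ⟨ccwAngle_nonneg _ _ _, ccwAngle_lt_two_pi _ _ _⟩
    ⟨by linarith, by linarith⟩ ?_
  have h3 : exp (((θ - σ : ℝ) : ℂ) * I) = exp (θ * I) / exp (σ * I) := by
    rw [← Complex.exp_sub]; push_cast; ring_nf
  rw [h3, h2]
  push_cast
  rw [add_mul, Complex.exp_add]
  field_simp

theorem exists_polar {z : ℂ} (hz : z ≠ 0) : ∃ a σ : ℝ, 0 < a ∧ z = a * exp (σ * I) :=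
  ⟨‖z‖, arg z, norm_pos_iff.2 hz, (Complex.norm_mul_exp_arg_mul_I z).symm⟩

theorem sub_ne_zero_of_frontier {D : Set ℂ} {o p : ℂ} (ho : o ∈ interior D)
    (hp : p ∈ frontier D) : p - o ≠ 0 := by
  intro h
  rw [sub_eq_zero] at h
  exact hp.2 (h ▸ ho)

/-- Of two distinct boundary points on a ray from an interior point, the nearer one would lie in an
open segment from the interior to the closure, hence in the interior. -/
theorem Convex.eq_of_same_ray {D : Set ℂ} (hD : Convex ℝ D) {o p z : ℂ} (ho : o ∈ interior D)
    (hp : p ∈ frontier D) (hz : z ∈ frontier D) {c : ℝ} (hc : 0 < c) (h : z - o = c * (p - o)) :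
    z = p := by
  have aux : ∀ {p z : ℂ} {c : ℝ}, p ∈ frontier D → z ∈ frontier D → 0 < c → c < 1 →
      z - o = c * (p - o) → False := by
    intro p z c hp hz hc hc1 h
    refine hz.2 (hD.openSegment_interior_closure_subset_interior ho hp.1
      ⟨1 - c, c, by linarith, hc, by ring, ?_⟩)
    rw [Complex.real_smul, Complex.real_smul]
    push_cast
    linear_combination -h
  rcases lt_trichotomy c 1 with h1 | h1 | h1
  · exact (aux hp hz hc h1 h).elim
  · rw [h1] at h
    simpa using h
  · refine (aux (c := c⁻¹) hz hp (by positivity) (inv_lt_one_of_one_lt₀ h1) ?_).elim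
    have : (c : ℂ) ≠ 0 := by exact_mod_cast hc.ne'
    rw [h]
    push_cast
    field_simp

theorem Convex.eq_of_ccwAngle_eq {D : Set ℂ} (hD : Convex ℝ D) {o p z q : ℂ}
    (ho : o ∈ interior D) (hp : p ∈ frontier D) (hz : z ∈ frontier D) (hq : q ∈ frontier D)
    (h : ccwAngle o p z = ccwAngle o p q) : z = q := by
  obtain ⟨a, σ, ha, hpσ⟩ := exists_polar (sub_ne_zero_of_frontier ho hp)
  have h1 := sub_eq_of_ccwAngle (q := z) ha hpσ
  have h2 := sub_eq_of_ccwAngle (q := q) ha hpσ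
  have hz0 := norm_pos_iff.2 (sub_ne_zero_of_frontier ho hz)
  have hq0 := norm_pos_iff.2 (sub_ne_zero_of_frontier ho hq)
  refine hD.eq_of_same_ray ho hq hz (div_pos hz0 hq0) ?_
  rw [h] at h1
  have : ((‖q - o‖ : ℝ) : ℂ) ≠ 0 := by exact_mod_cast hq0.ne'
  calc z - o = ‖z - o‖ * exp ((σ + ccwAngle o p q : ℝ) * I) := h1
    _ = ((‖z - o‖ / ‖q - o‖ : ℝ) : ℂ) * (‖q - o‖ * exp ((σ + ccwAngle o p q : ℝ) * I)) := by
      push_cast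
      field_simp
    _ = _ := by rw [← h2]

theorem ccwAngle_self {o p : ℂ} (h : p - o ≠ 0) : ccwAngle o p p = 0 := by
  obtain ⟨a, σ, ha, hpσ⟩ := exists_polar h
  rw [ccwAngle_eq_of_polar ha ha hpσ hpσ le_rfl (by linarith [Real.pi_pos]), sub_self]

/-- Distinct boundary points are never on the same ray from an interior point, so the quotient `(z -
o) / (p - o)` avoids the nonnegative reals, where the angle in `[0, 2π)` jumps. Turning by `π` moves
this cut to that of `arg`. -/
theorem Convex.continuousOn_ccwAngle {D : Set ℂ} (hD : Convex ℝ D) {p z : ℂ}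
    (hp : p ∈ frontier D) (hz : z ∈ frontier D) (hzp : z ≠ p) :
    ContinuousOn (fun o => ccwAngle o p z) (interior D) := by
  have hslit : ∀ o ∈ interior D, -((z - o) / (p - o)) ∈ Complex.slitPlane := by
    intro o ho
    by_contra hc
    rw [Complex.mem_slitPlane_iff, not_or, not_not, not_lt, Complex.neg_re, Complex.neg_im,
      neg_nonpos, neg_eq_zero] at hc
    have hp0 := sub_ne_zero_of_frontier ho hp
    have hz0 := sub_ne_zero_of_frontier ho hz
    have h1 : (z - o) / (p - o) = (((z - o) / (p - o)).re : ℂ) := by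
      apply Complex.ext
      · simp
      · simp [← hc.2]
    have h2 : z - o = (((z - o) / (p - o)).re : ℂ) * (p - o) := by
      rw [← h1]; field_simp
    have h3 : 0 < ((z - o) / (p - o)).re := by
      refine lt_of_le_of_ne hc.1 fun h => ?_
      rw [← h] at h1
      simp only [Complex.ofReal_zero, div_eq_zero_iff] at h1
      tauto
    exact hzp (hD.eq_of_same_ray ho hp hz h3 h2)
  have heq : ∀ o ∈ interior D, ccwAngle o p z = Real.pi + arg (-((z - o) / (p - o))) := by
    intro o ho
    have hp0 := sub_ne_zero_of_frontier ho hp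
    have hz0 := sub_ne_zero_of_frontier ho hz
    have hs := hslit o ho
    have hr := div_ne_zero hz0 hp0
    obtain ⟨a, σ, ha, hpσ⟩ := exists_polar hp0
    have h1 := Complex.neg_pi_lt_arg (-((z - o) / (p - o)))
    have h2 := (Complex.arg_le_pi (-((z - o) / (p - o)))).lt_of_ne
      (Complex.mem_slitPlane_iff_arg.1 hs).1
    have h3 := Complex.norm_mul_exp_arg_mul_I (-((z - o) / (p - o)))
    set r := (z - o) / (p - o) with hrdef
    have h4 : z - o = (a * ‖r‖ : ℝ) * exp ((σ + (Real.pi + arg (-r)) : ℝ) * I) := by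
      have : z - o = r * (p - o) := by rw [hrdef]; field_simp
      rw [this, hpσ]
      rw [norm_neg] at h3
      push_cast
      rw [add_mul, add_mul, Complex.exp_add, Complex.exp_add, Complex.exp_pi_mul_I]
      linear_combination ((a : ℂ) * exp (σ * I)) * h3
    rw [ccwAngle_eq_of_polar ha (mul_pos ha (norm_pos_iff.2 hr)) hpσ h4 (by linarith)
      (by linarith)]
    ring
  refine ContinuousOn.congr ?_ heq
  refine continuousOn_const.add fun o ho => ?_
  have hp0 := sub_ne_zero_of_frontier ho hp
  refine ContinuousAt.continuousWithinAt ?_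
  refine ContinuousAt.comp (f := fun o => -((z - o) / (p - o)))
    (Complex.continuousAt_arg (hslit o ho)) ?_
  exact ((continuousAt_const.sub continuousAt_id).div (continuousAt_const.sub continuousAt_id)
    hp0).neg

/-- The cyclic order of boundary points of a convex set does not depend on the interior point
from which they are seen. -/
theorem Convex.ccwAngle_le_of_le {D : Set ℂ} (hD : Convex ℝ D) {o o' p z q : ℂ}
    (ho : o ∈ interior D) (ho' : o' ∈ interior D) (hp : p ∈ frontier D) (hz : z ∈ frontier D)
    (hq : q ∈ frontier D) (h : ccwAngle o p z ≤ ccwAngle o p q) :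
    ccwAngle o' p z ≤ ccwAngle o' p q := by
  by_cases hzp : z = p
  · rw [hzp, ccwAngle_self (sub_ne_zero_of_frontier ho' hp)]
    exact ccwAngle_nonneg _ _ _
  by_cases hqp : q = p
  · refine (hzp (hD.eq_of_ccwAngle_eq ho hp hz hp ?_)).elim
    rw [hqp] at h
    refine le_antisymm h ?_
    rw [ccwAngle_self (sub_ne_zero_of_frontier ho hp)]
    exact ccwAngle_nonneg _ _ _
  by_cases hzq : z = q
  · rw [hzq]
  by_contra hc
  push Not at hc
  have hcont : ContinuousOn (fun o => ccwAngle o p z - ccwAngle o p q) (interior D) :=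
    (hD.continuousOn_ccwAngle hp hz hzp).sub (hD.continuousOn_ccwAngle hp hq hqp)
  -- If the order changed as the viewpoint moves through the connected interior, then from some
  -- viewpoint both angles would coincide, which forces `z = q`.
  obtain ⟨o'', ho'', h0⟩ := hD.interior.isPreconnected.intermediate_value ho ho' hcont
    (show (0 : ℝ) ∈ Icc _ _ from ⟨sub_nonpos.2 h, (sub_pos.2 hc).le⟩)
  exact hzq (hD.eq_of_ccwAngle_eq ho'' hp hz hq (sub_eq_zero.1 h0))

theorem Convex.ccwAngle_lt_of_lt {D : Set ℂ} (hD : Convex ℝ D) {o o' p z q : ℂ}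
    (ho : o ∈ interior D) (ho' : o' ∈ interior D) (hp : p ∈ frontier D) (hz : z ∈ frontier D)
    (hq : q ∈ frontier D) (h : ccwAngle o p z < ccwAngle o p q) :
    ccwAngle o' p z < ccwAngle o' p q := by
  by_contra hc
  push Not at hc
  exact h.not_ge (hD.ccwAngle_le_of_le ho' ho hp hq hz hc)

/-- Three angles that divide the circle into three counterclockwise arcs. -/
def IsDivision (t : Fin 3 → ℝ) : Prop := t 0 < t 1 ∧ t 1 < t 2 ∧ t 2 < t 0 + 2 * Real.pi

/-- The angle at which the arc starting at the angle `t i` ends. -/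
noncomputable def nextAngle (t : Fin 3 → ℝ) : Fin 3 → ℝ := ![t 1, t 2, t 0 + 2 * Real.pi]

theorem exp_nextAngle (t : Fin 3 → ℝ) (i : Fin 3) :
    exp (nextAngle t i * I) = exp (t (i + 1) * I) := by
  fin_cases i
  · rfl
  · rfl
  · change exp ((t 0 + 2 * Real.pi : ℝ) * I) = exp (t 0 * I)
    push_cast
    rw [add_mul, Complex.exp_add, Complex.exp_two_pi_mul_I, mul_one]

theorem IsDivision.lt_nextAngle {t : Fin 3 → ℝ} (ht : IsDivision t) (i : Fin 3) :
    t i < nextAngle t i := by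
  obtain ⟨h1, h2, h3⟩ := ht
  fin_cases i
  exacts [h1, h2, h3]

theorem IsDivision.nextAngle_lt {t : Fin 3 → ℝ} (ht : IsDivision t) (i : Fin 3) :
    nextAngle t i < t i + 2 * Real.pi := by
  obtain ⟨h1, h2, h3⟩ := ht
  fin_cases i
  · change t 1 < t 0 + _; linarith
  · change t 2 < t 1 + _; linarith
  · change t 0 + _ < t 2 + _; linarith

theorem Convex.mem_ccwArc_of_polar {D : Set ℂ} (hD : Convex ℝ D) {o p q z : ℂ}
    (ho : o ∈ interior D) (hp : p ∈ frontier D) (hq : q ∈ frontier D) (hz : z ∈ frontier D)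
    {a b c σ σ' θ : ℝ} (ha : 0 < a) (hb : 0 < b) (hc : 0 < c) (hpo : p - o = a * exp (σ * I))
    (hqo : q - o = b * exp (σ' * I)) (hzo : z - o = c * exp (θ * I)) (h1 : σ ≤ θ) (h2 : θ ≤ σ')
    (h3 : σ' < σ + 2 * Real.pi) : z ∈ ccwArc D p q := by
  refine ⟨hz, fun o' ho' => hD.ccwAngle_le_of_le ho ho' hp hz hq ?_⟩
  rw [ccwAngle_eq_of_polar ha hc hpo hzo h1 (by linarith),
    ccwAngle_eq_of_polar ha hb hpo hqo (by linarith) h3]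
  linarith

theorem exists_polar_of_mem_ccwArc {D : Set ℂ} {o p q z : ℂ} (ho : o ∈ interior D)
    (hz : z ∈ ccwArc D p q) {a b σ σ' : ℝ} (ha : 0 < a) (hb : 0 < b)
    (hpo : p - o = a * exp (σ * I)) (hqo : q - o = b * exp (σ' * I)) (h1 : σ ≤ σ')
    (h2 : σ' < σ + 2 * Real.pi) :
    ∃ θ ∈ Icc σ σ', z - o = ‖z - o‖ * exp (θ * I) := by
  refine ⟨σ + ccwAngle o p z, ⟨by linarith [ccwAngle_nonneg o p z], ?_⟩, sub_eq_of_ccwAngle ha hpo⟩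
  have := hz.2 o ho
  rw [ccwAngle_eq_of_polar ha hb hpo hqo h1 h2] at this
  linarith

theorem CyclicallyOrdered.exists_isDivision {D : Set ℂ} {p : Fin 3 → ℂ}
    (hp : CyclicallyOrdered D p) {o : ℂ} (ho : o ∈ interior D) :
    ∃ t, IsDivision t ∧ ∀ i, p i - o = ‖p i - o‖ * exp (t i * I) := by
  obtain ⟨a, σ, ha, hσ⟩ := exists_polar (sub_ne_zero_of_frontier ho (hp.1 0))
  refine ⟨fun i => σ + ccwAngle o (p 0) (p i), ⟨?_, ?_, ?_⟩, fun i => sub_eq_of_ccwAngle ha hσ⟩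
  · have := hp.2 o ho (show (0 : Fin 3) < 1 by decide)
    dsimp only at this ⊢
    linarith
  · have := hp.2 o ho (show (1 : Fin 3) < 2 by decide)
    dsimp only at this ⊢
    linarith
  · have := ccwAngle_lt_two_pi o (p 0) (p 2)
    have := ccwAngle_nonneg o (p 0) (p 0)
    dsimp only
    linarith

theorem Convex.cyclicallyOrdered_of_isDivision {D : Set ℂ} (hD : Convex ℝ D) {p : Fin 3 → ℂ}
    {o : ℂ} (ho : o ∈ interior D) (hp : ∀ i, p i ∈ frontier D) {t : Fin 3 → ℝ}
    (ht : IsDivision t) {a : Fin 3 → ℝ} (ha : ∀ i, 0 < a i)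
    (h : ∀ i, p i - o = a i * exp (t i * I)) : CyclicallyOrdered D p := by
  refine ⟨hp, fun o' ho' i j hij => hD.ccwAngle_lt_of_lt ho ho' (hp 0) (hp i) (hp j) ?_⟩
  obtain ⟨h1, h2, h3⟩ := ht
  have hb : ∀ i, t 0 ≤ t i ∧ t i < t 0 + 2 * Real.pi := by
    intro i
    fin_cases i
    · exact ⟨le_rfl, show t 0 < _ by linarith⟩
    · exact ⟨h1.le, show t 1 < _ by linarith⟩
    · exact ⟨show _ ≤ t 2 by linarith, h3⟩
  have hmono : t i < t j := by
    fin_cases i <;> fin_cases j <;> first | exact absurd hij (by decide) | skip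
    · exact h1
    · exact h1.trans h2
    · exact h2
  rw [ccwAngle_eq_of_polar (ha 0) (ha i) (h 0) (h i) (hb i).1 (hb i).2,
    ccwAngle_eq_of_polar (ha 0) (ha j) (h 0) (h j) (hb j).1 (hb j).2]
  linarith

end Angles

/-! ### Homotopy classes of maps to the circle -/

section Classes

theorem homotopyClass_eq_iff {X Y : Type*} [TopologicalSpace X] [TopologicalSpace Y]
    {f g : C(X, Y)} : homotopyClass f = homotopyClass g ↔ f.Homotopic g :=
  Quotient.eq (r := ⟨ContinuousMap.Homotopic, ContinuousMap.Homotopic.equivalence⟩)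

/-- The homotopy divided by its initial map starts at the constant `1`, so it lifts through the
covering `Circle.exp` starting from `0`; `u` is the end of the lift. -/
theorem ContinuousMap.Homotopic.exists_eq_mul_exp {X : Type*} [TopologicalSpace X]
    {f g : C(X, Circle)} (h : f.Homotopic g) :
    ∃ u : C(X, ℝ), ∀ x, g x = f x * Circle.exp (u x) := by
  obtain ⟨H⟩ := h
  let K : C(unitInterval × X, Circle) := ⟨fun p => H p * (f p.2)⁻¹, by fun_prop⟩
  have h0 : ∀ x, K (0, x) = Circle.exp ((ContinuousMap.const X (0 : ℝ)) x) := by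
    intro x
    simp [K]
  let L := Circle.isCoveringMap_exp.liftHomotopy K (ContinuousMap.const X (0 : ℝ)) h0
  refine ⟨⟨fun x => L (1, x), by fun_prop⟩, fun x => ?_⟩
  have h1 : Circle.exp (L (1, x)) = K (1, x) :=
    congrFun (Circle.isCoveringMap_exp.liftHomotopy_lifts K (ContinuousMap.const X (0 : ℝ)) h0) _
  change g x = f x * Circle.exp (L (1, x))
  rw [h1]
  simp [K, mul_comm]

theorem homotopic_of_eq_mul_exp {X : Type*} [TopologicalSpace X]
    {f g : C(X, Circle)} (u : X → ℝ) (hu : Continuous u)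
    (h : ∀ x, g x = f x * Circle.exp (u x)) : f.Homotopic g := by
  refine ⟨⟨⟨fun p => f p.2 * Circle.exp (p.1 * u p.2), by fun_prop⟩, fun x => ?_, fun x => ?_⟩⟩
  · simp
  · simp [h]

/-- Gluing of continuous functions along a closed cover by three sets. -/
theorem exists_glue {X W : Type*} [TopologicalSpace X] [TopologicalSpace W] {A : Fin 3 → Set X}
    (hA : ∀ i, IsClosed (A i)) (hcov : ∀ x, ∃ i, x ∈ A i) {u : Fin 3 → X → W}
    (hu : ∀ i, ContinuousOn (u i) (A i))
    (hov : ∀ i, ∀ x ∈ A i, x ∈ A (i + 1) → u i x = u (i + 1) x) :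
    ∃ F : X → W, Continuous F ∧ ∀ i, ∀ x ∈ A i, F x = u i x := by
  choose c hc using hcov
  have key : ∀ i j x, x ∈ A i → x ∈ A j → u i x = u j x := by
    intro i j x hi hj
    have h3 : j = i ∨ j = i + 1 ∨ i = j + 1 := by
      clear * - i j
      decide +revert
    rcases h3 with rfl | rfl | rfl
    · rfl
    · exact hov _ x hi hj
    · exact (hov _ x hj hi).symm
  refine ⟨fun x => u (c x) x, ?_, fun i x hx => key _ _ x (hc x) hx⟩
  refine (locallyFinite_of_finite A).continuous ?_ hA fun i =>
    (hu i).congr fun x hx => key _ _ x (hc x) hx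
  exact eq_univ_of_forall fun x => mem_iUnion.2 ⟨c x, hc x⟩

/-- The map `f` sends each `Y i` into the `i`-th arc of the division of the circle by the
angles `t`. -/
def SendsToArcs {M : Type*} [TopologicalSpace M] {X : Set M} (Y : Fin 3 → Set M)
    (t : Fin 3 → ℝ) (f : C(X, Circle)) : Prop :=
  ∀ i (x : X), (x : M) ∈ Y i → ∃ θ ∈ Icc (t i) (nextAngle t i), f x = Circle.exp θ

theorem zero_mem_interior_closedBall : (0 : ℂ) ∈ interior (Metric.closedBall (0 : ℂ) 1) := by
  rw [interior_closedBall _ one_ne_zero]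
  simp

theorem frontier_unit_closedBall :
    frontier (Metric.closedBall (0 : ℂ) 1) = Metric.sphere (0 : ℂ) 1 :=
  frontier_closedBall _ one_ne_zero

theorem isDecompositionClass_iff {M : Type*} [TopologicalSpace M] {X : Set M} {Y : Fin 3 → Set M}
    {α : HomotopyClasses X Circle} : IsDecompositionClass X Y α ↔
      ∃ t, IsDivision t ∧ ∃ f : C(X, Circle), SendsToArcs Y t f ∧ homotopyClass f = α := by
  have hconv := convex_closedBall (0 : ℂ) 1
  constructor
  · rintro ⟨p, hp, f, hf, hα⟩
    obtain ⟨t, ht, hpt⟩ := hp.exists_isDivision zero_mem_interior_closedBall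
    have hpn : ∀ i, ‖p i - 0‖ = 1 := by
      intro i
      have := hp.1 i
      rw [frontier_unit_closedBall] at this
      simpa using this
    refine ⟨t, ht, f, fun i x hx => ?_, hα⟩
    have h1 := hpt i
    have h2 := hpt (i + 1)
    rw [hpn] at h1 h2
    rw [← exp_nextAngle] at h2
    obtain ⟨θ, hθ, h⟩ := exists_polar_of_mem_ccwArc zero_mem_interior_closedBall (hf i x hx)
      one_pos one_pos h1 h2 (ht.lt_nextAngle i).le (ht.nextAngle_lt i)
    refine ⟨θ, hθ, Circle.ext ?_⟩
    have hn : ‖(f x : ℂ) - 0‖ = 1 := by rw [sub_zero]; exact Circle.norm_coe _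
    rw [hn] at h
    simpa using h
  · rintro ⟨t, ht, f, hf, hα⟩
    have hfr : ∀ θ : ℝ, Complex.exp (θ * Complex.I) ∈ frontier (Metric.closedBall (0 : ℂ) 1) := by
      intro θ
      rw [frontier_unit_closedBall]
      simp [Complex.norm_exp_ofReal_mul_I]
    refine ⟨fun i => Complex.exp (t i * Complex.I),
      hconv.cyclicallyOrdered_of_isDivision (a := fun _ => 1) zero_mem_interior_closedBall
        (fun i => hfr _) ht (fun _ => one_pos) (fun i => by simp), f, fun i x hx => ?_, hα⟩
    obtain ⟨θ, hθ, h⟩ := hf i x hx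
    rw [h, Circle.coe_exp]
    exact hconv.mem_ccwArc_of_polar (a := 1) (b := 1) (c := 1) (σ' := nextAngle t i)
      zero_mem_interior_closedBall (hfr _) (hfr _) (hfr _) one_pos one_pos one_pos (by simp)
      (by rw [exp_nextAngle]; simp) (by simp) hθ.1 hθ.2 (ht.nextAngle_lt i)

/-- Each arc is shorter than the full circle. After rotating its midpoint to `1` it misses the
branch cut of `arg`, which then provides a continuous lift. -/
theorem SendsToArcs.exists_lift {M : Type*} [TopologicalSpace M] {X : Set M} {Y : Fin 3 → Set M}
    {t : Fin 3 → ℝ} (ht : IsDivision t) {f : C(X, Circle)} (hf : SendsToArcs Y t f) :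
    ∃ θ : Fin 3 → X → ℝ, ∀ i, ContinuousOn (θ i) {x | (x : M) ∈ Y i} ∧
      ∀ x : X, (x : M) ∈ Y i → θ i x ∈ Icc (t i) (nextAngle t i) ∧ f x = Circle.exp (θ i x) := by
  have h1 := fun i => ht.lt_nextAngle i
  have h2 := fun i => ht.nextAngle_lt i
  have harg : ∀ i (x : X), (x : M) ∈ Y i → ∃ θ ∈ Icc (t i) (nextAngle t i), f x = Circle.exp θ ∧
      Complex.arg (f x * Circle.exp (-((t i + nextAngle t i) / 2)) : Circle) =
        θ - (t i + nextAngle t i) / 2 ∧ -Real.pi < θ - (t i + nextAngle t i) / 2 ∧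
        θ - (t i + nextAngle t i) / 2 < Real.pi := by
    intro i x hx
    obtain ⟨θ, hθ, h⟩ := hf i x hx
    have a1 : -Real.pi < θ - (t i + nextAngle t i) / 2 := by linarith [hθ.1, h1 i, h2 i]
    have a2 : θ - (t i + nextAngle t i) / 2 < Real.pi := by linarith [hθ.2, h1 i, h2 i]
    refine ⟨θ, hθ, h, ?_, a1, a2⟩
    rw [h, ← Circle.exp_add, ← sub_eq_add_neg, Circle.arg_exp a1 a2.le]
  refine ⟨fun i x => (t i + nextAngle t i) / 2 +
    Complex.arg (f x * Circle.exp (-((t i + nextAngle t i) / 2)) : Circle), fun i => ⟨?_, ?_⟩⟩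
  · refine continuousOn_const.add fun x hx => ContinuousAt.continuousWithinAt ?_
    obtain ⟨θ, hθ, h, ha, a1, a2⟩ := harg i x hx
    refine ContinuousAt.comp (g := Complex.arg)
      (f := fun x => ((f x * Circle.exp (-((t i + nextAngle t i) / 2)) : Circle) : ℂ))
      (Complex.continuousAt_arg ?_) (by fun_prop)
    rw [Complex.mem_slitPlane_iff_arg]
    refine ⟨?_, Circle.coe_ne_zero _⟩
    rw [ha]
    exact a2.ne
  · intro x hx
    obtain ⟨θ, hθ, h, ha, a1, a2⟩ := harg i x hx
    have hθ' : (t i + nextAngle t i) / 2 +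
        Complex.arg (f x * Circle.exp (-((t i + nextAngle t i) / 2)) : Circle) = θ := by
      linarith
    simp only [hθ']
    exact ⟨hθ, h⟩

/-- Two consecutive arcs together are shorter than the full circle because the third has positive
length, so they overlap only at their common endpoint. For `i = 2` the two angles of that point
differ by `2π`. -/
theorem IsDivision.eq_of_exp_eq {t : Fin 3 → ℝ} (ht : IsDivision t) {i : Fin 3} {θ θ' : ℝ}
    (hθ : θ ∈ Icc (t i) (nextAngle t i)) (hθ' : θ' ∈ Icc (t (i + 1)) (nextAngle t (i + 1)))
    (h : Circle.exp θ = Circle.exp θ') : θ = nextAngle t i ∧ θ' = t (i + 1) := by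
  have aux : ∀ {a b : ℝ}, Circle.exp a = Circle.exp b → a ≤ b → b < a + 2 * Real.pi → a = b := by
    intro a b hab h1 h2
    refine (sub_eq_zero.1 ?_ : b = a).symm
    refine eq_of_exp_mul_I_eq ⟨by linarith, by linarith⟩ ⟨le_rfl, by linarith [Real.pi_pos]⟩ ?_
    have h3 := congrArg (fun z : Circle => (z : ℂ)) hab
    simp only [Circle.coe_exp] at h3
    push_cast
    rw [sub_mul, Complex.exp_sub, ← h3, div_self (Complex.exp_ne_zero _)]
    simp
  obtain ⟨h1, h2, h3⟩ := ht
  have e0 : nextAngle t 0 = t 1 := rfl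
  have e1 : nextAngle t 1 = t 2 := rfl
  have e2 : nextAngle t 2 = t 0 + 2 * Real.pi := rfl
  fin_cases i
  · change θ ∈ Icc (t 0) (t 1) at hθ
    change θ' ∈ Icc (t 1) (t 2) at hθ'
    change θ = t 1 ∧ θ' = t 1
    have := aux h (hθ.2.trans hθ'.1) (by linarith [hθ.1, hθ'.2])
    constructor <;> linarith [hθ.2, hθ'.1]
  · change θ ∈ Icc (t 1) (t 2) at hθ
    change θ' ∈ Icc (t 2) (t 0 + 2 * Real.pi) at hθ'
    change θ = t 2 ∧ θ' = t 2
    have := aux h (hθ.2.trans hθ'.1) (by linarith [hθ.1, hθ'.2])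
    constructor <;> linarith [hθ.2, hθ'.1]
  · change θ ∈ Icc (t 2) (t 0 + 2 * Real.pi) at hθ
    change θ' ∈ Icc (t 0) (t 1) at hθ'
    change θ = t 0 + 2 * Real.pi ∧ θ' = t 0
    have h' : Circle.exp θ = Circle.exp (θ' + 2 * Real.pi) := by
      rw [h, Circle.exp_add, Circle.exp_two_pi, mul_one]
    have := aux h' (by linarith [hθ.2, hθ'.1]) (by linarith [hθ.1, hθ'.2])
    constructor <;> linarith [hθ.2, hθ'.1]

/-- On an overlap both lifts of each map are forced to be the endpoint angles. The jump of `2π` from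
the last arc to the first is the same for both maps, so the difference of lifts is globally well
defined. -/
theorem SendsToArcs.homotopic {M : Type*} [TopologicalSpace M] {X : Set M} {Y : Fin 3 → Set M}
    (hY : ∀ i, IsClosed (Y i)) (hX : ∀ x ∈ X, ∃ i, x ∈ Y i) {t t' : Fin 3 → ℝ}
    (ht : IsDivision t) (ht' : IsDivision t') {f f' : C(X, Circle)} (hf : SendsToArcs Y t f)
    (hf' : SendsToArcs Y t' f') : f.Homotopic f' := by
  obtain ⟨θ, hθ⟩ := hf.exists_lift ht
  obtain ⟨θ', hθ'⟩ := hf'.exists_lift ht'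
  obtain ⟨h, hc, hh⟩ := exists_glue (A := fun i => {x : X | (x : M) ∈ Y i})
    (fun i => (hY i).preimage continuous_subtype_val) (fun x => hX x x.2)
    (u := fun i x => θ' i x - θ i x) (fun i => (hθ' i).1.sub (hθ i).1) (by
      intro i x hi hi'
      have h1 := (hθ i).2 x hi
      have h2 := (hθ (i + 1)).2 x hi'
      have h1' := (hθ' i).2 x hi
      have h2' := (hθ' (i + 1)).2 x hi'
      obtain ⟨e1, e2⟩ := ht.eq_of_exp_eq h1.1 h2.1 (h1.2.symm.trans h2.2)
      obtain ⟨e1', e2'⟩ := ht'.eq_of_exp_eq h1'.1 h2'.1 (h1'.2.symm.trans h2'.2)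
      rw [e1, e2, e1', e2']
      fin_cases i
      · rfl
      · rfl
      · change (t' 0 + 2 * Real.pi) - (t 0 + 2 * Real.pi) = t' 0 - t 0
        ring)
  refine homotopic_of_eq_mul_exp h hc fun x => ?_
  obtain ⟨i, hi⟩ := hX x x.2
  rw [hh i x hi, ((hθ i).2 x hi).2, ((hθ' i).2 x hi).2, ← Circle.exp_add, add_sub_cancel]

/-- On `Y i` the fraction `u (i + 1) / (u i + u (i + 1))` interpolates along the arc: it is `0` on
the overlap with the preceding set and `1` on the overlap with the following one. The denominator
could vanish only on the triple intersection. -/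
theorem exists_sendsToArcs {M : Type*} [TopologicalSpace M] {X : Set M} {Y : Fin 3 → Set M}
    (hY : ∀ i, IsClosed (Y i)) (hX : ∀ x ∈ X, ∃ i, x ∈ Y i) (hempty : ∀ x, ∃ i, x ∉ Y i)
    {u : Fin 3 → M → ℝ} (hu : ∀ i, Continuous (u i)) (hu0 : ∀ i x, 0 ≤ u i x)
    (huY : ∀ i x, u i x = 0 ↔ x ∈ Y (i + 1)) {t : Fin 3 → ℝ} (ht : IsDivision t) :
    ∃ f : C(X, Circle), SendsToArcs Y t f := by
  have hpos : ∀ i x, x ∈ Y i → 0 < u i x + u (i + 1) x := by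
    intro i x hx
    refine lt_of_le_of_ne (add_nonneg (hu0 _ _) (hu0 _ _)) fun h => ?_
    have h1 : u i x = 0 := by linarith [hu0 i x, hu0 (i + 1) x]
    have h2 : u (i + 1) x = 0 := by linarith [hu0 i x, hu0 (i + 1) x]
    rw [huY] at h1 h2
    obtain ⟨j, hj⟩ := hempty x
    have : j = i ∨ j = i + 1 ∨ j = i + 1 + 1 := by
      clear * - i j
      decide +revert
    rcases this with rfl | rfl | rfl <;> contradiction
  set θ : Fin 3 → X → ℝ := fun i x =>
    t i + (nextAngle t i - t i) * (u (i + 1) x / (u i x + u (i + 1) x)) with hθ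
  obtain ⟨F, hF, hFθ⟩ := exists_glue (A := fun i => {x : X | (x : M) ∈ Y i})
    (fun i => (hY i).preimage continuous_subtype_val) (fun x => hX x x.2)
    (u := fun i x => Circle.exp (θ i x)) (by
      intro i
      refine Circle.exp.continuous.comp_continuousOn ?_
      refine continuousOn_const.add (continuousOn_const.mul (ContinuousOn.div ?_ ?_ ?_))
      · exact ((hu _).comp continuous_subtype_val).continuousOn
      · exact (((hu _).comp continuous_subtype_val).add
          ((hu _).comp continuous_subtype_val)).continuousOn
      · intro x hx
        exact (hpos i x hx).ne') (by
      intro i x hi hi'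
      have e1 : u i x = 0 := (huY i x).2 hi'
      have e2 : u (i + 1 + 1) x = 0 := by
        rw [huY]
        have : i + 1 + 1 + 1 = i := by
          clear * - i
          decide +revert
        rw [this]
        exact hi
      have e3 : u (i + 1) x ≠ 0 := by
        have := hpos i x hi
        rw [e1, zero_add] at this
        exact this.ne'
      have e4 : θ i x = nextAngle t i := by
        simp only [hθ]
        rw [e1, zero_add, div_self e3]
        ring
      have e5 : θ (i + 1) x = t (i + 1) := by
        simp only [hθ]
        rw [e2]
        simp
      rw [e4, e5]
      apply Circle.ext
      rw [Circle.coe_exp, Circle.coe_exp, exp_nextAngle])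
  refine ⟨⟨F, hF⟩, fun i x hx => ⟨θ i x, ?_, hFθ i x hx⟩⟩
  have h1 := ht.lt_nextAngle i
  have h2 : 0 ≤ u (i + 1) x / (u i x + u (i + 1) x) :=
    div_nonneg (hu0 _ _) (hpos i x hx).le
  have h3 : u (i + 1) x / (u i x + u (i + 1) x) ≤ 1 :=
    div_le_one_of_le₀ (by linarith [hu0 i x]) (hpos i x hx).le
  constructor
  · simp only [hθ]
    nlinarith
  · simp only [hθ]
    nlinarith

end Classes

/-! ### Radial maps of the plane and their Jacobians -/

section Radial

theorem hasDerivAt_primitive {w : ℝ → ℝ} (hw : Continuous w) (x : ℝ) :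
    HasDerivAt (fun u => ∫ s in (0 : ℝ)..u, w s) (w x) x :=
  intervalIntegral.integral_hasDerivAt_right (hw.intervalIntegrable _ _)
    (hw.stronglyMeasurableAtFilter _ _) hw.continuousAt

theorem contDiff_primitive {w : ℝ → ℝ} (hw : ContDiff ℝ ∞ w) :
    ContDiff ℝ ∞ (fun u => ∫ s in (0 : ℝ)..u, w s) := by
  have h := hasDerivAt_primitive hw.continuous
  rw [contDiff_infty_iff_deriv]
  exact ⟨fun x => (h x).differentiableAt, by rwa [show deriv _ = w from funext fun x => (h x).deriv]⟩

/-- A smooth cutoff of the radius whose square has derivative at most `2 * B` times the radius. -/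
theorem exists_radial_profile {B : ℝ} (hB : 1 < B) :
    ∃ ρ : ℝ → ℝ, ContDiff ℝ ∞ ρ ∧ (∃ η > 0, ∀ u ≤ η, ρ u = 0) ∧ (∀ u, 1 ≤ u → ρ u = 1) ∧
      (∀ u, 0 ≤ ρ u ∧ ρ u ≤ 1) ∧ ∀ u, 0 ≤ u → |ρ u * deriv ρ u| ≤ B * u := by
  have hlim : Tendsto (fun δ : ℝ => (1 / (1 - 2 * δ)) ^ 2) (𝓝[>] 0) (𝓝 1) := by
    have : ContinuousAt (fun δ : ℝ => (1 / (1 - 2 * δ)) ^ 2) 0 := by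
      refine ContinuousAt.pow (ContinuousAt.div (by fun_prop) (by fun_prop) (by norm_num)) 2
    have := this.tendsto
    norm_num at this
    refine Tendsto.mono_left ?_ nhdsWithin_le_nhds
    simpa using this
  obtain ⟨δ, hδB, hδ0, hδ1⟩ : ∃ δ : ℝ, (1 / (1 - 2 * δ)) ^ 2 < B ∧ 0 < δ ∧ δ < 1 / 4 := by
    have h1 : ∀ᶠ δ : ℝ in 𝓝[>] 0, (1 / (1 - 2 * δ)) ^ 2 < B := hlim.eventually_lt_const hB
    have h2 : ∀ᶠ δ : ℝ in 𝓝[>] 0, δ ∈ Ioo (0 : ℝ) (1 / 4) := Ioo_mem_nhdsGT (by norm_num)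
    obtain ⟨δ, h1, h2⟩ := (h1.and h2).exists
    exact ⟨δ, h1, h2.1, h2.2⟩
  -- `ρ` is the primitive of a normalized bump supported inside `(0, 1)`. Its plateau has length `1
  -- - 2 δ`, so its height is at most `β = 1 / (1 - 2 δ)`. Then `ρ u ≤ β u` and `ρ' ≤ β`, and `δ`
  -- was chosen with `β² < B`.
  let f : ContDiffBump (1 / 2 : ℝ) := ⟨1 / 2 - δ, 1 / 2 - δ / 2, by linarith, by linarith⟩
  set b : ℝ → ℝ := f.normed MeasureTheory.volume with hb
  have hbs : ContDiff ℝ ∞ b := f.contDiff_normed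
  have hb0 : ∀ x, 0 ≤ b x := f.nonneg_normed
  set β : ℝ := 1 / (1 - 2 * δ) with hβ
  have hβpos : 0 < β := by rw [hβ]; apply one_div_pos.2; linarith
  have hbβ : ∀ x, b x ≤ β := by
    intro x
    refine (f.normed_le_div_measure_closedBall_rIn MeasureTheory.volume x).trans_eq ?_
    rw [MeasureTheory.Measure.real, Real.volume_closedBall]
    change 1 / (ENNReal.ofReal (2 * (1 / 2 - δ))).toReal = _
    rw [ENNReal.toReal_ofReal (by linarith), hβ]
    ring_nf
  have hsupp : ∀ x, b x ≠ 0 → x ∈ Ioo (δ / 2) 1 := by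
    intro x hx
    have : x ∈ Function.support b := hx
    rw [hb, f.support_normed_eq, Real.ball_eq_Ioo] at this
    change x ∈ Ioo (1 / 2 - (1 / 2 - δ / 2)) (1 / 2 + (1 / 2 - δ / 2)) at this
    exact ⟨by linarith [this.1], by linarith [this.2]⟩
  set ρ : ℝ → ℝ := fun u => ∫ s in (0 : ℝ)..u, b s with hρ
  have hd : ∀ x, HasDerivAt ρ (b x) x := hasDerivAt_primitive hbs.continuous
  have hzero : ∀ u ≤ δ / 2, ρ u = 0 := by
    intro u hu
    refine intervalIntegral.integral_zero_ae (Eventually.of_forall fun x hx => ?_)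
    by_contra hc
    have h1 := hsupp x hc
    rcases mem_uIoc.1 hx with h | h
    · linarith [h.2, h1.1]
    · linarith [h.2, h1.1]
  have hone : ∀ u, 1 ≤ u → ρ u = 1 := by
    intro u hu
    have : Function.support b ⊆ Ioc 0 u := fun x hx =>
      ⟨by linarith [(hsupp x hx).1], by linarith [(hsupp x hx).2]⟩
    rw [hρ]
    dsimp only
    rw [intervalIntegral.integral_eq_integral_of_support_subset this]
    exact f.integral_normed
  have hmono : Monotone ρ := monotone_of_deriv_nonneg (fun x => (hd x).differentiableAt)
    fun x => by rw [(hd x).deriv]; exact hb0 x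
  have hle : ∀ u, 0 ≤ u → ρ u ≤ β * u := by
    intro u hu
    have := intervalIntegral.norm_integral_le_of_norm_le_const (a := 0) (b := u) (f := b) (C := β)
      fun x _ => by rw [Real.norm_eq_abs, abs_of_nonneg (hb0 x)]; exact hbβ x
    rw [sub_zero, abs_of_nonneg hu] at this
    exact (le_abs_self _).trans this
  have h01 : ∀ u, 0 ≤ ρ u ∧ ρ u ≤ 1 := fun u => by
    constructor
    · rw [← hzero (min u 0) (by linarith [min_le_right u 0])]
      exact hmono (min_le_left _ _)
    · rw [← hone (max u 1) (le_max_right _ _)]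
      exact hmono (le_max_left _ _)
  refine ⟨ρ, contDiff_primitive hbs, ⟨δ / 2, by linarith, hzero⟩, hone, h01, fun u hu => ?_⟩
  rw [(hd u).deriv, abs_of_nonneg (mul_nonneg (h01 u).1 (hb0 u))]
  calc ρ u * b u ≤ (β * u) * β := mul_le_mul (hle u hu) (hbβ u) (hb0 u) (by positivity)
    _ = β ^ 2 * u := by ring
    _ ≤ B * u := by gcongr

/-- The determinant of two plane vectors. -/
def planeCross (a b : ℂ) : ℝ := a.re * b.im - b.re * a.im

theorem planeCross_smul_add (r s t : ℝ) (a b : ℂ) :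
    planeCross (r • a) (s • a + t • b) = r * t * planeCross a b := by
  simp [planeCross]
  ring

/-- The determinant may be computed in the polar frame `z`, `i z`, which spans a square of area
`‖z‖²`. -/
theorem planeDet_mul_normSq (L : ℂ →L[ℝ] ℂ) (z : ℂ) :
    planeDet L * ‖z‖ ^ 2 = planeCross (L z) (L (z * Complex.I)) := by
  have h1 : z = z.re • (1 : ℂ) + z.im • Complex.I := by apply Complex.ext <;> simp
  have h2 : z * Complex.I = (-z.im) • (1 : ℂ) + z.re • Complex.I := by apply Complex.ext <;> simp
  have e1 : L z = z.re • L 1 + z.im • L Complex.I := by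
    conv_lhs => rw [h1]
    rw [map_add, map_smul, map_smul]
  have e2 : L (z * Complex.I) = (-z.im) • L 1 + z.re • L Complex.I := by
    rw [h2, map_add, map_smul, map_smul]
  rw [e1, e2, ← Complex.normSq_eq_norm_sq, Complex.normSq_apply]
  simp [planeDet, planeCross]
  ring

/-- The map given in polar coordinates by `(r, θ) ↦ ρ (r * k θ) • C θ`. -/
noncomputable def radialMap (ρ k : ℝ → ℝ) (C : ℝ → ℂ) (z : ℂ) : ℂ :=
  ρ (‖z‖ * k z.arg) • C z.arg

variable {ρ k : ℝ → ℝ} {C : ℝ → ℂ}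

/-- Periodicity removes the branch cut of `arg`: in the logarithmic coordinate a radial map is a
formula without discontinuities. -/
theorem Function.Periodic.apply_arg_exp {W : Type*} {g : ℝ → W}
    (hg : Function.Periodic g (2 * Real.pi)) (w : ℂ) : g (Complex.exp w).arg = g w.im := by
  have h : (Complex.exp w).arg = w.im - toIocDiv Real.two_pi_pos (-Real.pi) w.im •
      (2 * Real.pi) := by
    rw [Complex.arg_exp]; rfl
  rw [h, hg.sub_zsmul_eq]

theorem radialMap_exp (hk : Function.Periodic k (2 * Real.pi))
    (hC : Function.Periodic C (2 * Real.pi)) (w : ℂ) :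
    radialMap ρ k C (Complex.exp w) = ρ (Real.exp w.re * k w.im) • C w.im := by
  rw [radialMap, hk.apply_arg_exp, hC.apply_arg_exp, Complex.norm_exp]

theorem radialMap_polar (hk : Function.Periodic k (2 * Real.pi))
    (hC : Function.Periodic C (2 * Real.pi)) {r : ℝ} (hr : 0 < r) (θ : ℝ) :
    radialMap ρ k C (r * Complex.exp (θ * Complex.I)) = ρ (r * k θ) • C θ := by
  have h : (r * Complex.exp (θ * Complex.I) : ℂ) = Complex.exp (Real.log r + θ * Complex.I) := by
    rw [Complex.exp_add, ← Complex.ofReal_exp, Real.exp_log hr]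
  rw [h, radialMap_exp hk hC]
  simp [Real.exp_log hr]

theorem radialMap_eventually_zero (hkc : Continuous k) {η : ℝ} (hη : 0 < η)
    (hρ : ∀ u ≤ η, ρ u = 0) : ∀ᶠ z in 𝓝 (0 : ℂ), radialMap ρ k C z = 0 := by
  obtain ⟨K, hK⟩ := (isCompact_Icc (a := -Real.pi) (b := Real.pi)).exists_bound_of_continuousOn
    hkc.continuousOn
  have h : Tendsto (fun z : ℂ => ‖z‖ * K) (𝓝 0) (𝓝 0) := by
    have : Continuous (fun z : ℂ => ‖z‖ * K) := by fun_prop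
    simpa using this.tendsto 0
  filter_upwards [h.eventually_lt_const hη] with z hz
  have h1 := hK z.arg ⟨(Complex.neg_pi_lt_arg z).le, Complex.arg_le_pi z⟩
  have h2 : ‖z‖ * k z.arg ≤ ‖z‖ * K :=
    mul_le_mul_of_nonneg_left ((le_abs_self _).trans h1) (norm_nonneg _)
  rw [radialMap, hρ _ (h2.trans hz.le), zero_smul]

/-- Away from the origin the map is a smooth function of a local branch of the logarithm; near the
origin it is zero, since `ρ` vanishes near `0`. -/
theorem contDiff_radialMap (hρs : ContDiff ℝ ∞ ρ) (hks : ContDiff ℝ ∞ k) (hCs : ContDiff ℝ ∞ C)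
    (hk : Function.Periodic k (2 * Real.pi)) (hC : Function.Periodic C (2 * Real.pi))
    {η : ℝ} (hη : 0 < η) (hρ : ∀ u ≤ η, ρ u = 0) : ContDiff ℝ ∞ (radialMap ρ k C) := by
  rw [contDiff_iff_contDiffAt]
  intro z
  by_cases hz : z = 0
  · rw [hz]
    exact contDiffAt_const.congr_of_eventuallyEq
      (radialMap_eventually_zero hks.continuous hη hρ)
  · have hG : ContDiff ℝ ∞ fun w : ℂ => ρ (Real.exp w.re * k w.im) • C w.im := by
      have hre : ContDiff ℝ ∞ Complex.re := Complex.reCLM.contDiff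
      have him : ContDiff ℝ ∞ Complex.im := Complex.imCLM.contDiff
      exact (hρs.comp ((Real.contDiff_exp.comp hre).mul (hks.comp him))).smul (hCs.comp him)
    -- Dividing by `z` gives a branch of the logarithm that is smooth at `z` even if `z` lies on the
    -- cut of the principal one.
    have hl : ContDiffAt ℝ ∞ (fun y => Complex.log (y / z) + Complex.log z) z := by
      refine ContDiffAt.add ?_ contDiffAt_const
      have h1 : ContDiffAt ℝ ∞ Complex.log (z / z) := by
        rw [div_self hz]
        exact (Complex.contDiffAt_log Complex.one_mem_slitPlane).restrict_scalars ℝ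
      refine ContDiffAt.comp (f := fun y => y / z) z h1 ?_
      simp only [div_eq_mul_inv]
      exact contDiffAt_id.mul contDiffAt_const
    refine (hG.contDiffAt.comp z hl).congr_of_eventuallyEq ?_
    filter_upwards [isOpen_ne.mem_nhds hz] with y hy
    rw [Function.comp_apply, ← radialMap_exp hk hC, Complex.exp_add,
      Complex.exp_log (div_ne_zero hy hz), Complex.exp_log hz, div_mul_cancel₀ _ hz]

/-- With `u = r k`, the images of `z` and `i z` are `ρ' u C` and a multiple of `C` plus `ρ C'`. The
multiple of `C`, which contains `k'`, drops out of the cross product, so the Jacobian times `r²` is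
`ρ ρ' u (C × C')`. The bound `|ρ ρ'| ≤ B u` turns this into `B k² |C × C'| r²`. -/
theorem abs_planeDet_radialMap_le (hρs : ContDiff ℝ ∞ ρ) (hks : ContDiff ℝ ∞ k)
    (hCs : ContDiff ℝ ∞ C) (hk : Function.Periodic k (2 * Real.pi))
    (hC : Function.Periodic C (2 * Real.pi)) (hkpos : ∀ θ, 0 < k θ) {η : ℝ} (hη : 0 < η)
    (hρ : ∀ u ≤ η, ρ u = 0) {B K : ℝ} (hB : ∀ u, 0 ≤ u → |ρ u * deriv ρ u| ≤ B * u)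
    (hK : ∀ θ, k θ ^ 2 * |planeCross (C θ) (deriv C θ)| ≤ K) (z : ℂ) :
    |planeDet (fderiv ℝ (radialMap ρ k C) z)| ≤ B * K := by
  have hB0 : 0 ≤ B := by
    have := (abs_nonneg _).trans (hB 1 zero_le_one)
    linarith
  have hK0 : 0 ≤ K := le_trans (by positivity) (hK 0)
  by_cases hz : z = 0
  · have h0 : fderiv ℝ (radialMap ρ k C) z = 0 := by
      have : radialMap ρ k C =ᶠ[𝓝 z] fun _ => 0 := by
        rw [hz]
        exact radialMap_eventually_zero hks.continuous hη hρ
      rw [this.fderiv_eq]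
      simp
    rw [h0]
    simp only [planeDet, zero_apply, Complex.zero_re, Complex.zero_im]
    simpa using mul_nonneg hB0 hK0
  set w := Complex.log z with hw
  have hexp : Complex.exp w = z := Complex.exp_log hz
  set L := fderiv ℝ (radialMap ρ k C) z with hLdef
  have hL : HasFDerivAt (radialMap ρ k C) L z :=
    ((contDiff_radialMap hρs hks hCs hk hC hη hρ).differentiable (by simp) z).hasFDerivAt
  set u := Real.exp w.re * k w.im with hu
  have hcurve : ∀ v : ℂ, HasDerivAt (fun s : ℝ => radialMap ρ k C (Complex.exp (w + s * v)))
      (L (z * v)) 0 := by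
    intro v
    have h1 : HasDerivAt (fun s : ℝ => w + (s : ℂ) * v) v 0 := by
      simpa using ((Complex.ofRealCLM.hasDerivAt (x := (0 : ℝ))).mul_const v).const_add w
    have h2 : HasDerivAt (fun s : ℝ => Complex.exp (w + (s : ℂ) * v)) (z * v) 0 := by
      have := h1.cexp
      simpa [hexp] using this
    have h3 : HasFDerivAt (radialMap ρ k C) L (Complex.exp (w + ((0 : ℝ) : ℂ) * v)) := by
      simpa [hexp] using hL
    exact h3.comp_hasDerivAt (0 : ℝ) h2
  have hρd : ∀ x, HasDerivAt ρ (deriv ρ x) x := fun x =>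
    (hρs.differentiable (by simp) x).hasDerivAt
  have hkd : ∀ x, HasDerivAt k (deriv k x) x := fun x =>
    (hks.differentiable (by simp) x).hasDerivAt
  have hCd : ∀ x, HasDerivAt C (deriv C x) x := fun x =>
    (hCs.differentiable (by simp) x).hasDerivAt
  have hx : L z = (deriv ρ u * u) • C w.im := by
    have h1 := hcurve 1
    rw [mul_one] at h1
    refine h1.unique ?_
    have h2 : HasDerivAt (fun s : ℝ => Real.exp (w.re + s) * k w.im) u 0 := by
      have := (((hasDerivAt_id (0 : ℝ)).const_add w.re).exp).mul_const (k w.im)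
      simpa [hu] using this
    have h3 : HasDerivAt (fun s : ℝ => ρ (Real.exp (w.re + s) * k w.im)) (deriv ρ u * u) 0 := by
      refine HasDerivAt.comp (0 : ℝ) (h₂ := ρ) ?_ h2
      simpa [hu] using hρd u
    refine (h3.smul_const (C w.im)).congr_of_eventuallyEq (Eventually.of_forall fun s => ?_)
    simp [radialMap_exp hk hC]
  have hy : L (z * Complex.I) =
      (deriv ρ u * (Real.exp w.re * deriv k w.im)) • C w.im + ρ u • deriv C w.im := by
    refine (hcurve Complex.I).unique ?_
    have h1 : HasDerivAt (fun s : ℝ => k (w.im + s)) (deriv k w.im) 0 :=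
      HasDerivAt.comp_const_add w.im 0 (by rw [add_zero]; exact hkd w.im)
    have h2 : HasDerivAt (fun s : ℝ => C (w.im + s)) (deriv C w.im) 0 :=
      HasDerivAt.comp_const_add w.im 0 (by rw [add_zero]; exact hCd w.im)
    have h3 : HasDerivAt (fun s : ℝ => ρ (Real.exp w.re * k (w.im + s)))
        (deriv ρ u * (Real.exp w.re * deriv k w.im)) 0 := by
      refine HasDerivAt.comp (0 : ℝ) (h₂ := ρ) ?_ (h1.const_mul _)
      simpa [hu] using hρd u
    have h4 := h3.smul h2
    simp only [add_zero] at h4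
    rw [add_comm]
    refine h4.congr_of_eventuallyEq (Eventually.of_forall fun s => ?_)
    simp [radialMap_exp hk hC]
  have hdet := planeDet_mul_normSq L z
  rw [hx, hy, planeCross_smul_add] at hdet
  have hnorm : ‖z‖ = Real.exp w.re := by rw [← hexp, Complex.norm_exp]
  have hupos : 0 < u := mul_pos (Real.exp_pos _) (hkpos _)
  have hzpos : 0 < ‖z‖ ^ 2 := by have := norm_pos_iff.2 hz; positivity
  refine le_of_mul_le_mul_right ?_ hzpos
  calc |planeDet L| * ‖z‖ ^ 2 = |planeDet L * ‖z‖ ^ 2| := by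
        rw [abs_mul, abs_of_pos hzpos]
    _ = |ρ u * deriv ρ u| * (u * |planeCross (C w.im) (deriv C w.im)|) := by
        rw [hdet, ← abs_of_pos hupos, ← abs_mul, ← abs_mul, abs_of_pos hupos]
        ring_nf
    _ ≤ (B * u) * (u * |planeCross (C w.im) (deriv C w.im)|) := by
        gcongr
        exact hB u hupos.le
    _ = B * (k w.im ^ 2 * |planeCross (C w.im) (deriv C w.im)|) * ‖z‖ ^ 2 := by
        rw [hnorm, hu]
        ring
    _ ≤ B * K * ‖z‖ ^ 2 := by
        gcongr
        exact hK _

end Radial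

/-! ### The gauge of a convex body in polar coordinates -/

section Body

/-- The gauge of `D` in the direction of the angle `θ`; its inverse is the distance from the origin
to the boundary of `D` in that direction. -/
noncomputable def dirGauge (D : Set ℂ) (θ : ℝ) : ℝ := gauge D (Complex.exp (θ * Complex.I))

variable {D : Set ℂ}

theorem dirGauge_periodic : Function.Periodic (dirGauge D) (2 * Real.pi) := by
  intro θ
  rw [dirGauge, dirGauge]
  push_cast
  rw [add_mul, Complex.exp_add, Complex.exp_two_pi_mul_I, mul_one]

theorem gauge_polar {r : ℝ} (hr : 0 ≤ r) (θ : ℝ) :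
    gauge D (r * Complex.exp (θ * Complex.I)) = r * dirGauge D θ := by
  rw [← Complex.real_smul, gauge_smul_of_nonneg hr]
  rfl

theorem dirGauge_pos (hc : IsCompact D) (h0 : D ∈ 𝓝 0) (θ : ℝ) : 0 < dirGauge D θ :=
  (gauge_pos (absorbent_nhds_zero h0) (NormedSpace.isVonNBounded_of_isBounded ℝ hc.isBounded)).2 (Complex.exp_ne_zero _)

theorem continuous_dirGauge (hconv : Convex ℝ D) (h0 : D ∈ 𝓝 0) : Continuous (dirGauge D) :=
  (continuous_gauge hconv h0).comp (by fun_prop)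

theorem mem_iff_gauge_le_one (hc : IsCompact D) (hconv : Convex ℝ D) (h0 : D ∈ 𝓝 0) {z : ℂ} :
    z ∈ D ↔ gauge D z ≤ 1 := by
  rw [gauge_le_one_iff_mem_closure hconv h0, hc.isClosed.closure_eq]

/-- The area in polar coordinates is half the integral of the squared boundary radius, and that
radius is the inverse of the gauge. -/
theorem integral_inv_dirGauge_sq (hc : IsCompact D) (hconv : Convex ℝ D) (h0 : D ∈ 𝓝 0)
    (harea : MeasureTheory.volume D = 1) :
    ∫ θ in (0 : ℝ)..(2 * Real.pi), (dirGauge D θ ^ 2)⁻¹ = 2 := by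
  have hpos := dirGauge_pos hc h0
  have hcont := continuous_dirGauge hconv h0
  have hinv : Continuous fun θ => (dirGauge D θ ^ 2)⁻¹ :=
    (hcont.pow 2).inv₀ fun θ => (pow_pos (hpos θ) 2).ne'
  have hmeas := hc.isClosed.measurableSet
  have h1 := Complex.lintegral_comp_polarCoord_symm (D.indicator (1 : ℂ → ENNReal))
  rw [MeasureTheory.lintegral_indicator_one hmeas, harea, polarCoord_target,
    MeasureTheory.Measure.volume_eq_prod, ← MeasureTheory.Measure.prod_restrict,
    MeasureTheory.lintegral_prod_symm] at h1
  · have h2 : ∀ θ : ℝ, ∫⁻ r in Ioi (0 : ℝ), ENNReal.ofReal r •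
        D.indicator (1 : ℂ → ENNReal) (Complex.polarCoord.symm (r, θ)) =
        ENNReal.ofReal ((dirGauge D θ ^ 2)⁻¹ / 2) := by
      intro θ
      have hR : 0 < (dirGauge D θ)⁻¹ := inv_pos.2 (hpos θ)
      have h3 : ∀ r ∈ Ioi (0 : ℝ), ENNReal.ofReal r •
          D.indicator (1 : ℂ → ENNReal) (Complex.polarCoord.symm (r, θ)) =
          (Ioc (0 : ℝ) (dirGauge D θ)⁻¹).indicator (fun r => ENNReal.ofReal r) r := by
        intro r hr
        have hr' : (0 : ℝ) < r := hr
        have e : Complex.polarCoord.symm (r, θ) = r * Complex.exp (θ * Complex.I) := by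
          rw [Complex.polarCoord_symm_apply, Complex.exp_mul_I, Complex.ofReal_cos,
            Complex.ofReal_sin]
        have hiff : (r * Complex.exp (θ * Complex.I) : ℂ) ∈ D ↔ r ≤ (dirGauge D θ)⁻¹ := by
          rw [mem_iff_gauge_le_one hc hconv h0, gauge_polar hr'.le, ← le_div_iff₀ (hpos θ),
            one_div]
        rw [e]
        by_cases h : r ≤ (dirGauge D θ)⁻¹
        · rw [indicator_of_mem (hiff.2 h), indicator_of_mem (show r ∈ Ioc 0 (dirGauge D θ)⁻¹ from ⟨hr', h⟩)]
          simp
        · rw [indicator_of_notMem (fun hh => h (hiff.1 hh)),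
            indicator_of_notMem (fun hh => h hh.2)]
          simp
      rw [MeasureTheory.setLIntegral_congr_fun measurableSet_Ioi h3,
        MeasureTheory.lintegral_indicator measurableSet_Ioc,
        MeasureTheory.Measure.restrict_restrict measurableSet_Ioc,
        inter_eq_left.2 Ioc_subset_Ioi_self,
        ← MeasureTheory.ofReal_integral_eq_lintegral_ofReal,
        ← intervalIntegral.integral_of_le hR.le, integral_id]
      · congr 1
        rw [inv_pow]
        ring
      · exact (continuous_id.integrableOn_Icc (a := (0 : ℝ))).mono_set Ioc_subset_Icc_self
      · filter_upwards [MeasureTheory.ae_restrict_mem measurableSet_Ioc] with r hr using hr.1.le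
    rw [MeasureTheory.lintegral_congr h2, ← MeasureTheory.ofReal_integral_eq_lintegral_ofReal,
      ← MeasureTheory.integral_Ioc_eq_integral_Ioo, ← intervalIntegral.integral_of_le
      (by linarith [Real.pi_pos]), intervalIntegral.integral_div, ENNReal.ofReal_eq_one] at h1
    · have hper : Function.Periodic (fun θ => (dirGauge D θ ^ 2)⁻¹) (2 * Real.pi) := fun θ => by
        dsimp only
        rw [dirGauge_periodic]
      have := hper.intervalIntegral_add_eq 0 (-Real.pi)
      rw [zero_add, show -Real.pi + 2 * Real.pi = Real.pi by ring] at this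
      rw [this]
      linarith
    · exact ((hinv.div_const 2).integrableOn_Icc (a := -Real.pi) (b := Real.pi)).mono_set
        Ioo_subset_Icc_self
    · exact Eventually.of_forall fun θ => by have := hpos θ; positivity
  · refine Measurable.aemeasurable ?_
    refine (ENNReal.measurable_ofReal.comp measurable_fst).smul ?_
    refine (measurable_one.indicator hmeas).comp ?_
    have : Continuous fun p : ℝ × ℝ => Complex.polarCoord.symm p := by
      simp only [Complex.polarCoord_symm_apply]
      fun_prop
    exact this.measurable

end Body

/-! ### Reparametrization of the circle by a density -/

section Reparametrization

/-- The smooth reparametrization of the circle whose speed is proportional to a given positive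
density. -/
theorem exists_reparametrization {w : ℝ → ℝ} (hw : ContDiff ℝ ∞ w) (hpos : ∀ θ, 0 < w θ)
    (hper : Function.Periodic w (2 * Real.pi)) :
    ∃ τ : ℝ ≃ₜ ℝ, ContDiff ℝ ∞ τ ∧ ContDiff ℝ ∞ τ.symm ∧ StrictMono τ ∧
      (∀ θ, τ (θ + 2 * Real.pi) = τ θ + 2 * Real.pi) ∧
      ∀ θ, HasDerivAt τ (2 * Real.pi / (∫ s in (0 : ℝ)..(2 * Real.pi), w s) * w θ) θ := by
  have hpi := Real.pi_pos
  set J := ∫ s in (0 : ℝ)..(2 * Real.pi), w s with hJ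
  have hJpos : 0 < J := intervalIntegral.intervalIntegral_pos_of_pos_on
    (hw.continuous.intervalIntegrable _ _) (fun x _ => hpos x) (by linarith)
  set f : ℝ → ℝ := fun θ => 2 * Real.pi / J * ∫ s in (0 : ℝ)..θ, w s with hf
  have hd : ∀ θ, HasDerivAt f (2 * Real.pi / J * w θ) θ := fun θ =>
    (hasDerivAt_primitive hw.continuous θ).const_mul _
  have hfs : ContDiff ℝ ∞ f := contDiff_const.mul (contDiff_primitive hw)
  have hmono : StrictMono f := strictMono_of_deriv_pos fun θ => by
    rw [(hd θ).deriv]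
    have := hpos θ
    positivity
  have hequi : ∀ θ, f (θ + 2 * Real.pi) = f θ + 2 * Real.pi := by
    intro θ
    have h1 : ∫ s in (0 : ℝ)..(θ + 2 * Real.pi), w s = (∫ s in (0 : ℝ)..θ, w s) + J := by
      rw [← intervalIntegral.integral_add_adjacent_intervals (b := θ)
        (hw.continuous.intervalIntegrable _ _) (hw.continuous.intervalIntegrable _ _),
        hper.intervalIntegral_add_eq θ 0, zero_add]
    simp only [hf]
    rw [h1]
    field_simp
  have hint : ∀ n : ℤ, f (n * (2 * Real.pi)) = n * (2 * Real.pi) := by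
    intro n
    have hp : Function.Periodic (fun θ => f θ - θ) (2 * Real.pi) := fun θ => by
      dsimp only
      rw [hequi]; ring
    have h0 : f 0 = 0 := by simp [hf]
    have := hp.int_mul n 0
    simp only [zero_add, h0, sub_zero] at this
    linarith
  have hsurj : Function.Surjective f := by
    intro y
    refine mem_range_of_exists_le_of_exists_ge hfs.continuous
      ⟨(⌊y / (2 * Real.pi)⌋ : ℤ) * (2 * Real.pi), ?_⟩ ⟨(⌈y / (2 * Real.pi)⌉ : ℤ) * (2 * Real.pi), ?_⟩
    · rw [hint, ← le_div_iff₀ (by positivity)]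
      exact Int.floor_le _
    · rw [hint, ← div_le_iff₀ (by positivity)]
      exact Int.le_ceil _
  let τ : ℝ ≃ₜ ℝ := (hmono.orderIsoOfSurjective f hsurj).toHomeomorph
  have hτ : (τ : ℝ → ℝ) = f := rfl
  refine ⟨τ, hfs, ?_, hmono, hequi, hd⟩
  refine τ.contDiff_symm_deriv (f' := fun θ => 2 * Real.pi / J * w θ) (fun θ => ?_) hd hfs
  have := hpos θ
  positivity

end Reparametrization

/-! ### From a convex body to the disc -/

section MapToDisc

theorem planeCross_exp {τ : ℝ → ℝ} {d θ : ℝ} (hτ : HasDerivAt τ d θ) :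
    planeCross (Complex.exp (τ θ * Complex.I))
      (deriv (fun θ => Complex.exp (τ θ * Complex.I)) θ) = d := by
  have h : HasDerivAt (fun θ => Complex.exp (τ θ * Complex.I))
      (Complex.exp (τ θ * Complex.I) * (d * Complex.I)) θ :=
    (hτ.ofReal_comp.mul_const Complex.I).cexp
  have h1 := Complex.exp_ofReal_mul_I_re (τ θ)
  have h2 := Complex.exp_ofReal_mul_I_im (τ θ)
  rw [h.deriv]
  simp only [planeCross, Complex.mul_re, Complex.mul_im, Complex.I_re, Complex.I_im,
    Complex.ofReal_re, Complex.ofReal_im, h1, h2]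
  linear_combination d * Real.sin_sq_add_cos_sq (τ θ)

/-- A smooth, almost area preserving map of a convex body of area one onto the unit disc (up to the
factor `π`) that sends the boundary to the unit circle. -/
theorem exists_map_to_disc {D : Set ℂ} (hc : IsCompact D) (hconv : Convex ℝ D) (h0 : D ∈ 𝓝 0)
    (harea : MeasureTheory.volume D = 1) {c : ℝ} (hπ : Real.pi < c) :
    ∃ T : ℂ → ℂ, ContDiff ℝ ∞ T ∧ (∀ z, ‖T z‖ ≤ 1) ∧ (∀ z, |planeDet (fderiv ℝ T z)| ≤ c) ∧
      ∃ τ : ℝ → ℝ, StrictMono τ ∧ (∀ θ, τ (θ + 2 * Real.pi) = τ θ + 2 * Real.pi) ∧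
        ∀ r θ : ℝ, 0 < r → (r * Complex.exp (θ * Complex.I) : ℂ) ∈ frontier D →
          T (r * Complex.exp (θ * Complex.I)) = Complex.exp (τ θ * Complex.I) := by
  have hpi := Real.pi_pos
  have hgpos := dirGauge_pos hc h0
  have hgcont := continuous_dirGauge hconv h0
  obtain ⟨δ, hδ, hδc⟩ : ∃ δ > (0 : ℝ), (1 + δ) * (Real.pi * (1 + δ) ^ 2) < c := by
    have : ContinuousAt (fun δ : ℝ => (1 + δ) * (Real.pi * (1 + δ) ^ 2)) 0 := by fun_prop
    have h1 : Tendsto (fun δ : ℝ => (1 + δ) * (Real.pi * (1 + δ) ^ 2)) (𝓝[>] 0) (𝓝 Real.pi) := by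
      refine Tendsto.mono_left ?_ nhdsWithin_le_nhds
      simpa using this.tendsto
    obtain ⟨δ, h2, h3⟩ := ((h1.eventually_lt_const hπ).and self_mem_nhdsWithin).exists
    exact ⟨δ, h3, h2⟩
  obtain ⟨m, hm, hmg⟩ : ∃ m > 0, ∀ θ, m ≤ dirGauge D θ := by
    obtain ⟨z, hz, hmin⟩ := (isCompact_sphere (0 : ℂ) 1).exists_isMinOn
      (NormedSpace.sphere_nonempty.2 zero_le_one) (continuous_gauge hconv h0).continuousOn
    refine ⟨gauge D z, (gauge_pos (absorbent_nhds_zero h0)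
      (NormedSpace.isVonNBounded_of_isBounded ℝ hc.isBounded)).2 ?_, fun θ => hmin ?_⟩
    · rintro rfl
      simp at hz
    · simp [Complex.norm_exp_ofReal_mul_I]
  -- Approximating `1 + δ / 2` times the gauge with error below `δ / 2` times its minimum on the
  -- circle puts `k` strictly between the gauge and `1 + δ` times the gauge. The lower bound gives
  -- `r k ≥ 1` on the boundary, where `ρ` is therefore `1`; the upper bound controls the area.
  obtain ⟨G, hGs, hG, -⟩ := Continuous.exists_contDiff_approx (E := ℂ) (F := ℝ) ⊤
    (f := fun z => (1 + δ / 2) * gauge D z) (ε := fun _ => δ / 2 * m)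
    (continuous_const.mul (continuous_gauge hconv h0)) continuous_const fun _ => by positivity
  have hexp : ContDiff ℝ ∞ fun θ : ℝ => Complex.exp (θ * Complex.I) :=
    (Complex.ofRealCLM.contDiff.mul contDiff_const).cexp
  set k : ℝ → ℝ := fun θ => G (Complex.exp (θ * Complex.I)) with hk
  have hks : ContDiff ℝ ∞ k := hGs.comp hexp
  have hkper : Function.Periodic k (2 * Real.pi) := by
    intro θ
    simp only [hk]
    push_cast
    rw [add_mul, Complex.exp_add, Complex.exp_two_pi_mul_I, mul_one]
  have hkg : ∀ θ, dirGauge D θ < k θ ∧ k θ < (1 + δ) * dirGauge D θ := by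
    intro θ
    have h1 := hG (Complex.exp (θ * Complex.I))
    rw [Real.dist_eq, abs_lt] at h1
    have h2 := mul_le_mul_of_nonneg_left (hmg θ) (half_pos hδ).le
    change _ < k θ - (1 + δ / 2) * dirGauge D θ ∧ k θ - (1 + δ / 2) * dirGauge D θ < _ at h1
    constructor <;> linarith [h1.1, h1.2]
  have hkpos : ∀ θ, 0 < k θ := fun θ => (hgpos θ).trans (hkg θ).1
  have hk2 : ∀ θ, k θ ^ 2 ≠ 0 := fun θ => (pow_pos (hkpos θ) 2).ne'
  obtain ⟨τ, hτs, -, hτm, hτe, hτd⟩ := exists_reparametrization (w := fun θ => (k θ ^ 2)⁻¹)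
    ((hks.pow 2).inv hk2) (fun θ => inv_pos.2 (pow_pos (hkpos θ) 2))
    (fun θ => by dsimp only; rw [hkper])
  set J := ∫ s in (0 : ℝ)..(2 * Real.pi), (k s ^ 2)⁻¹ with hJ
  have hJle : 2 / (1 + δ) ^ 2 ≤ J := by
    rw [← integral_inv_dirGauge_sq hc hconv h0 harea, ← intervalIntegral.integral_div]
    refine intervalIntegral.integral_mono_on (by positivity) ?_ ?_ fun θ _ => ?_
    · refine Continuous.intervalIntegrable ?_ _ _
      exact ((hgcont.pow 2).inv₀ fun θ => (pow_pos (hgpos θ) 2).ne').div_const _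
    · exact ((hks.continuous.pow 2).inv₀ hk2).intervalIntegrable _ _
    · rw [div_eq_mul_inv, ← mul_inv]
      refine inv_anti₀ (pow_pos (hkpos θ) 2) ?_
      rw [← mul_pow, mul_comm]
      exact pow_le_pow_left₀ (hkpos θ).le (hkg θ).2.le 2
  have hJpos : 0 < J := lt_of_lt_of_le (by positivity) hJle
  obtain ⟨ρ, hρs, ⟨η, hη, hρ0⟩, hρ1, hρ01, hρB⟩ := exists_radial_profile (B := 1 + δ) (by linarith)
  set C : ℝ → ℂ := fun θ => Complex.exp (τ θ * Complex.I) with hC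
  have hCs : ContDiff ℝ ∞ C := hexp.comp hτs
  have hCper : Function.Periodic C (2 * Real.pi) := by
    intro θ
    simp only [hC]
    rw [hτe]
    push_cast
    rw [add_mul, Complex.exp_add, Complex.exp_two_pi_mul_I, mul_one]
  refine ⟨radialMap ρ k C, contDiff_radialMap hρs hks hCs hkper hCper hη hρ0, fun z => ?_,
    fun z => ?_, τ, hτm, hτe, fun r θ hr hz => ?_⟩
  · rw [radialMap, norm_smul, hC, Complex.norm_exp_ofReal_mul_I, mul_one, Real.norm_eq_abs,
      abs_of_nonneg (hρ01 _).1]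
    exact (hρ01 _).2
  · refine (abs_planeDet_radialMap_le hρs hks hCs hkper hCper hkpos hη hρ0 hρB
      (K := Real.pi * (1 + δ) ^ 2) (fun θ => ?_) z).trans hδc.le
    rw [hC, planeCross_exp (hτd θ), abs_of_nonneg (by have := hk2 θ; positivity)]
    -- The speed of `τ` was chosen to cancel `k²`, leaving the constant `2π / J`. Since the squared
    -- boundary radius has integral `2`, `J` is at least `2 / (1 + δ)²`.
    have e : k θ ^ 2 * (2 * Real.pi / J * (k θ ^ 2)⁻¹) = 2 * Real.pi / J := by
      rw [mul_comm, mul_assoc, inv_mul_cancel₀ (hk2 θ), mul_one]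
    rw [e, div_le_iff₀ hJpos]
    have : Real.pi * (1 + δ) ^ 2 * (2 / (1 + δ) ^ 2) = 2 * Real.pi := by
      field_simp
    rw [← this]
    gcongr
  · rw [radialMap_polar hkper hCper hr, hρ1, one_smul]
    have h1 := (gauge_eq_one_iff_mem_frontier hconv h0).2 hz
    rw [gauge_polar hr.le] at h1
    rw [← h1]
    exact mul_le_mul_of_nonneg_left (hkg θ).1.le hr.le

end MapToDisc

/-! ### Smooth monotone angle maps that rest at given angles -/

section Flattening

/-- A smooth staircase: it is constant on `[n - 1/2, n]` and increases by one on `[n, n + 1/2]`. -/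
noncomputable def smoothStair (x : ℝ) : ℝ := ⌊x⌋ + Real.smoothTransition (2 * Int.fract x)

theorem smoothStair_eq {k : ℤ} {x : ℝ} (hx : x ∈ Ioo (k - 1 / 2 : ℝ) (k + 1)) :
    smoothStair x = k + Real.smoothTransition (2 * (x - k)) := by
  by_cases h : (k : ℝ) ≤ x
  · have : ⌊x⌋ = k := Int.floor_eq_iff.2 ⟨h, hx.2⟩
    rw [smoothStair, Int.fract, this]
  · push Not at h
    have : ⌊x⌋ = k - 1 := Int.floor_eq_iff.2 ⟨by push_cast; linarith [hx.1], by push_cast; linarith⟩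
    rw [smoothStair, Int.fract, this, Real.smoothTransition.one_of_one_le (by push_cast; linarith [hx.1]),
      Real.smoothTransition.zero_of_nonpos (by linarith)]
    push_cast
    ring

theorem contDiff_smoothStair : ContDiff ℝ ∞ smoothStair := by
  rw [contDiff_iff_contDiffAt]
  intro x
  have h : ContDiff ℝ ∞ fun y : ℝ => (⌊x⌋ : ℝ) + Real.smoothTransition (2 * (y - ⌊x⌋)) :=
    contDiff_const.add (Real.smoothTransition.contDiff.comp (by fun_prop))
  refine h.contDiffAt.congr_of_eventuallyEq ?_
  filter_upwards [Ioo_mem_nhds (show (⌊x⌋ - 1 / 2 : ℝ) < x by linarith [Int.floor_le x])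
    (Int.lt_floor_add_one x)] with y hy
  exact smoothStair_eq hy

theorem monotone_smoothStair : Monotone smoothStair := by
  intro x y hxy
  rcases (Int.floor_mono hxy).eq_or_lt with h | h
  · rw [smoothStair, smoothStair, Int.fract, Int.fract, h]
    gcongr
    exact Real.smoothTransition.monotone (by linarith)
  · have h1 : (⌊x⌋ : ℝ) + 1 ≤ ⌊y⌋ := by exact_mod_cast h
    have h2 := Real.smoothTransition.le_one (2 * Int.fract x)
    have h3 := Real.smoothTransition.nonneg (2 * Int.fract y)
    rw [smoothStair, smoothStair]
    linarith

theorem smoothStair_add_one (x : ℝ) : smoothStair (x + 1) = smoothStair x + 1 := by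
  rw [smoothStair, smoothStair, Int.floor_add_one, Int.fract_add_one]
  push_cast
  ring

/-- A function does not cross the level `s` at any point. -/
def NonCrossing (a : ℝ → ℝ) (s : ℝ) : Prop :=
  ∀ t₀, a t₀ = s → (∀ᶠ t in 𝓝 t₀, s ≤ a t) ∨ ∀ᶠ t in 𝓝 t₀, a t ≤ s

theorem exists_nonCrossing_single (u : ℝ) :
    ∃ b : ℝ → ℝ, ContDiff ℝ ∞ b ∧ Monotone b ∧ (∀ t, b (t + 2 * Real.pi) = b t + 2 * Real.pi) ∧
      NonCrossing b u := by
  have hpi := Real.pi_pos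
  -- The rescaled staircase has the constant value `u` on `[u - π, u]`. Monotonicity then bounds it
  -- by `u` on one side of any point.
  set b : ℝ → ℝ := fun x => u + 2 * Real.pi * smoothStair ((x - u) / (2 * Real.pi)) with hb
  have hmono : Monotone b := fun x y hxy => by
    have := monotone_smoothStair (show (x - u) / (2 * Real.pi) ≤ (y - u) / (2 * Real.pi) by gcongr)
    simp only [hb]
    gcongr
  have hu : b u = u := by
    simp only [hb, sub_self, zero_div]
    rw [smoothStair_eq (k := 0) (by constructor <;> norm_num)]
    simp
  have hu' : b (u - Real.pi) = u := by
    simp only [hb]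
    have : (u - Real.pi - u) / (2 * Real.pi) = -(1 / 2) := by field_simp; ring
    rw [this, smoothStair_eq (k := -1) (by constructor <;> norm_num)]
    norm_num
  refine ⟨b, ?_, hmono, fun t => ?_, fun t₀ _ => ?_⟩
  · exact contDiff_const.add (contDiff_const.mul (contDiff_smoothStair.comp (by fun_prop)))
  · simp only [hb]
    have : (t + 2 * Real.pi - u) / (2 * Real.pi) = (t - u) / (2 * Real.pi) + 1 := by
      field_simp; ring
    rw [this, smoothStair_add_one]
    ring
  · by_cases h : t₀ < u
    · right
      filter_upwards [gt_mem_nhds h] with t ht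
      exact (hmono ht.le).trans_eq hu
    · left
      filter_upwards [lt_mem_nhds (show u - Real.pi < t₀ by linarith)] with t ht
      exact hu'.symm.trans_le (hmono ht.le)

/-- If the map `a` built so far crosses `s` at `t₀`, monotonicity makes `t₀` the only preimage of
`s`. Precomposing with a map that does not cross `t₀` repairs this, and precomposition preserves the
levels already treated. -/
theorem exists_nonCrossing (F : Finset ℝ) :
    ∃ a : ℝ → ℝ, ContDiff ℝ ∞ a ∧ Monotone a ∧ (∀ t, a (t + 2 * Real.pi) = a t + 2 * Real.pi) ∧
      ∀ s ∈ F, NonCrossing a s := by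
  classical
  induction F using Finset.induction_on with
  | empty => exact ⟨id, contDiff_id, monotone_id, fun _ => rfl, by simp⟩
  | insert s F _ ih =>
    obtain ⟨a, hs, hm, he, hF⟩ := ih
    by_cases hns : NonCrossing a s
    · exact ⟨a, hs, hm, he, by simpa using ⟨hns, hF⟩⟩
    · unfold NonCrossing at hns
      push Not at hns
      obtain ⟨t₀, ht₀, hl, hr⟩ := hns
      obtain ⟨b, hbs, hbm, hbe, hb⟩ := exists_nonCrossing_single t₀
      refine ⟨a ∘ b, hs.comp hbs, hm.comp hbm, fun t => by simp [hbe, he], fun s' hs' => ?_⟩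
      rw [Finset.mem_insert] at hs'
      rcases hs' with rfl | hs'
      · have huniq : ∀ t, a t = s' → t = t₀ := by
          intro t ht
          rcases lt_trichotomy t t₀ with h | h | h
          · refine (hl ?_).elim
            filter_upwards [lt_mem_nhds h] with x hx
            exact not_lt.2 (ht.symm.trans_le (hm hx.le))
          · exact h
          · refine (hr ?_).elim
            filter_upwards [gt_mem_nhds h] with x hx
            exact not_lt.2 ((hm hx.le).trans_eq ht)
        intro x hx
        rcases hb x (huniq _ hx) with h | h
        · left
          filter_upwards [h] with y hy
          exact ht₀.symm.trans_le (hm hy)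
        · right
          filter_upwards [h] with y hy
          exact (hm hy).trans_eq ht₀
      · intro x hx
        rcases hF s' hs' (b x) hx with h | h
        · exact Or.inl (hbs.continuous.continuousAt.eventually h)
        · exact Or.inr (hbs.continuous.continuousAt.eventually h)

theorem add_int_mul_of_equivariant {a : ℝ → ℝ} (he : ∀ t, a (t + 2 * Real.pi) = a t + 2 * Real.pi)
    (t : ℝ) (n : ℤ) : a (t + n * (2 * Real.pi)) = a t + n * (2 * Real.pi) := by
  have hp : Function.Periodic (fun θ => a θ - θ) (2 * Real.pi) := fun θ => by
    dsimp only
    rw [he]; ring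
  have := hp.int_mul n t
  linarith

theorem NonCrossing.add_int_mul {a : ℝ → ℝ} (he : ∀ t, a (t + 2 * Real.pi) = a t + 2 * Real.pi)
    {s : ℝ} (h : NonCrossing a s) (n : ℤ) : NonCrossing a (s + n * (2 * Real.pi)) := by
  intro t₀ ht₀
  have h1 : ∀ t, a (t - n * (2 * Real.pi)) = a t - n * (2 * Real.pi) := by
    intro t
    have := add_int_mul_of_equivariant he (t - n * (2 * Real.pi)) n
    rw [sub_add_cancel] at this
    linarith
  have hc : ContinuousAt (fun t : ℝ => t - n * (2 * Real.pi)) t₀ := by fun_prop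
  rcases h (t₀ - n * (2 * Real.pi)) (by rw [h1]; linarith) with h | h
  · left
    filter_upwards [hc.eventually h] with t ht
    rw [h1] at ht
    linarith
  · right
    filter_upwards [hc.eventually h] with t ht
    rw [h1] at ht
    linarith

theorem surjective_of_equivariant {a : ℝ → ℝ} (hc : Continuous a)
    (he : ∀ t, a (t + 2 * Real.pi) = a t + 2 * Real.pi) : Function.Surjective a := by
  have hpi := Real.pi_pos
  intro y
  have h := fun n : ℤ => add_int_mul_of_equivariant he 0 n
  refine mem_range_of_exists_le_of_exists_ge hc
    ⟨0 + (⌊(y - a 0) / (2 * Real.pi)⌋ : ℤ) * (2 * Real.pi), ?_⟩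
    ⟨0 + (⌈(y - a 0) / (2 * Real.pi)⌉ : ℤ) * (2 * Real.pi), ?_⟩
  · rw [h, ← le_sub_iff_add_le', ← le_div_iff₀ (by positivity)]
    exact Int.floor_le _
  · rw [h, ← sub_le_iff_le_add', ← div_le_iff₀ (by positivity)]
    exact Int.le_ceil _

/-- A monotone map that reaches the level `s` but stays on one side of it near a preimage must be
constant on an interval there. -/
theorem NonCrossing.exists_interval {a : ℝ → ℝ} (hc : Continuous a) (hm : Monotone a)
    (he : ∀ t, a (t + 2 * Real.pi) = a t + 2 * Real.pi) {s : ℝ} (h : NonCrossing a s) :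
    ∃ u v, u < v ∧ a u = s ∧ a v = s := by
  obtain ⟨t₀, ht₀⟩ := surjective_of_equivariant hc he s
  rcases h t₀ ht₀ with h | h
  · obtain ⟨u, hu1, hu2⟩ := ((h.filter_mono nhdsWithin_le_nhds).and
      (self_mem_nhdsWithin (s := Iio t₀))).exists
    exact ⟨u, t₀, hu2, le_antisymm ((hm hu2.le).trans_eq ht₀) hu1, ht₀⟩
  · obtain ⟨u, hu1, hu2⟩ := ((h.filter_mono nhdsWithin_le_nhds).and
      (self_mem_nhdsWithin (s := Ioi t₀))).exists
    exact ⟨t₀, u, hu2, ht₀, le_antisymm hu1 (ht₀.symm.trans_le (hm (le_of_lt hu2)))⟩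

end Flattening

/-! ### Smoothing piecewise smooth periodic functions -/

section PiecewiseSmooth

/-- Near every point, the function agrees on either side with a function that is smooth across
that point. -/
def PiecewiseSmooth (g : ℝ → ℝ) : Prop :=
  ∀ θ₀, (∃ h, (∀ᶠ θ in 𝓝 θ₀, ContDiffAt ℝ ∞ h θ) ∧ ∀ᶠ θ in 𝓝[≥] θ₀, g θ = h θ) ∧
    ∃ h, (∀ᶠ θ in 𝓝 θ₀, ContDiffAt ℝ ∞ h θ) ∧ ∀ᶠ θ in 𝓝[≤] θ₀, g θ = h θ

/-- Every point has a punctured neighbourhood without singular points, so compactness leaves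
finitely many. -/
theorem PiecewiseSmooth.finite_bad {g : ℝ → ℝ} (hg : PiecewiseSmooth g) (K : Set ℝ)
    (hK : IsCompact K) : ({θ | ¬ContDiffAt ℝ ∞ g θ} ∩ K).Finite := by
  have key : ∀ θ₀, ∀ᶠ θ in 𝓝[≠] θ₀, ContDiffAt ℝ ∞ g θ := by
    intro θ₀
    have aux : ∀ {s : Set ℝ}, IsOpen s → (∃ h, (∀ᶠ θ in 𝓝 θ₀, ContDiffAt ℝ ∞ h θ) ∧
        ∀ᶠ θ in 𝓝[s] θ₀, g θ = h θ) → ∀ᶠ θ in 𝓝[s] θ₀, ContDiffAt ℝ ∞ g θ := by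
      rintro s hs ⟨h, h1, h2⟩
      filter_upwards [h1.filter_mono nhdsWithin_le_nhds, eventually_eventually_nhdsWithin.2 h2,
        self_mem_nhdsWithin] with θ h3 h4 h5
      rw [hs.nhdsWithin_eq h5] at h4
      exact h3.congr_of_eventuallyEq h4
    obtain ⟨⟨h, h1, h2⟩, h', h1', h2'⟩ := hg θ₀
    rw [← Iio_union_Ioi, nhdsWithin_union, eventually_sup]
    exact ⟨aux isOpen_Iio ⟨h', h1', h2'.filter_mono (nhdsWithin_mono _ Iio_subset_Iic_self)⟩,
      aux isOpen_Ioi ⟨h, h1, h2.filter_mono (nhdsWithin_mono _ Ioi_subset_Ici_self)⟩⟩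
  refine hK.induction_on (p := fun s => ({θ | ¬ContDiffAt ℝ ∞ g θ} ∩ s).Finite) (by simp)
    (fun s t hst ht => ht.subset (inter_subset_inter_right _ hst))
    (fun s t hs ht => by rw [inter_union_distrib_left]; exact hs.union ht) fun θ _ => ?_
  refine ⟨{x | x ≠ θ → ContDiffAt ℝ ∞ g x}, mem_nhdsWithin_of_mem_nhds
    (eventually_nhdsWithin_iff.1 (key θ)), (finite_singleton θ).subset ?_⟩
  rintro x ⟨h1, h2⟩
  by_contra h
  exact h1 (h2 h)

/-- At a singular value, a map that does not cross it sees only one side of `g`, where `g` agrees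
with a function smooth across the point. -/
theorem PiecewiseSmooth.comp_contDiff {g a : ℝ → ℝ} (hg : PiecewiseSmooth g)
    (hs : ContDiff ℝ ∞ a) (h : ∀ t, ¬ContDiffAt ℝ ∞ g (a t) → NonCrossing a (a t)) :
    ContDiff ℝ ∞ fun t => g (a t) := by
  rw [contDiff_iff_contDiffAt]
  intro t
  by_cases hb : ContDiffAt ℝ ∞ g (a t)
  · exact hb.comp t hs.contDiffAt
  · obtain ⟨⟨f, h1, h2⟩, f', h1', h2'⟩ := hg (a t)
    rcases h t hb t rfl with h | h
    · refine (h1.self_of_nhds.comp t hs.contDiffAt).congr_of_eventuallyEq ?_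
      exact (tendsto_nhdsWithin_iff.2 ⟨hs.continuous.continuousAt, h⟩).eventually h2
    · refine (h1'.self_of_nhds.comp t hs.contDiffAt).congr_of_eventuallyEq ?_
      exact (tendsto_nhdsWithin_iff.2 ⟨hs.continuous.continuousAt, h⟩).eventually h2'

/-- A monotone smooth reparametrization of the angle that makes a piecewise smooth periodic function
smooth and stops at given angles. -/
theorem PiecewiseSmooth.exists_reparam {g : ℝ → ℝ} (hg : PiecewiseSmooth g)
    (hper : Function.Periodic g (2 * Real.pi)) (F : Finset ℝ) :
    ∃ a : ℝ → ℝ, ContDiff ℝ ∞ a ∧ Monotone a ∧ (∀ t, a (t + 2 * Real.pi) = a t + 2 * Real.pi) ∧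
      (ContDiff ℝ ∞ fun t => g (a t)) ∧ ∀ s ∈ F, NonCrossing a s := by
  classical
  have hfin := hg.finite_bad (Icc 0 (2 * Real.pi)) isCompact_Icc
  obtain ⟨a, hs, hm, he, hF⟩ := exists_nonCrossing (F ∪ hfin.toFinset)
  refine ⟨a, hs, hm, he, hg.comp_contDiff hs fun t ht => ?_,
    fun s hs => hF s (Finset.mem_union_left _ hs)⟩
  -- Only the finitely many singular angles of one period were treated; periodicity of `g` and
  -- equivariance of `a` transfer the conclusion to their translates.
  set s := toIcoMod Real.two_pi_pos 0 (a t) with hsdef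
  have hst : a t = s + toIcoDiv Real.two_pi_pos 0 (a t) * (2 * Real.pi) := by
    have := toIcoMod_add_toIcoDiv_zsmul Real.two_pi_pos 0 (a t)
    rw [zsmul_eq_mul] at this
    exact this.symm
  rw [hst]
  refine (hF s (Finset.mem_union_right _ (hfin.mem_toFinset.2 ⟨fun hc => ht ?_, ?_⟩))).add_int_mul
    he _
  · rw [hst]
    set n := toIcoDiv Real.two_pi_pos 0 (a t)
    have e : g = fun x => g (x - n * (2 * Real.pi)) := funext fun x => (hper.sub_int_mul_eq n).symm
    rw [e]
    refine ContDiffAt.comp (f := fun x : ℝ => x - n * (2 * Real.pi)) _ ?_ (by fun_prop)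
    rwa [add_sub_cancel_right]
  · have := toIcoMod_mem_Ico Real.two_pi_pos 0 (a t)
    rw [zero_add] at this
    exact Ico_subset_Icc_self this

end PiecewiseSmooth

/-! ### The boundary curve and the map from the disc -/

section BoundaryCurve

/-- A smooth closed curve that runs once around the boundary of a convex body of area one, sweeps
area at an almost constant rate and stops at three given boundary points. -/
theorem exists_boundary_curve {D : Set ℂ} (hc : IsCompact D) (hconv : Convex ℝ D) (h0 : D ∈ 𝓝 0)
    (harea : MeasureTheory.volume D = 1) (hps : PiecewiseSmooth (dirGauge D)) {s : Fin 3 → ℝ}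
    (hs : IsDivision s) {c : ℝ} (hπ : 1 / Real.pi < c) :
    ∃ C : ℝ → ℂ, ContDiff ℝ ∞ C ∧ Function.Periodic C (2 * Real.pi) ∧
      (∀ t, C t ∈ frontier D) ∧ (∀ t, |planeCross (C t) (deriv C t)| ≤ c) ∧
      ∃ t, IsDivision t ∧ ∃ δ > 0, ∀ i, ∀ x ∈ Ioo (t i - δ) (nextAngle t i + δ),
        ∃ r θ : ℝ, 0 < r ∧ θ ∈ Icc (s i) (nextAngle s i) ∧
          C x = r * Complex.exp (θ * Complex.I) := by
  classical
  have hpi := Real.pi_pos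
  have hgpos := dirGauge_pos hc h0
  have hgcont := continuous_dirGauge hconv h0
  obtain ⟨a, has, ham, hae, hgas, hnc⟩ :=
    hps.exists_reparam dirGauge_periodic (Finset.univ.image s)
  have hgas0 : ∀ t, dirGauge D (a t) ≠ 0 := fun t => (hgpos _).ne'
  set P : ℝ → ℝ := fun t => (dirGauge D (a t))⁻¹ with hP
  have hPs : ContDiff ℝ ∞ P := hgas.inv hgas0
  have hPpos : ∀ t, 0 < P t := fun t => inv_pos.2 (hgpos _)
  have hPper : Function.Periodic P (2 * Real.pi) := fun t => by
    simp only [hP]; rw [hae, dirGauge_periodic]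
  have had : ∀ t, HasDerivAt a (deriv a t) t := fun t => (has.differentiable (by simp) t).hasDerivAt
  have hads : ContDiff ℝ ∞ (deriv a) := (contDiff_infty_iff_deriv.1 has).2
  have hadper : Function.Periodic (deriv a) (2 * Real.pi) := fun t => by
    have : a = fun t => a (t + 2 * Real.pi) - 2 * Real.pi := funext fun t => by rw [hae]; ring
    have h1 : HasDerivAt (fun t => a (t + 2 * Real.pi) - 2 * Real.pi)
        (deriv a (t + 2 * Real.pi)) t :=
      (HasDerivAt.comp_add_const t (2 * Real.pi) (had _)).sub_const _
    rw [← this] at h1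
    exact h1.deriv.symm
  have had0 : ∀ t, 0 ≤ deriv a t := fun t => ham.deriv_nonneg
  set Γ : ℝ → ℂ := fun t => P t • Complex.exp (a t * Complex.I) with hΓ
  have hexps : ContDiff ℝ ∞ fun t => Complex.exp (a t * Complex.I) :=
    ((Complex.ofRealCLM.contDiff.comp has).mul contDiff_const).cexp
  have hΓs : ContDiff ℝ ∞ Γ := hPs.smul hexps
  have hexpper : Function.Periodic (fun t => Complex.exp (a t * Complex.I)) (2 * Real.pi) := by
    intro t
    dsimp only
    rw [hae]
    push_cast
    rw [add_mul, Complex.exp_add, Complex.exp_two_pi_mul_I, mul_one]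
  have hΓper : Function.Periodic Γ (2 * Real.pi) := fun t => by
    change P (t + 2 * Real.pi) • (fun t => Complex.exp (a t * Complex.I)) (t + 2 * Real.pi) = _
    rw [hPper, hexpper]
  have hΓcross : ∀ t, planeCross (Γ t) (deriv Γ t) = P t ^ 2 * deriv a t := by
    intro t
    have h1 : HasDerivAt P (deriv P t) t := (hPs.differentiable (by simp) t).hasDerivAt
    have h2 := (hexps.differentiable (by simp) t).hasDerivAt
    have h3 : deriv Γ t = _ := (h1.smul h2).deriv
    rw [h3, add_comm, planeCross_smul_add, planeCross_exp (had t)]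
    ring
  have hΓfr : ∀ t, Γ t ∈ frontier D := by
    intro t
    rw [← gauge_eq_one_iff_mem_frontier hconv h0]
    simp only [hΓ]
    rw [Complex.real_smul, gauge_polar (hPpos t).le]
    exact inv_mul_cancel₀ (hgas0 t)
  set ε : ℝ := c - 1 / Real.pi with hε
  have hεpos : 0 < ε := by rw [hε]; linarith
  -- The curve `Γ` sweeps area with density `P² a'`, which vanishes where `a` rests. Adding `ε`
  -- makes the density positive, so that the reparametrization is invertible with smooth inverse.
  -- With `c = 1 / π + ε` the total is `2π c`, and the new rate is `c P² a' / w ≤ c`.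
  set w : ℝ → ℝ := fun t => P t ^ 2 * deriv a t + ε with hw
  have hws : ContDiff ℝ ∞ w := ((hPs.pow 2).mul hads).add contDiff_const
  have hw0 : ∀ t, 0 ≤ P t ^ 2 * deriv a t := fun t => mul_nonneg (sq_nonneg _) (had0 t)
  have hwpos : ∀ t, 0 < w t := fun t => add_pos_of_nonneg_of_pos (hw0 t) hεpos
  have hJ : ∫ t in (0 : ℝ)..(2 * Real.pi), w t = 2 + 2 * Real.pi * ε := by
    have hcont : Continuous fun θ => (dirGauge D θ ^ 2)⁻¹ :=
      (hgcont.pow 2).inv₀ fun θ => (pow_pos (hgpos θ) 2).ne'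
    have h1 : ∫ t in (0 : ℝ)..(2 * Real.pi), P t ^ 2 * deriv a t = 2 := by
      have h2 := intervalIntegral.integral_comp_mul_deriv (a := 0) (b := 2 * Real.pi)
        (f := a) (f' := deriv a) (g := fun θ => (dirGauge D θ ^ 2)⁻¹) (fun t _ => had t)
        hads.continuous.continuousOn hcont
      have h3 : a (2 * Real.pi) = a 0 + 2 * Real.pi := by rw [← hae, zero_add]
      have hper : Function.Periodic (fun θ => (dirGauge D θ ^ 2)⁻¹) (2 * Real.pi) := fun θ => by
        dsimp only
        rw [dirGauge_periodic]
      have h4 := hper.intervalIntegral_add_eq (a 0) 0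
      rw [zero_add, integral_inv_dirGauge_sq hc hconv h0 harea] at h4
      rw [h3, h4] at h2
      refine Eq.trans ?_ h2
      refine intervalIntegral.integral_congr fun t _ => ?_
      simp only [hP, Function.comp_apply, inv_pow]
    simp only [hw]
    rw [intervalIntegral.integral_add, h1, intervalIntegral.integral_const, smul_eq_mul, sub_zero]
    · exact ((hPs.continuous.pow 2).mul hads.continuous).intervalIntegrable _ _
    · exact continuous_const.intervalIntegrable _ _
  obtain ⟨τ, hτs, hτs', hτm, hτe, hτd⟩ := exists_reparametrization hws hwpos fun t => by
    simp only [hw]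
    rw [hPper, hadper]
  rw [hJ] at hτd
  set J := 2 + 2 * Real.pi * ε with hJdef
  have hJpos : 0 < J := by positivity
  have hτsd : ∀ t, HasDerivAt τ.symm (2 * Real.pi / J * w (τ.symm t))⁻¹ t := fun t => by
    refine HasDerivAt.of_local_left_inverse τ.symm.continuous.continuousAt (hτd _) ?_
      (Eventually.of_forall fun t => τ.apply_symm_apply t)
    have := hwpos (τ.symm t)
    positivity
  have hτse : ∀ t, τ.symm (t + 2 * Real.pi) = τ.symm t + 2 * Real.pi := fun t => by
    rw [τ.symm_apply_eq, hτe, τ.apply_symm_apply]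
  have hC : ∀ t, HasDerivAt (fun t => Γ (τ.symm t))
      ((2 * Real.pi / J * w (τ.symm t))⁻¹ • deriv Γ (τ.symm t)) t := fun t =>
    ((hΓs.differentiable (by simp) _).hasDerivAt).scomp t (hτsd t)
  refine ⟨fun t => Γ (τ.symm t), hΓs.comp hτs', fun t => ?_, fun t => hΓfr _, fun t => ?_, ?_⟩
  · dsimp only
    rw [hτse, hΓper]
  · have e : ∀ (r : ℝ) (u v : ℂ), planeCross u (r • v) = r * planeCross u v := by
      intro r u v
      simp [planeCross]
      ring
    rw [(hC t).deriv, e, hΓcross]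
    have h1 := hw0 (τ.symm t)
    have h2 := hwpos (τ.symm t)
    rw [abs_of_nonneg (by positivity), inv_mul_le_iff₀ (by positivity)]
    have h3 : 2 * Real.pi / J * w (τ.symm t) * c = w (τ.symm t) := by
      have : J = 2 * Real.pi * c := by
        rw [hJdef, hε]
        field_simp
        ring
      rw [this]
      have hcpos : 0 < c := lt_trans (by positivity) hπ
      field_simp
    rw [h3]
    simp only [hw]
    linarith
  · have hflat : ∀ i, ∃ u v, u < v ∧ a u = s i ∧ a v = s i := fun i =>
      (hnc (s i) (Finset.mem_image_of_mem _ (Finset.mem_univ i))).exists_interval has.continuous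
        ham hae
    choose u v huv hu hv using hflat
    -- The division is taken at the midpoints of the intervals of rest, so each arc can be enlarged
    -- on both sides without its image leaving the corresponding boundary arc.
    set m : Fin 3 → ℝ := fun i => (u i + v i) / 2 with hm
    have hum : ∀ i, u i < m i := fun i => by simp only [hm]; linarith [huv i]
    have hmv : ∀ i, m i < v i := fun i => by simp only [hm]; linarith [huv i]
    have ham' : ∀ i, a (m i) = s i := fun i =>
      le_antisymm ((ham (hmv i).le).trans_eq (hv i)) ((hu i).symm.trans_le (ham (hum i).le))
    have hdiv : IsDivision fun i => τ (m i) := by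
      obtain ⟨h1, h2, h3⟩ := hs
      refine ⟨hτm (ham.reflect_lt ?_), hτm (ham.reflect_lt ?_), ?_⟩
      · rwa [ham', ham']
      · rwa [ham', ham']
      · rw [← hτe]
        refine hτm (ham.reflect_lt ?_)
        rwa [hae, ham', ham']
    set v' : Fin 3 → ℝ := ![v 1, v 2, v 0 + 2 * Real.pi] with hv'
    have hv'a : ∀ i, a (v' i) = nextAngle s i := by
      intro i
      fin_cases i
      · exact hv 1
      · exact hv 2
      · change a (v 0 + 2 * Real.pi) = s 0 + 2 * Real.pi
        rw [hae, hv]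
    have hv't : ∀ i, nextAngle (fun i => τ (m i)) i < τ (v' i) := by
      intro i
      fin_cases i
      · exact hτm (hmv 1)
      · exact hτm (hmv 2)
      · change τ (m 0) + 2 * Real.pi < τ (v 0 + 2 * Real.pi)
        rw [hτe]
        have := hτm (hmv 0)
        linarith
    have hev : ∀ᶠ δ : ℝ in 𝓝[>] 0, ∀ i, τ (u i) < τ (m i) - δ ∧
        nextAngle (fun i => τ (m i)) i + δ < τ (v' i) := by
      refine Filter.eventually_all.2 fun i => Filter.Eventually.filter_mono nhdsWithin_le_nhds ?_
      have c1 : ContinuousAt (fun δ : ℝ => τ (m i) - δ) 0 := by fun_prop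
      have c2 : ContinuousAt (fun δ : ℝ => nextAngle (fun i => τ (m i)) i + δ) 0 := by fun_prop
      refine (c1.eventually_const_lt ?_).and (c2.eventually_lt_const ?_)
      · rw [show (fun δ : ℝ => τ (m i) - δ) 0 = τ (m i) from sub_zero _]
        exact hτm (hum i)
      · dsimp only
        rw [add_zero]
        exact hv't i
    obtain ⟨δ, hδ, hδpos⟩ := (hev.and self_mem_nhdsWithin).exists
    refine ⟨fun i => τ (m i), hdiv, δ, hδpos, fun i x hx => ⟨P (τ.symm x), a (τ.symm x),
      hPpos _, ⟨?_, ?_⟩, by simp only [hΓ]; rw [Complex.real_smul]⟩⟩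
    · rw [← hu i]
      refine ham (hτm.le_iff_le.1 ?_)
      rw [τ.apply_symm_apply]
      linarith [(hδ i).1, hx.1]
    · rw [← hv'a i]
      refine ham (hτm.le_iff_le.1 ?_)
      rw [τ.apply_symm_apply]
      linarith [(hδ i).2, hx.2]

/-- A smooth, almost area preserving map of the unit disc onto a convex body of area one (up to the
factor `1 / π`) that sends the unit circle to the boundary and has a controlled behaviour near three
points of the circle. -/
theorem exists_map_from_disc {D : Set ℂ} (hc : IsCompact D) (hconv : Convex ℝ D) (h0 : D ∈ 𝓝 0)
    (harea : MeasureTheory.volume D = 1) (hps : PiecewiseSmooth (dirGauge D)) {s : Fin 3 → ℝ}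
    (hs : IsDivision s) {c : ℝ} (hπ : 1 / Real.pi < c) :
    ∃ S : ℂ → ℂ, ContDiff ℝ ∞ S ∧ (∀ z, S z ∈ D) ∧ S 0 = 0 ∧
      (∀ z, |planeDet (fderiv ℝ S z)| ≤ c) ∧
      ∃ t, IsDivision t ∧ ∃ δ > 0, ∀ i, ∀ x ∈ Ioo (t i - δ) (nextAngle t i + δ),
        S (Complex.exp (x * Complex.I)) ∈ frontier D ∧
        ∃ r θ : ℝ, 0 < r ∧ θ ∈ Icc (s i) (nextAngle s i) ∧
          S (Complex.exp (x * Complex.I)) = r * Complex.exp (θ * Complex.I) := by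
  obtain ⟨c', h1, h2⟩ := exists_between hπ
  have hpi := Real.pi_pos
  have hc' : 0 < c' := lt_trans (by positivity) h1
  obtain ⟨C, hCs, hCper, hCfr, hCc, t, ht, δ, hδ, hC⟩ :=
    exists_boundary_curve hc hconv h0 harea hps hs h1
  obtain ⟨ρ, hρs, ⟨η, hη, hρ0⟩, hρ1, hρ01, hρB⟩ :=
    exists_radial_profile (B := c / c') ((one_lt_div hc').2 h2)
  have hkper : Function.Periodic (fun _ : ℝ => (1 : ℝ)) (2 * Real.pi) := fun _ => rfl
  have hval : ∀ x : ℝ, radialMap ρ (fun _ => 1) C (Complex.exp (x * Complex.I)) = C x := by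
    intro x
    have := radialMap_polar (ρ := ρ) hkper hCper one_pos x
    rwa [Complex.ofReal_one, one_mul, one_mul, hρ1 1 le_rfl, one_smul] at this
  refine ⟨radialMap ρ (fun _ => 1) C, contDiff_radialMap hρs contDiff_const hCs hkper hCper hη hρ0,
    fun z => ?_, ?_, fun z => ?_, t, ht, δ, hδ, fun i x hx => ?_⟩
  · exact hconv.smul_mem_of_zero_mem (mem_of_mem_nhds h0)
      (hc.isClosed.frontier_subset (hCfr _)) (hρ01 _)
  · rw [radialMap, hρ0 _ (by simpa using hη.le), zero_smul]
  · refine (abs_planeDet_radialMap_le hρs contDiff_const hCs hkper hCper (fun _ => one_pos) hη hρ0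
      hρB (K := c') (fun θ => ?_) z).trans_eq (div_mul_cancel₀ _ hc'.ne')
    rw [one_pow, one_mul]
    exact hCc θ
  · rw [hval]
    exact ⟨hCfr _, hC i x hx⟩

end BoundaryCurve

/-! ### Piecewise smoothness of the gauge: polygons -/

section PolygonGauge

variable {D : Set ℂ}

theorem exists_supporting_functional (hconv : Convex ℝ D) (h0 : D ∈ 𝓝 0) {z : ℂ}
    (hz : gauge D z = 1) : ∃ l : ℂ →L[ℝ] ℝ, (∀ x ∈ D, l x ≤ 1) ∧ l z = 1 := by
  have hzi : z ∉ interior D := fun h => by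
    have := (gauge_lt_one_iff_mem_interior hconv h0).2 h
    linarith
  obtain ⟨f, hf⟩ := geometric_hahn_banach_open_point hconv.interior isOpen_interior hzi
  have hpos : 0 < f z := by simpa using hf 0 (mem_interior_iff_mem_nhds.2 h0)
  have hle : ∀ x ∈ D, f x ≤ f z := by
    intro x hx
    have hcl : x ∈ closure (interior D) := by
      rw [hconv.closure_interior_eq_closure_of_nonempty_interior
        ⟨0, mem_interior_iff_mem_nhds.2 h0⟩]
      exact subset_closure hx
    exact closure_minimal (fun a ha => (hf a ha).le) (isClosed_le f.continuous continuous_const) hcl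
  refine ⟨(f z)⁻¹ • f, fun x hx => ?_, ?_⟩
  · rw [smul_apply, smul_eq_mul, inv_mul_le_iff₀ hpos, mul_one]
    exact hle x hx
  · rw [smul_apply, smul_eq_mul, inv_mul_cancel₀ hpos.ne']

theorem le_gauge_of_le_one (hc : IsCompact D) (hconv : Convex ℝ D) (h0 : D ∈ 𝓝 0)
    {l : ℂ →L[ℝ] ℝ} (hl : ∀ x ∈ D, l x ≤ 1) (x : ℂ) : l x ≤ gauge D x := by
  by_cases hx : x = 0
  · simp [hx]
  have hg : 0 < gauge D x := (gauge_pos (absorbent_nhds_zero h0)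
    (NormedSpace.isVonNBounded_of_isBounded ℝ hc.isBounded)).2 hx
  have h1 : (gauge D x)⁻¹ • x ∈ D := by
    rw [mem_iff_gauge_le_one hc hconv h0, gauge_smul_of_nonneg (inv_pos.2 hg).le, smul_eq_mul,
      inv_mul_cancel₀ hg.ne']
  have h2 := hl _ h1
  rwa [map_smul, smul_eq_mul, inv_mul_le_iff₀ hg, mul_one] at h2

/-- The gauge of a convex polygon is the maximum of finitely many linear functionals. -/
theorem exists_gauge_eq_max (hc : IsCompact D) (hconv : Convex ℝ D) (h0 : D ∈ 𝓝 0)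
    (hpoly : IsConvexPolygon D) : ∃ T : Finset (ℂ →L[ℝ] ℝ), (∀ l ∈ T, ∀ x, l x ≤ gauge D x) ∧
      ∀ x, x ≠ 0 → ∃ l ∈ T, l x = gauge D x := by
  classical
  obtain ⟨S, hS⟩ := hpoly
  -- One supporting functional is chosen for each possible set `A` of points of `S` at which it
  -- equals `1`; finiteness comes from the finitely many subsets.
  let Q : Finset ℂ → (ℂ →L[ℝ] ℝ) → Prop := fun A l =>
    (∀ x ∈ D, l x ≤ 1) ∧ ∀ s ∈ S, l s = 1 ↔ s ∈ A
  let F : Finset ℂ → (ℂ →L[ℝ] ℝ) := fun A => if h : ∃ l, Q A l then h.choose else 0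
  have hF : ∀ A, (∃ l, Q A l) → Q A (F A) := fun A h => by
    simp only [F, dif_pos h]
    exact h.choose_spec
  refine ⟨S.powerset.image F, ?_, ?_⟩
  · intro l hl x
    obtain ⟨A, -, rfl⟩ := Finset.mem_image.1 hl
    by_cases h : ∃ l, Q A l
    · exact le_gauge_of_le_one hc hconv h0 (hF A h).1 x
    · simp only [F, dif_neg h, zero_apply]
      exact gauge_nonneg x
  · intro x hx
    have hg : 0 < gauge D x := (gauge_pos (absorbent_nhds_zero h0)
      (NormedSpace.isVonNBounded_of_isBounded ℝ hc.isBounded)).2 hx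
    set z := (gauge D x)⁻¹ • x with hz
    have hgz : gauge D z = 1 := by
      rw [hz, gauge_smul_of_nonneg (inv_pos.2 hg).le, smul_eq_mul, inv_mul_cancel₀ hg.ne']
    obtain ⟨l, hl, hlz⟩ := exists_supporting_functional hconv h0 hgz
    have hQ : Q (S.filter fun s => l s = 1) l :=
      ⟨hl, fun s hs => by simp [hs]⟩
    have hQF := hF _ ⟨l, hQ⟩
    refine ⟨F (S.filter fun s => l s = 1),
      Finset.mem_image_of_mem _ (Finset.mem_powerset.2 (Finset.filter_subset _ _)), ?_⟩
    set l' := F (S.filter fun s => l s = 1)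
    have hzD : z ∈ convexHull ℝ (S : Set ℂ) := by
      rw [← hS, mem_iff_gauge_le_one hc hconv h0, hgz]
    obtain ⟨w, hw0, hw1, hwz⟩ := Finset.mem_convexHull.1 hzD
    rw [Finset.centerMass_eq_of_sum_1 _ _ hw1] at hwz
    have hmap : ∀ f : ℂ →L[ℝ] ℝ, f z = ∑ s ∈ S, w s * f s := by
      intro f
      rw [← hwz, map_sum]
      exact Finset.sum_congr rfl fun s _ => by rw [map_smul, smul_eq_mul, id]
    -- The point `z` is a convex combination in which only points with `l = 1` have positive weight.
    -- Any functional with the same contact set therefore also takes the value `1` at `z`.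
    have hvan : ∑ s ∈ S, w s * (1 - l s) = 0 := by
      simp only [mul_sub, mul_one, Finset.sum_sub_distrib]
      rw [hw1, ← hmap, hlz, sub_self]
    have hSD : ∀ s ∈ S, s ∈ D := fun s hs => hS ▸ subset_convexHull ℝ _ hs
    rw [Finset.sum_eq_zero_iff_of_nonneg fun s hs =>
      mul_nonneg (hw0 s hs) (sub_nonneg.2 (hl s (hSD s hs)))] at hvan
    have hl'z : l' z = 1 := by
      rw [hmap, ← hw1]
      refine Finset.sum_congr rfl fun s hs => ?_
      rcases mul_eq_zero.1 (hvan s hs) with h | h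
      · rw [h, zero_mul]
      · have : l s = 1 := by linarith
        rw [(hQF.2 s hs).2 (by simp [hs, this]), mul_one]
    rw [hz, map_smul, smul_eq_mul] at hl'z
    field_simp at hl'z
    exact hl'z

theorem piecewiseSmooth_dirGauge_of_polygon (hc : IsCompact D) (hconv : Convex ℝ D)
    (h0 : D ∈ 𝓝 0) (hpoly : IsConvexPolygon D) : PiecewiseSmooth (dirGauge D) := by
  obtain ⟨T, hT1, hT2⟩ := exists_gauge_eq_max hc hconv h0 hpoly
  intro θ₀
  set e : ℝ → ℂ := fun θ => Complex.exp (θ * Complex.I) with he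
  have hes : ContDiff ℝ ∞ e := (Complex.ofRealCLM.contDiff.mul contDiff_const).cexp
  have hrot : ∀ (l : ℂ →L[ℝ] ℝ) (θ : ℝ), l (e θ) =
      l (e θ₀) * Real.cos (θ - θ₀) + l (e θ₀ * Complex.I) * Real.sin (θ - θ₀) := by
    intro l θ
    have : e θ = Real.cos (θ - θ₀) • e θ₀ + Real.sin (θ - θ₀) • (e θ₀ * Complex.I) := by
      have h1 : e θ = e θ₀ * e (θ - θ₀) := by
        simp only [he]
        rw [← Complex.exp_add]
        push_cast
        ring_nf
      rw [h1]
      simp only [he]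
      rw [Complex.exp_mul_I ((θ - θ₀ : ℝ) : ℂ), ← Complex.ofReal_cos, ← Complex.ofReal_sin,
        Complex.real_smul, Complex.real_smul]
      ring
    rw [this, map_add, map_smul, map_smul, smul_eq_mul, smul_eq_mul]
    ring
  have hTne : T.Nonempty := by
    obtain ⟨l, hl, -⟩ := hT2 1 one_ne_zero
    exact ⟨l, hl⟩
  obtain ⟨l₁, hl₁, hmax⟩ := T.exists_max_image (fun l => l (e θ₀)) hTne
  -- The sign `c = ±1` selects the side of `θ₀`. Among the functionals maximal in the direction
  -- `θ₀`, the one with the largest derivative towards that side dominates all others nearby.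
  have key : ∀ (c : ℝ) (s : Set ℝ), (∀ᶠ θ in 𝓝[s] θ₀, 0 ≤ c * Real.sin (θ - θ₀)) → c * c = 1 →
      ∃ h, (∀ᶠ θ in 𝓝 θ₀, ContDiffAt ℝ ∞ h θ) ∧ ∀ᶠ θ in 𝓝[s] θ₀, dirGauge D θ = h θ := by
    intro c s hs hc
    obtain ⟨l₂, hl₂, hmax₂⟩ := (T.filter fun l => l (e θ₀) = l₁ (e θ₀)).exists_max_image
      (fun l => c * l (e θ₀ * Complex.I)) ⟨l₁, by simp [hl₁]⟩
    rw [Finset.mem_filter] at hl₂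
    refine ⟨fun θ => l₂ (e θ), Eventually.of_forall fun θ =>
      (l₂.contDiff.comp hes).contDiffAt, ?_⟩
    have hev : ∀ᶠ θ in 𝓝[s] θ₀, ∀ l ∈ T, l (e θ) ≤ l₂ (e θ) := by
      rw [Filter.eventually_all_finset]
      intro l hl
      by_cases h : l (e θ₀) = l₁ (e θ₀)
      · filter_upwards [hs] with θ hθ
        have h1 := hmax₂ l (by simp [hl, h])
        rw [hrot l, hrot l₂, h, hl₂.2]
        have h2 := mul_nonneg (sub_nonneg.2 h1) hθ
        have h3 : (c * l₂ (e θ₀ * Complex.I) - c * l (e θ₀ * Complex.I)) *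
            (c * Real.sin (θ - θ₀)) = (c * c) * ((l₂ (e θ₀ * Complex.I) - l (e θ₀ * Complex.I)) *
              Real.sin (θ - θ₀)) := by ring
        rw [h3, hc, one_mul] at h2
        linarith
      · have hlt : l (e θ₀) < l₂ (e θ₀) := by
          rw [hl₂.2]
          exact lt_of_le_of_ne (hmax l hl) h
        have c1 : ContinuousAt (fun θ => l (e θ)) θ₀ :=
          (l.continuous.comp hes.continuous).continuousAt
        have c2 : ContinuousAt (fun θ => l₂ (e θ)) θ₀ :=
          (l₂.continuous.comp hes.continuous).continuousAt
        exact ((c1.eventually_lt c2 hlt).filter_mono nhdsWithin_le_nhds).mono fun _ h => h.le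
    filter_upwards [hev] with θ hθ
    obtain ⟨l, hl, h⟩ := hT2 (e θ) (Complex.exp_ne_zero _)
    exact le_antisymm (h.symm.trans_le (hθ l hl)) (hT1 l₂ hl₂.1 _)
  constructor
  · refine key 1 _ ?_ (by norm_num)
    filter_upwards [self_mem_nhdsWithin, mem_nhdsWithin_of_mem_nhds
      (Iio_mem_nhds (show θ₀ < θ₀ + Real.pi by linarith [Real.pi_pos]))] with θ h1 h2
    rw [one_mul]
    exact Real.sin_nonneg_of_nonneg_of_le_pi (sub_nonneg.2 h1) (by linarith [mem_Iio.1 h2])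
  · refine key (-1) _ ?_ (by norm_num)
    filter_upwards [self_mem_nhdsWithin, mem_nhdsWithin_of_mem_nhds
      (Ioi_mem_nhds (show θ₀ - Real.pi < θ₀ by linarith [Real.pi_pos]))] with θ h1 h2
    have := Real.sin_nonpos_of_nonpos_of_neg_pi_le (sub_nonpos.2 h1)
      (by linarith [mem_Ioi.1 h2])
    linarith

end PolygonGauge

/-! ### Piecewise smoothness of the gauge: smooth boundaries -/

section SmoothGauge

variable {D : Set ℂ}

/-- By convexity the tangent half-plane contains `D`, that is, `L ≤ L z` on `D`. Since the origin is
interior and `L ≠ 0`, `L` takes positive values on `D`. This is transversality of rays to the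
boundary. -/
theorem fderiv_apply_pos_of_boundary (hconv : Convex ℝ D) (h0 : D ∈ 𝓝 0) {z : ℂ} (hz : z ∈ D)
    {U : Set ℂ} (hU : U ∈ 𝓝 z) {g : ℂ → ℝ} {L : ℂ →L[ℝ] ℝ} (hg : HasFDerivAt g L z) (hg0 : g z = 0)
    (hL : L ≠ 0) (hUD : ∀ w ∈ U, w ∈ D → g w ≤ 0) : 0 < L z := by
  have key : ∀ w ∈ D, L w ≤ L z := by
    intro w hw
    have h1 : HasDerivAt (fun s : ℝ => z + s • (w - z)) (w - z) 0 := by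
      simpa using ((hasDerivAt_id (0 : ℝ)).smul_const (w - z)).const_add z
    have h2 : HasDerivAt (fun s : ℝ => g (z + s • (w - z))) (L (w - z)) 0 := by
      refine HasFDerivAt.comp_hasDerivAt (0 : ℝ) (l := g) ?_ h1
      simpa using hg
    have h3 := hasDerivAt_iff_tendsto_slope.1 h2
    have h4 := h3.mono_left (nhdsWithin_mono 0 (s := Ioi (0 : ℝ))
      (fun x (hx : (0 : ℝ) < x) => ne_of_gt hx))
    have h5 : L (w - z) ≤ 0 := by
      refine le_of_tendsto h4 ?_
      have h6 : ∀ᶠ s : ℝ in 𝓝 0, z + s • (w - z) ∈ U := by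
        refine h1.continuousAt.eventually ?_
        simpa using hU
      filter_upwards [h6.filter_mono nhdsWithin_le_nhds,
        Ioo_mem_nhdsGT (zero_lt_one (α := ℝ))] with s hs hs'
      have h7 := hUD _ hs (hconv.add_smul_sub_mem hz hw ⟨hs'.1.le, hs'.2.le⟩)
      rw [slope_def_field, zero_smul, add_zero, hg0, sub_zero, sub_zero]
      exact div_nonpos_of_nonpos_of_nonneg h7 hs'.1.le
    rw [map_sub] at h5
    linarith
  obtain ⟨v, hv⟩ : ∃ v, 0 < L v := by
    by_contra hc
    push Not at hc
    refine hL (ContinuousLinearMap.ext fun v => le_antisymm (hc v) ?_)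
    have := hc (-v)
    rw [map_neg] at this
    simpa using this
  have h8 : ∀ᶠ s : ℝ in 𝓝[>] 0, s • v ∈ D := by
    have : Tendsto (fun s : ℝ => s • v) (𝓝[>] 0) (𝓝 0) := by
      refine Tendsto.mono_left ?_ nhdsWithin_le_nhds
      have : Continuous fun s : ℝ => s • v := by fun_prop
      simpa using this.tendsto 0
    exact this.eventually h0
  obtain ⟨s, hs, hs'⟩ := (h8.and self_mem_nhdsWithin).exists
  have := key _ hs
  rw [map_smul, smul_eq_mul] at this
  exact lt_of_lt_of_le (mul_pos hs' hv) this

/-- Rays meet the boundary transversally, so the implicit function theorem in polar coordinates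
makes the boundary radius a smooth function of the angle. -/
theorem contDiff_dirGauge_of_smooth (hc : IsCompact D) (hconv : Convex ℝ D) (h0 : D ∈ 𝓝 0)
    (hsmooth : HasSmoothBoundary D) : ContDiff ℝ ∞ (dirGauge D) := by
  have hgpos := dirGauge_pos hc h0
  have hgcont := continuous_dirGauge hconv h0
  set R : ℝ → ℝ := fun θ => (dirGauge D θ)⁻¹ with hR
  have hRpos : ∀ θ, 0 < R θ := fun θ => inv_pos.2 (hgpos θ)
  have hRcont : Continuous R := hgcont.inv₀ fun θ => (hgpos θ).ne'
  suffices h : ContDiff ℝ ∞ R by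
    have : dirGauge D = fun θ => (R θ)⁻¹ := funext fun θ => by simp [hR]
    rw [this]
    exact h.inv fun θ => (hRpos θ).ne'
  have hfr : ∀ θ : ℝ, (R θ * Complex.exp (θ * Complex.I) : ℂ) ∈ frontier D := by
    intro θ
    rw [← gauge_eq_one_iff_mem_frontier hconv h0, gauge_polar (hRpos θ).le]
    exact inv_mul_cancel₀ (hgpos θ).ne'
  rw [contDiff_iff_contDiffAt]
  intro θ₀
  set e : ℝ → ℂ := fun θ => Complex.exp (θ * Complex.I) with he
  have hes : ContDiff ℝ ∞ e := (Complex.ofRealCLM.contDiff.mul contDiff_const).cexp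
  obtain ⟨U, hU, hzU, g, hg, hg0, hdg, hgD⟩ := hsmooth _ (hfr θ₀)
  set z₀ : ℂ := R θ₀ * e θ₀ with hz₀
  have hgz : ContDiffAt ℝ ∞ g z₀ := hg.contDiffAt (hU.mem_nhds hzU)
  have hgd : HasFDerivAt g (fderiv ℝ g z₀) z₀ := (hgz.differentiableAt (by simp)).hasFDerivAt
  have hLpos := fderiv_apply_pos_of_boundary hconv h0 (hc.isClosed.frontier_subset (hfr θ₀))
    (hU.mem_nhds hzU) hgd hg0 hdg fun w hw hwD => (hgD w hw).1 hwD
  set f : ℝ × ℝ → ℝ := fun v => g (v.2 • e v.1) with hf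
  have hpolar : ContDiff ℝ ∞ fun v : ℝ × ℝ => v.2 • e v.1 :=
    contDiff_snd.smul (hes.comp contDiff_fst)
  have hval : R θ₀ • e θ₀ = z₀ := by rw [hz₀, Complex.real_smul]
  have hfs : ContDiffAt ℝ ∞ f (θ₀, R θ₀) := by
    refine ContDiffAt.comp (g := g) (θ₀, R θ₀) ?_ hpolar.contDiffAt
    simpa only [hval] using hgz
  have hfd : (fderiv ℝ f (θ₀, R θ₀) ∘L ContinuousLinearMap.inr ℝ ℝ ℝ) 1 =
      fderiv ℝ g z₀ (e θ₀) := by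
    have h1 : HasDerivAt (fun r : ℝ => (θ₀, r)) ((0 : ℝ), (1 : ℝ)) (R θ₀) :=
      (hasDerivAt_const _ _).prodMk (hasDerivAt_id _)
    have h2 := (hfs.differentiableAt (by simp)).hasFDerivAt.comp_hasDerivAt (R θ₀) h1
    have h3 : HasDerivAt (fun r : ℝ => r • e θ₀) (e θ₀) (R θ₀) := by
      simpa using (hasDerivAt_id (R θ₀)).smul_const (e θ₀)
    have h4 : HasDerivAt (fun r : ℝ => g (r • e θ₀)) (fderiv ℝ g z₀ (e θ₀)) (R θ₀) := by
      refine HasFDerivAt.comp_hasDerivAt (R θ₀) (l := g) ?_ h3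
      simpa only [hval] using hgd
    exact h2.unique h4
  have hne : fderiv ℝ g z₀ (e θ₀) ≠ 0 := by
    change 0 < fderiv ℝ g z₀ z₀ at hLpos
    rw [show fderiv ℝ g z₀ z₀ = fderiv ℝ g z₀ (R θ₀ • e θ₀) by rw [hval], map_smul,
      smul_eq_mul] at hLpos
    intro h
    rw [h, mul_zero] at hLpos
    exact lt_irrefl _ hLpos
  have hinv : (fderiv ℝ f (θ₀, R θ₀) ∘L ContinuousLinearMap.inr ℝ ℝ ℝ).IsInvertible := by
    refine ⟨ContinuousLinearEquiv.unitsEquivAut ℝ (Units.mk0 _ hne), ?_⟩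
    ext
    rw [hfd]
    simp
  have hψ := hfs.contDiffAt_implicitFunction (by simp) hinv
  refine hψ.congr_of_eventuallyEq ?_
  have h5 := hfs.eventually_apply_eq_iff_implicitFunction (by simp) hinv
  have hcont : ContinuousAt (fun θ => (θ, R θ)) θ₀ := by fun_prop
  have hUev : ∀ᶠ θ in 𝓝 θ₀, R θ • e θ ∈ U := by
    have : ContinuousAt (fun θ => R θ • e θ) θ₀ :=
      (hRcont.smul hes.continuous).continuousAt
    refine this.eventually ?_
    change U ∈ 𝓝 (R θ₀ • e θ₀)
    rw [hval]
    exact hU.mem_nhds hzU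
  have hzero : ∀ w ∈ frontier D, w ∈ U → g w = 0 := by
    intro w hw hwU
    refine le_antisymm ((hgD w hwU).1 (hc.isClosed.frontier_subset hw)) ?_
    by_contra hneg
    push Not at hneg
    refine hw.2 (mem_interior_iff_mem_nhds.2 ?_)
    have hcg : ContinuousAt g w := (hg.contDiffAt (hU.mem_nhds hwU)).continuousAt
    filter_upwards [hcg.eventually_lt_const hneg, hU.mem_nhds hwU] with y hy hyU
    exact (hgD y hyU).2 hy.le
  filter_upwards [hcont.eventually h5, hUev] with θ hθ hθU
  refine (hθ.1 ?_).symm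
  have h6 : f (θ, R θ) = 0 := hzero _ (by rw [Complex.real_smul]; exact hfr θ) hθU
  have h7 : f (θ₀, R θ₀) = 0 := by
    simp only [hf]
    rw [hval]
    exact hg0
  rw [h6, h7]

theorem piecewiseSmooth_dirGauge (hc : IsCompact D) (hconv : Convex ℝ D) (h0 : D ∈ 𝓝 0)
    (h : HasSmoothBoundary D ∨ IsConvexPolygon D) : PiecewiseSmooth (dirGauge D) := by
  rcases h with h | h
  · have hs := contDiff_dirGauge_of_smooth hc hconv h0 h
    intro θ₀
    exact ⟨⟨_, Eventually.of_forall fun _ => hs.contDiffAt, Eventually.of_forall fun _ => rfl⟩,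
      ⟨_, Eventually.of_forall fun _ => hs.contDiffAt, Eventually.of_forall fun _ => rfl⟩⟩
  · exact piecewiseSmooth_dirGauge_of_polygon hc hconv h0 h

end SmoothGauge

/-! ### Moving an interior point to the origin -/

section Translation

variable {Δ : Set ℂ} {o : ℂ}

theorem mem_frontier_translate {z : ℂ} :
    z ∈ frontier ((fun z => z + o) ⁻¹' Δ) ↔ z + o ∈ frontier Δ := by
  have := (Homeomorph.addRight o).preimage_frontier Δ
  rw [show (fun z => z + o) ⁻¹' Δ = Homeomorph.addRight o ⁻¹' Δ from rfl, ← this]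
  rfl

theorem translate_mem_nhds_zero (ho : o ∈ interior Δ) : (fun z => z + o) ⁻¹' Δ ∈ 𝓝 (0 : ℂ) := by
  refine ContinuousAt.preimage_mem_nhds (by fun_prop) ?_
  rw [zero_add]
  exact mem_interior_iff_mem_nhds.1 ho

theorem boundary_translate (h : HasSmoothBoundary Δ ∨ IsConvexPolygon Δ) :
    HasSmoothBoundary ((fun z => z + o) ⁻¹' Δ) ∨ IsConvexPolygon ((fun z => z + o) ⁻¹' Δ) := by
  classical
  have hcd : ContDiff ℝ ∞ fun z : ℂ => z + o := contDiff_id.add contDiff_const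
  rcases h with h | ⟨S, hS⟩
  · left
    intro z hz
    obtain ⟨U, hU, hzU, g, hg, hg0, hdg, hgD⟩ := h _ (mem_frontier_translate.1 hz)
    refine ⟨(fun z => z + o) ⁻¹' U, hU.preimage (by fun_prop), hzU, fun z => g (z + o),
      hg.comp hcd.contDiffOn fun _ h => h, hg0, ?_, fun w hw => hgD _ hw⟩
    rwa [fderiv_comp_add_right]
  · right
    refine ⟨S.image fun z => z - o, ?_⟩
    have h1 := (AffineEquiv.constVAdd ℝ ℂ (-o)).toAffineMap.image_convexHull (S : Set ℂ)
    have h2 : ∀ A : Set ℂ, (AffineEquiv.constVAdd ℝ ℂ (-o)).toAffineMap '' A =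
        (fun z => z - o) '' A := fun A => by
      refine image_congr fun z _ => ?_
      simp [sub_eq_neg_add]
    rw [h2, h2, ← hS] at h1
    rw [Finset.coe_image, ← h1]
    ext z
    constructor
    · intro hz
      exact ⟨z + o, hz, by simp⟩
    · rintro ⟨w, hw, rfl⟩
      simpa using hw

end Translation

theorem nextAngle_comp {τ : ℝ → ℝ} (hτ : ∀ θ, τ (θ + 2 * Real.pi) = τ θ + 2 * Real.pi)
    (t : Fin 3 → ℝ) (i : Fin 3) : nextAngle (fun i => τ (t i)) i = τ (nextAngle t i) := by
  fin_cases i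
  · rfl
  · rfl
  · exact (hτ _).symm

theorem IsDivision.comp {τ : ℝ → ℝ} (hm : StrictMono τ)
    (hτ : ∀ θ, τ (θ + 2 * Real.pi) = τ θ + 2 * Real.pi) {t : Fin 3 → ℝ} (ht : IsDivision t) :
    IsDivision fun i => τ (t i) :=
  ⟨hm ht.1, hm ht.2.1, (hm ht.2.2).trans_eq (hτ _)⟩

/-- Every closed subset of the manifold is the zero set of a nonnegative smooth function, which
supplies the functions used for the interpolation. -/
theorem exists_sendsToArcs_of_manifold (E : Type*) {M : Type*} [NormedAddCommGroup E]
    [NormedSpace ℝ E] [FiniteDimensional ℝ E] [TopologicalSpace M] [ChartedSpace E M]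
    [IsManifold 𝓘(ℝ, E) ∞ M] [T2Space M] [SigmaCompactSpace M] {Y : Fin 3 → Set M} {X : Set M}
    (hY : ∀ i, IsCompact (Y i)) (hX : X = ⋃ i, Y i) (hempty : ∀ x, ∃ i, x ∉ Y i)
    {t : Fin 3 → ℝ} (ht : IsDivision t) : ∃ f : C(X, Circle), SendsToArcs Y t f := by
  have hu : ∀ i : Fin 3, ∃ u : M → ℝ, Continuous u ∧ (∀ x, 0 ≤ u x) ∧
      ∀ x, u x = 0 ↔ x ∈ Y (i + 1) := by
    intro i
    obtain ⟨f, hf1, hf2, hf3⟩ :=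
      (hY (i + 1)).isClosed.isOpen_compl.exists_contMDiff_support_eq (n := ⊤) 𝓘(ℝ, E)
    refine ⟨f, hf2.continuous, hf3, fun x => ?_⟩
    rw [← notMem_compl_iff, ← hf1, Function.notMem_support]
  choose u hu1 hu2 hu3 using hu
  exact exists_sendsToArcs (fun i => (hY i).isClosed)
    (fun x hx => by rw [hX] at hx; exact mem_iUnion.1 hx) hempty hu1 hu2 hu3 ht

/-! ### Comparison of the two invariants -/

section Invariants

theorem AdmissibleForClass.const_mul {E M : Type*} [NormedAddCommGroup E] [NormedSpace ℝ E]
    [TopologicalSpace M] [ChartedSpace E M] {r : ℝ} {X : Set M} {α : HomotopyClasses X Circle}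
    {φ : M → ℂ} (h : AdmissibleForClass (E := E) r X α φ) {c : ℝ} (hc : 0 < c) :
    AdmissibleForClass (E := E) (c * r) X α fun x => c * φ x := by
  obtain ⟨h1, h2, h3, ⟨U, hU, hXU, hUs⟩, g, hg, hα⟩ := h
  have hn : ∀ x, ‖(c : ℂ) * φ x‖ = c * ‖φ x‖ := fun x => by
    rw [norm_mul, Complex.norm_real, Real.norm_eq_abs, abs_of_pos hc]
  refine ⟨?_, fun x => ?_, h3.mul_left, ⟨U, hU, hXU, fun x hx => ?_⟩, g, fun x => ?_, hα⟩
  · have : ContDiff ℝ ∞ fun z : ℂ => (c : ℂ) * z := contDiff_const.mul contDiff_id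
    exact this.contMDiff.comp h1
  · have := h2 x
    rw [mem_closedBall_zero_iff] at this ⊢
    rw [hn]
    gcongr
  · have := hUs x hx
    rw [mem_sphere_zero_iff_norm] at this ⊢
    rw [hn, this]
  · change (c : ℂ) * φ x = ((c * r : ℝ) : ℂ) * (g x : ℂ)
    rw [hg]
    push_cast
    ring

variable {E M : Type*} [NormedAddCommGroup E] [NormedSpace ℝ E] [FiniteDimensional ℝ E]
  [TopologicalSpace M] [ChartedSpace E M]

/-- The boundary of a convex set has measure zero, while the domain has area one. -/
theorem MarkedDomain.interior_nonempty {N : ℕ} [NeZero N] (Δ : MarkedDomain N) :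
    (interior Δ.carrier).Nonempty := by
  by_contra h
  rw [not_nonempty_iff_eq_empty] at h
  have h1 := Δ.convex.addHaar_frontier MeasureTheory.volume
  rw [frontier, h, sdiff_empty, Δ.isCompact.isClosed.closure_eq, Δ.area] at h1
  exact one_ne_zero h1

theorem SymplecticForm.abs_bracket_comp_le (Ω : SymplecticForm E M) {φ : M → ℂ} {x : M}
    (hφ : ContMDiff 𝓘(ℝ, E) 𝓘(ℝ, ℂ) ∞ φ) {Z : ℂ → ℂ} (hZ : ContDiff ℝ ∞ Z) {c : ℝ}
    (hc : ∀ z, |planeDet (fderiv ℝ Z z)| ≤ c) :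
    |Ω.bracket (fun y => (Z (φ y)).re) (fun y => (Z (φ y)).im) x| ≤
      c * |Ω.bracket (fun y => (φ y).re) (fun y => (φ y).im) x| := by
  rw [Ω.bracket_comp (hφ.mdifferentiable (by simp) x)
    (hZ.differentiable (by simp) (φ x)).hasFDerivAt, abs_mul]
  exact mul_le_mul_of_nonneg_right (hc _) (abs_nonneg _)

theorem SymplecticForm.pbClass_mul_le (Ω : SymplecticForm E M) (r : ℝ) {X : Set M}
    (α : HomotopyClasses X Circle) {c : ℝ} (hc : 0 < c) :
    Ω.pbClass (c * r) X α ≤ ENNReal.ofReal (c ^ 2) * Ω.pbClass r X α := by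
  unfold SymplecticForm.pbClass
  have hc2 : 0 < c ^ 2 := by positivity
  rw [ENNReal.mul_iInf_of_ne (ENNReal.ofReal_pos.2 hc2).ne' ENNReal.ofReal_ne_top]
  refine le_iInf fun φ => ?_
  rw [ENNReal.mul_iInf_of_ne (ENNReal.ofReal_pos.2 hc2).ne' ENNReal.ofReal_ne_top]
  refine le_iInf fun h => (iInf₂_le _ (h.const_mul hc)).trans ?_
  refine Ω.bracketNorm_le hc2.le fun x => Ω.abs_bracket_comp_le h.1 (Z := fun z => (c : ℂ) * z)
    (contDiff_const.mul contDiff_id) fun z => ?_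
  have : HasFDerivAt (fun z : ℂ => (c : ℂ) * z) (c • ContinuousLinearMap.id ℝ ℂ) z := by
    have := (c • ContinuousLinearMap.id ℝ ℂ).hasFDerivAt (x := z)
    exact this.congr_of_eventuallyEq (Eventually.of_forall fun z => by simp)
  rw [this.fderiv]
  simp only [planeDet, smul_apply, ContinuousLinearMap.id_apply]
  simp [pow_two]

theorem SymplecticForm.pbClass_eq_mul (Ω : SymplecticForm E M) {X : Set M}
    (α : HomotopyClasses X Circle) {r : ℝ} (hr : 0 < r) :
    Ω.pbClass r X α = ENNReal.ofReal (r ^ 2) * Ω.pbClass 1 X α := by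
  refine le_antisymm (by simpa using Ω.pbClass_mul_le 1 α hr) ?_
  have h := Ω.pbClass_mul_le r α (inv_pos.2 hr)
  rw [inv_mul_cancel₀ hr.ne'] at h
  calc ENNReal.ofReal (r ^ 2) * Ω.pbClass 1 X α
      ≤ ENNReal.ofReal (r ^ 2) * (ENNReal.ofReal (r⁻¹ ^ 2) * Ω.pbClass r X α) := by gcongr
    _ = Ω.pbClass r X α := by
      rw [← mul_assoc, ← ENNReal.ofReal_mul (by positivity), ← mul_pow, mul_inv_cancel₀ hr.ne']
      simp

variable [IsManifold 𝓘(ℝ, E) ∞ M] [T2Space M] [SigmaCompactSpace M]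

variable (E) in
theorem exists_smooth_cutoff {K U : Set M} (hK : IsCompact K) (hU : IsOpen U) (hKU : K ⊆ U) :
    ∃ χ : M → ℝ, ContMDiff 𝓘(ℝ, E) 𝓘(ℝ, ℝ) ∞ χ ∧ (∀ᶠ x in 𝓝ˢ K, χ x = 1) ∧ HasCompactSupport χ ∧
      tsupport χ ⊆ U ∧ ∀ x, χ x ∈ Icc (0 : ℝ) 1 := by
  have : LocallyCompactSpace M := Manifold.locallyCompact_of_finiteDimensional 𝓘(ℝ, E)
  obtain ⟨K', hK', hKK', hK'U⟩ := exists_compact_between hK hU hKU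
  obtain ⟨χ, h1, h2, h3⟩ := exists_contMDiffMap_one_nhds_of_subset_interior (n := ⊤) 𝓘(ℝ, E)
    hK.isClosed hKK'
  have hsupp : tsupport χ ⊆ K' := closure_minimal
    (fun x hx => by by_contra hc; exact hx (h2 x hc)) hK'.isClosed
  exact ⟨χ, χ.contMDiff, h1, hK'.of_isClosed_subset isClosed_closure hsupp, hsupp.trans hK'U, h3⟩

/-- `Φ` is followed by the map to the disc. The result is constant outside a compact set, but not
necessarily zero there, so it is multiplied by a cutoff. -/
theorem SymplecticForm.pbClass_one_le (Ω : SymplecticForm E M) (Δ : MarkedDomain 3)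
    {Y : Fin 3 → Set M} {X : Set M} (hY : ∀ i, IsCompact (Y i)) (hX : X = ⋃ i, Y i)
    {α : HomotopyClasses X Circle} (hα : IsDecompositionClass X Y α) {c : ℝ} (hc : Real.pi < c)
    {Φ : M → ℂ} (hΦ : AdmissibleForTuple (E := E) Δ Y Φ) :
    Ω.pbClass 1 X α ≤ ENNReal.ofReal c * Ω.bracketNorm Φ := by
  obtain ⟨hs, -, ⟨p, -, hp⟩, hU⟩ := hΦ
  choose U hUo hYU hUarc using hU
  have hXc : IsCompact X := hX ▸ isCompact_iUnion hY
  have hXY : ∀ x ∈ X, ∃ i, x ∈ Y i := fun x hx => by rw [hX] at hx; exact mem_iUnion.1 hx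
  obtain ⟨o, ho⟩ := Δ.interior_nonempty
  obtain ⟨T, hTs, hT1, hTc, τ, hτm, hτe, hTτ⟩ := exists_map_to_disc
    (D := (fun z => z + o) ⁻¹' Δ.carrier) ((Homeomorph.addRight o).isCompact_preimage.2 Δ.isCompact)
    (Δ.convex.translate_preimage_left o) (translate_mem_nhds_zero ho)
    (by rw [MeasureTheory.measure_preimage_add_right]; exact Δ.area) hc
  obtain ⟨t, ht, hpt⟩ := Δ.ordered.exists_isDivision ho
  have hpn : ∀ i, 0 < ‖Δ.point i - o‖ := fun i =>
    norm_pos_iff.2 (sub_ne_zero_of_frontier ho (Δ.ordered.1 i))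
  have hval : ∀ i, ∀ x ∈ U i, ∃ θ ∈ Icc (t i) (nextAngle t i),
      T (Φ x - o) = Complex.exp (τ θ * Complex.I) := by
    intro i x hx
    have h1 := hUarc i x hx
    obtain ⟨θ, hθ, h2⟩ := exists_polar_of_mem_ccwArc ho h1 (hpn i) (hpn (i + 1)) (hpt i)
      (by rw [exp_nextAngle]; exact hpt (i + 1)) (ht.lt_nextAngle i).le (ht.nextAngle_lt i)
    refine ⟨θ, hθ, ?_⟩
    rw [h2]
    refine hTτ _ _ (norm_pos_iff.2 (sub_ne_zero_of_frontier ho h1.1)) ?_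
    rw [← h2, mem_frontier_translate, sub_add_cancel]
    exact h1.1
  set Z : ℂ → ℂ := fun z => T (z - o) with hZ
  have hZs : ContDiff ℝ ∞ Z := hTs.comp (contDiff_id.sub contDiff_const)
  have hZc : ∀ z, |planeDet (fderiv ℝ Z z)| ≤ c := fun z => by
    rw [show Z = fun z => T (z + -o) from funext fun z => congrArg T (sub_eq_add_neg z o),
      fderiv_comp_add_right]
    exact hTc _
  have hψs : ContMDiff 𝓘(ℝ, E) 𝓘(ℝ, ℂ) ∞ fun x => Z (Φ x) := hZs.contMDiff.comp hs
  have hKc : IsCompact (tsupport (fun x => Φ x - p) ∪ X) := IsCompact.union hp hXc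
  obtain ⟨χ, hχs, hχ1, hχc, -, hχ01⟩ := exists_smooth_cutoff E hKc isOpen_univ (subset_univ _)
  obtain ⟨V, hVo, hKV, hV⟩ := mem_nhdsSet_iff_exists.1 hχ1
  have hVχ : ∀ x ∈ V, χ x = 1 := fun x hx => hV hx
  have hnorm : ∀ i, ∀ x ∈ U i, ‖Z (Φ x)‖ = 1 := by
    intro i x hx
    obtain ⟨θ, -, h⟩ := hval i x hx
    simp only [hZ]
    rw [h, Complex.norm_exp_ofReal_mul_I]
  have hgm : ∀ x : X, Z (Φ x) ∈ Submonoid.unitSphere ℂ := fun x => by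
    obtain ⟨i, hi⟩ := hXY x x.2
    exact mem_sphere_zero_iff_norm.2 (hnorm i x (hYU i hi))
  let g : C(X, Circle) := ⟨fun x => ⟨Z (Φ x), hgm x⟩,
    (hψs.continuous.comp continuous_subtype_val).subtype_mk hgm⟩
  have hgt : SendsToArcs Y (fun i => τ (t i)) g := by
    intro i x hx
    obtain ⟨θ, hθ, h⟩ := hval i x (hYU i hx)
    refine ⟨τ θ, ⟨hτm.monotone hθ.1, ?_⟩, Circle.ext ?_⟩
    · rw [nextAngle_comp hτe]
      exact hτm.monotone hθ.2
    · rw [Circle.coe_exp]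
      exact h
  have hgα : homotopyClass g = α := by
    obtain ⟨t', ht', f, hf, hfα⟩ := isDecompositionClass_iff.1 hα
    rw [← hfα, homotopyClass_eq_iff]
    exact hgt.homotopic (fun i => (hY i).isClosed) hXY (ht.comp hτm hτe) ht' hf
  have hadm : AdmissibleForClass (E := E) 1 X α fun x => (χ x : ℂ) * Z (Φ x) := by
    refine ⟨?_, fun x => ?_, ?_, ⟨V ∩ ⋃ i, U i, hVo.inter (isOpen_iUnion hUo), ?_, ?_⟩, g, ?_, hgα⟩
    · have := hχs.smul hψs
      exact this.congr fun x => (Complex.real_smul).symm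
    · rw [mem_closedBall_zero_iff, norm_mul, Complex.norm_real, Real.norm_eq_abs,
        abs_of_nonneg (hχ01 x).1]
      exact mul_le_one₀ (hχ01 x).2 (norm_nonneg _) (hT1 _)
    · refine HasCompactSupport.mul_right (f := fun x => (χ x : ℂ)) ?_
      exact hχc.comp_left Complex.ofReal_zero
    · intro x hx
      obtain ⟨i, hi⟩ := hXY x hx
      exact ⟨hKV (Or.inr hx), mem_iUnion.2 ⟨i, hYU i hi⟩⟩
    · rintro x ⟨hxV, hxU⟩
      obtain ⟨i, hi⟩ := mem_iUnion.1 hxU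
      rw [mem_sphere_zero_iff_norm]
      change ‖(χ x : ℂ) * Z (Φ x)‖ = 1
      rw [hVχ x hxV, Complex.ofReal_one, one_mul]
      exact hnorm i x hi
    · intro x
      change (χ (x : M) : ℂ) * Z (Φ x) = ((1 : ℝ) : ℂ) * (g x : ℂ)
      rw [hVχ x (hKV (Or.inr x.2))]
      rfl
  have hc0 : 0 ≤ c := Real.pi_pos.le.trans hc.le
  refine (iInf₂_le _ hadm).trans (Ω.bracketNorm_le hc0 fun x => ?_)
  -- Near the support the cutoff is `1` and the Jacobian bound applies. Off the support the map is
  -- the cutoff times a fixed vector, so it moves in a line and its bracket vanishes.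
  by_cases hx : x ∈ tsupport fun x => Φ x - p
  · have h1 : (fun x => (χ x : ℂ) * Z (Φ x)) =ᶠ[𝓝 x] fun x => Z (Φ x) := by
      filter_upwards [hVo.mem_nhds (hKV (Or.inl hx))] with y hy
      rw [hVχ y hy, Complex.ofReal_one, one_mul]
    rw [Ω.bracket_congr h1]
    exact Ω.abs_bracket_comp_le hs hZs hZc
  · have h1 : ∀ᶠ y in 𝓝 x, (χ y : ℂ) * Z (Φ y) = χ y * Z p := by
      rw [notMem_tsupport_iff_eventuallyEq] at hx
      filter_upwards [hx] with y hy
      rw [sub_eq_zero.1 hy]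
    rw [Ω.bracket_eq_zero_of_line (hχs.mdifferentiable (by simp) x) _ h1, abs_zero]
    exact mul_nonneg hc0 (abs_nonneg _)

/-- `φ` is rotated, only where it already has values in the circle, until each `Y i` is mapped
within `δ` of the `i`-th arc; then the map from the disc is applied. -/
theorem SymplecticForm.pbTuple_le (Ω : SymplecticForm E M) (Δ : MarkedDomain 3)
    {Y : Fin 3 → Set M} {X : Set M} (hY : ∀ i, IsCompact (Y i)) (hX : X = ⋃ i, Y i)
    (hempty : ∀ x, ∃ i, x ∉ Y i) {α : HomotopyClasses X Circle}
    (hα : IsDecompositionClass X Y α) {c : ℝ} (hc : 1 / Real.pi < c)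
    {φ : M → ℂ} (hφ : AdmissibleForClass (E := E) 1 X α φ) :
    Ω.pbTuple Δ Y ≤ ENNReal.ofReal c * Ω.bracketNorm φ := by
  obtain ⟨hs, hball, hsupp, ⟨U, hUo, hXU, hU⟩, g, hg, hgα⟩ := hφ
  have : LocallyCompactSpace M := Manifold.locallyCompact_of_finiteDimensional 𝓘(ℝ, E)
  have hXc : IsCompact X := hX ▸ isCompact_iUnion hY
  have hXY : ∀ x ∈ X, ∃ i, x ∈ Y i := fun x hx => by rw [hX] at hx; exact mem_iUnion.1 hx
  have hYX : ∀ i, Y i ⊆ X := fun i => hX ▸ subset_iUnion Y i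
  obtain ⟨o, ho⟩ := Δ.interior_nonempty
  obtain ⟨s, hs3, hps⟩ := Δ.ordered.exists_isDivision ho
  have hpn : ∀ i, 0 < ‖Δ.point i - o‖ := fun i =>
    norm_pos_iff.2 (sub_ne_zero_of_frontier ho (Δ.ordered.1 i))
  have hDc : IsCompact ((fun z => z + o) ⁻¹' Δ.carrier) :=
    (Homeomorph.addRight o).isCompact_preimage.2 Δ.isCompact
  have hDconv := Δ.convex.translate_preimage_left o
  have hD0 := translate_mem_nhds_zero ho
  obtain ⟨S, hSs, hSD, hS0, hSc, t, ht, δ, hδ, hSt⟩ := exists_map_from_disc hDc hDconv hD0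
    (by rw [MeasureTheory.measure_preimage_add_right]; exact Δ.area)
    (piecewiseSmooth_dirGauge hDc hDconv hD0 (boundary_translate Δ.boundary)) hs3 hc
  obtain ⟨f, hf⟩ := exists_sendsToArcs_of_manifold E hY hX hempty ht
  have hfg : f.Homotopic g := by
    obtain ⟨t', ht', f', hf', hfα⟩ := isDecompositionClass_iff.1 hα
    rw [← homotopyClass_eq_iff, hgα, ← hfα, homotopyClass_eq_iff]
    exact hf.homotopic (fun i => (hY i).isClosed) hXY ht ht' hf'
  obtain ⟨h, hh⟩ := hfg.exists_eq_mul_exp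
  obtain ⟨H, hH⟩ := h.exists_restrict_eq hXc.isClosed
  obtain ⟨H', hH', -⟩ := H.continuous.exists_contMDiff_approx 𝓘(ℝ, E) ⊤ (ε := fun _ => δ)
    continuous_const fun _ => hδ
  obtain ⟨χ, hχs, hχ1, -, hχU, -⟩ := exists_smooth_cutoff E hXc hUo hXU
  -- The restriction of `φ` to `X` is `f * exp (i h)`, and `H'` is within `δ` of an extension of
  -- `h`. Hence on `X` the map `ψ` is `f` rotated by less than `δ`.
  set ψ : M → ℂ := fun x => φ x * Complex.exp ((-(χ x * H' x) : ℝ) * Complex.I) with hψ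
  have hψs : ContMDiff 𝓘(ℝ, E) 𝓘(ℝ, ℂ) ∞ ψ := by
    have h1 : ContDiff ℝ ∞ fun r : ℝ => Complex.exp ((-r : ℝ) * Complex.I) :=
      ((Complex.ofRealCLM.contDiff.comp contDiff_neg).mul contDiff_const).cexp
    exact (contDiff_mul (𝕜 := ℝ) (𝔸 := ℂ)).contMDiff.comp
      (hs.prodMk_space (h1.contMDiff.comp (hχs.smul H'.contMDiff)))
  have hψn : ∀ x, ‖ψ x‖ = ‖φ x‖ := fun x => by
    simp only [hψ]
    rw [norm_mul, Complex.norm_exp_ofReal_mul_I, mul_one]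
  have hφU : ∀ x ∈ U, ‖φ x‖ = 1 := fun x hx => mem_sphere_zero_iff_norm.1 (hU x hx)
  set Z : ℂ → ℂ := fun z => S z + o with hZ
  have hZs : ContDiff ℝ ∞ Z := hSs.add contDiff_const
  have hZc : ∀ z, |planeDet (fderiv ℝ Z z)| ≤ c := fun z => by
    rw [hZ, fderiv_add_const]
    exact hSc _
  have hadm : AdmissibleForTuple (E := E) Δ Y fun x => Z (ψ x) := by
    refine ⟨hZs.contMDiff.comp hψs, fun x => hSD _, ⟨o, interior_subset ho, ?_⟩, fun i => ?_⟩
    · refine hsupp.mono fun x hx => ?_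
      rw [Function.mem_support] at hx ⊢
      intro h0
      refine hx ?_
      simp only [hZ, hψ]
      rw [h0, zero_mul, hS0, zero_add, sub_self]
    -- `W` is the open sector over the arc enlarged by `δ`. On `U` the values of `ψ` have norm one,
    -- so `W` contributes only points of the enlarged arc of the circle.
    · set W : Set ℂ := Complex.exp '' {w | w.im ∈ Ioo (t i - δ) (nextAngle t i + δ)} with hW
      have hWo : IsOpen W := Complex.isOpenMap_exp _ (isOpen_Ioo.preimage Complex.continuous_im)
      refine ⟨U ∩ ψ ⁻¹' W, hUo.inter (hWo.preimage hψs.continuous), fun x hx => ⟨hXU (hYX i hx), ?_⟩,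
        fun x hx => ?_⟩
      · obtain ⟨θ, hθ, hfθ⟩ := hf i ⟨x, hYX i hx⟩ hx
        have h1 : H x = h ⟨x, hYX i hx⟩ := by rw [← hH]; rfl
        have h2 := hH' x
        rw [Real.dist_eq, abs_lt] at h2
        refine ⟨((θ + H x - H' x : ℝ) : ℂ) * Complex.I, ?_, ?_⟩
        · have him : (((θ + H x - H' x : ℝ) : ℂ) * Complex.I).im = θ + H x - H' x := by
            rw [Complex.im_ofReal_mul, Complex.I_im, mul_one]
          change _ ∈ Ioo _ _
          rw [him]
          exact ⟨by linarith [hθ.1], by linarith [hθ.2]⟩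
        · have h3 := hg ⟨x, hYX i hx⟩
          rw [hh, hfθ, ← h1, ← Circle.exp_add, Circle.coe_exp] at h3
          simp only [hψ]
          rw [h3, hχ1.self_of_nhdsSet x (hYX i hx), Complex.ofReal_one, one_mul, ← Complex.exp_add]
          push_cast
          ring_nf
      · obtain ⟨hxU, w, hw, hwx⟩ := hx
        have hre : w.re = 0 := by
          have h1 := hψn x
          rw [hφU x hxU, ← hwx, Complex.norm_exp] at h1
          exact Real.exp_eq_one_iff _ |>.1 h1
        have hw' : w = (w.im : ℂ) * Complex.I := by
          apply Complex.ext <;> simp [hre]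
        obtain ⟨hfr, r, θ, hr, hθ, hSθ⟩ := hSt i w.im hw
        rw [← hw', hwx] at hfr hSθ
        refine Δ.convex.mem_ccwArc_of_polar ho (Δ.ordered.1 i) (Δ.ordered.1 (i + 1))
          (mem_frontier_translate.1 hfr) (hpn i) (hpn (i + 1)) hr (hps i)
          (by rw [exp_nextAngle]; exact hps (i + 1)) ?_ hθ.1 hθ.2 (hs3.nextAngle_lt i)
        rw [add_sub_cancel_right, hSθ]
  have hc0 : 0 ≤ c := (by positivity : 0 ≤ 1 / Real.pi).trans hc.le
  refine (iInf₂_le _ hadm).trans (Ω.bracketNorm_le hc0 fun x => ?_)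
  refine (Ω.abs_bracket_comp_le hψs hZs hZc).trans (mul_le_mul_of_nonneg_left ?_ hc0)
  -- Near the support of the cutoff `ψ` has values in the circle and zero bracket; elsewhere it
  -- agrees locally with `φ`.
  by_cases hx : x ∈ tsupport χ
  · have h1 : ∀ᶠ y in 𝓝 x, ‖ψ y‖ = 1 := by
      filter_upwards [hUo.mem_nhds (hχU hx)] with y hy
      rw [hψn, hφU y hy]
    rw [Ω.bracket_eq_zero_of_sphere (hψs.mdifferentiable (by simp) x) h1, abs_zero]
    exact abs_nonneg _
  · have h1 : ψ =ᶠ[𝓝 x] φ := by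
      rw [notMem_tsupport_iff_eventuallyEq] at hx
      filter_upwards [hx] with y hy
      simp only [hψ]
      rw [hy]
      simp
    rw [Ω.bracket_congr h1]

end Invariants

theorem ENNReal.le_ofReal_mul_of_forall_lt {a b : ENNReal} {k : ℝ} (hk : 0 < k)
    (h : ∀ c, k < c → a ≤ ENNReal.ofReal c * b) : a ≤ ENNReal.ofReal k * b := by
  have h1 : Tendsto (fun c : ℝ => ENNReal.ofReal c * b) (𝓝[>] k) (𝓝 (ENNReal.ofReal k * b)) := by
    refine ENNReal.Tendsto.mul_const ?_ (Or.inl (by simpa using hk))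
    exact ((ENNReal.continuous_ofReal.tendsto k)).mono_left nhdsWithin_le_nhds
  refine ge_of_tendsto h1 ?_
  filter_upwards [self_mem_nhdsWithin] with c hc using h c hc

theorem mainTheorem4 {E M : Type*} [NormedAddCommGroup E] [NormedSpace ℝ E]
    [FiniteDimensional ℝ E] [TopologicalSpace M] [ChartedSpace E M] [IsManifold 𝓘(ℝ, E) ∞ M]
    [T2Space M] [SigmaCompactSpace M] (Ω : SymplecticForm E M) (Δ : MarkedDomain 3)
    (X X₁ X₂ X₃ : Set M) (hX₁ : IsCompact X₁) (hX₂ : IsCompact X₂) (hX₃ : IsCompact X₃)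
    (hX : X = X₁ ∪ X₂ ∪ X₃) (hempty : X₁ ∩ X₂ ∩ X₃ = ∅) :
    (∃! α : HomotopyClasses X Circle, IsDecompositionClass X ![X₁, X₂, X₃] α) ∧
    ∀ α : HomotopyClasses X Circle, IsDecompositionClass X ![X₁, X₂, X₃] α →
      Ω.pbTuple Δ ![X₁, X₂, X₃] = Ω.pbClass (1 / √Real.pi) X α ∧
      Ω.pbClass 1 X α = ENNReal.ofReal Real.pi * Ω.pbTuple Δ ![X₁, X₂, X₃] := by
  have hpi := Real.pi_pos
  have hY : ∀ i, IsCompact (![X₁, X₂, X₃] i) := by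
    intro i
    fin_cases i
    exacts [hX₁, hX₂, hX₃]
  have hXY : X = ⋃ i, ![X₁, X₂, X₃] i := by
    ext x
    simp [hX, Fin.exists_fin_succ, or_assoc]
  have hXY' : ∀ x ∈ X, ∃ i, x ∈ ![X₁, X₂, X₃] i := fun x hx => by
    rw [hXY] at hx
    exact mem_iUnion.1 hx
  have hemp : ∀ x, ∃ i, x ∉ ![X₁, X₂, X₃] i := by
    intro x
    by_contra hc
    push Not at hc
    have : x ∈ X₁ ∩ X₂ ∩ X₃ := ⟨⟨hc 0, hc 1⟩, hc 2⟩
    rw [hempty] at this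
    exact this
  refine ⟨?_, fun α hα => ?_⟩
  -- Any division serves for existence; this one is valid because `2 < 2π`.
  · have ht : IsDivision ![0, 1, 2] := by
      refine ⟨by simp, by simp, ?_⟩
      change (2 : ℝ) < 0 + 2 * Real.pi
      linarith [Real.pi_gt_three]
    obtain ⟨f, hf⟩ := exists_sendsToArcs_of_manifold E hY hXY hemp ht
    refine ⟨homotopyClass f, isDecompositionClass_iff.2 ⟨_, ht, f, hf, rfl⟩, fun β hβ => ?_⟩
    obtain ⟨t', ht', f', hf', rfl⟩ := isDecompositionClass_iff.1 hβ
    rw [homotopyClass_eq_iff]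
    exact hf'.homotopic (fun i => (hY i).isClosed) hXY' ht' ht hf
  · have h1 : Ω.pbClass 1 X α ≤ ENNReal.ofReal Real.pi * Ω.pbTuple Δ ![X₁, X₂, X₃] := by
      refine ENNReal.le_ofReal_mul_of_forall_lt hpi fun c hc => ?_
      have hc0 : ENNReal.ofReal c ≠ 0 := by simpa using hpi.trans hc
      unfold SymplecticForm.pbTuple
      rw [ENNReal.mul_iInf_of_ne hc0 ENNReal.ofReal_ne_top]
      refine le_iInf fun Φ => ?_
      rw [ENNReal.mul_iInf_of_ne hc0 ENNReal.ofReal_ne_top]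
      exact le_iInf fun hΦ => Ω.pbClass_one_le Δ hY hXY hα hc hΦ
    have h2 : Ω.pbTuple Δ ![X₁, X₂, X₃] ≤ ENNReal.ofReal (1 / Real.pi) * Ω.pbClass 1 X α := by
      refine ENNReal.le_ofReal_mul_of_forall_lt (by positivity) fun c hc => ?_
      have hc0 : ENNReal.ofReal c ≠ 0 := by
        simpa using lt_trans (by positivity : 0 < 1 / Real.pi) hc
      unfold SymplecticForm.pbClass
      rw [ENNReal.mul_iInf_of_ne hc0 ENNReal.ofReal_ne_top]
      refine le_iInf fun φ => ?_
      rw [ENNReal.mul_iInf_of_ne hc0 ENNReal.ofReal_ne_top]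
      exact le_iInf fun hφ => Ω.pbTuple_le Δ hY hXY hemp hα hc hφ
    have h3 : Ω.pbClass 1 X α = ENNReal.ofReal Real.pi * Ω.pbTuple Δ ![X₁, X₂, X₃] := by
      refine le_antisymm h1 ?_
      calc ENNReal.ofReal Real.pi * Ω.pbTuple Δ ![X₁, X₂, X₃]
          ≤ ENNReal.ofReal Real.pi * (ENNReal.ofReal (1 / Real.pi) * Ω.pbClass 1 X α) := by gcongr
        _ = Ω.pbClass 1 X α := by
          rw [← mul_assoc, ← ENNReal.ofReal_mul hpi.le, mul_one_div_cancel hpi.ne']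
          simp
    refine ⟨?_, h3⟩
    -- Scaling the disc by `r` multiplies the bracket by `r²`; for `r = 1 / √π` this cancels the
    -- factor `π`.
    rw [Ω.pbClass_eq_mul α (by positivity), h3, ← mul_assoc, ← ENNReal.ofReal_mul (by positivity),
      div_pow, one_pow, Real.sq_sqrt hpi.le, one_div_mul_cancel hpi.ne']
    simp
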